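/- For $a\in(0,1)$ let $K_a$ be the even kernel on $\mathbb R$ whose Fourier transform $\int K_a(x)e^{-ix\xi}\,dx$ is $(\tanh\xi/\xi)^a$; thus $K_a*f$, $f\in L^2(\mathbb R)$, is the Fourier multiplier operator with this symbol. For $\alpha>0$ let $\Psi=\Psi_\alpha:\mathbb R\to[0,\infty)$ be the even function with $$\Psi(y)=\alpha y^2-\tfrac13y^3\quad(0\le y<\alpha),\qquad \Psi(y)=\tfrac23\alpha^3+\alpha^2(y-\alpha)+(y-\alpha)^3\quad(y\ge\alpha),$$ let $\mathcal L^\Psi$ be the corresponding Orlicz space of real functions on $\mathbb R$, i.e. the measurable $f$ with $\int\Psi(cf)\,dx<\infty$ for some $c>0$ (it equals $L^2\cap L^3$), and let $N_\Psi(f)=\inf\{\lambda>0:\int_{\mathbb R}\Psi(f/\lambda)\,dx\le1\}$ be its gauge norm. A *maximiser* (for $\alpha$) is a function $f\in\mathcal L^\Psi$ with $N_\Psi(f)=1$ that maximises $\|K_{1/4}*f\|_{L^2}$ among all functions in $\mathcal L^\Psi$ with $N_\Psi=1$. A function is *bell-shaped* if it is almost everywhere equal to an even, nonnegative function that is nonincreasing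 on $(0,\infty)$. Write $\langle f,\Psi'(f)\rangle=\int_{\mathbb R} f\,\Psi'(f)\,dx$. For every $\alpha>0$, every bell-shaped maximiser has a continuous representative; $f_\alpha$ denotes this representative. For all $\alpha>0$, every bell-shaped maximiser $f_\alpha$ satisfies: 1. $f_\alpha(0)\le\frac{4}{\sqrt3}\cos\left(\frac{5\pi}{18}\right)\alpha$, where $\left|\frac{4}{\sqrt3}\cos\left(\frac{5\pi}{18}\right)-1.48\right|<0.005$; 2. $1<\langle f_\alpha,\Psi'(f_\alpha)\rangle<2$; 3. $f_\alpha\in L^1$ and $\|f_\alpha\|_{L^1}+|xf_\alpha(x)|\le C(1+\alpha^{-2})$ for all $x\in\mathbb R$, with an absolute constant $C$; 4. $f_\alpha\in L^3$ and $\|f_\alpha\|_{L^3}^3\ge \frac{c}{1+\alpha^2}$, with an absolute constant $c>0$; 5. $f_\alpha\in L^\infty$ and, for each $\delta\in(0,\frac32]$, $\|f_\alpha\|_{L^\infty}\le C_\delta\,\alpha^{-\frac12+\delta}$, with a constant $C_\delta$ depending only on $\delta$. For each $\delta>0$ and $\alpha_1>0$ the same bound holds for all $\alpha\ge\alpha_1$,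 with a constant depending only on $\delta$ and $\alpha_1$. Moreover, there is a number $\alpha_0\ge0$ such that for every $\alpha>\alpha_0$ there is a bell-shaped maximiser $f_\alpha$ with $f_\alpha(0)<\alpha$. -/

import Mathlib

open MeasureTheory Set
open scoped ENNReal FourierTransform

namespace Whitham

noncomputable section

/-- The symbol `(tanh ξ / ξ) ^ a`, with its limit value `1` at the origin. It is the Fourier
transform of the kernel `K_a` in the normalisation `∫ f(x) e^{-ixξ} dx`. -/
def symbol (a ξ : ℝ) : ℝ := if ξ = 0 then 1 else (Real.tanh ξ / ξ) ^ a

theorem tanh_div_mem {ξ : ℝ} (h : ξ ≠ 0) : 0 ≤ Real.tanh ξ / ξ ∧ Real.tanh ξ / ξ ≤ 1 := by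
  have key : ∀ x : ℝ, 0 < x → 0 ≤ Real.tanh x ∧ Real.tanh x ≤ x := by
    intro x hx
    have hc := Real.cosh_pos x
    rw [Real.tanh_eq_sinh_div_cosh]
    refine ⟨div_nonneg (Real.sinh_nonneg_iff.2 hx.le) hc.le, ?_⟩
    rw [div_le_iff₀ hc]
    have hmono : MonotoneOn (fun t : ℝ => t * Real.cosh t - Real.sinh t) (Ici 0) := by
      refine monotoneOn_of_deriv_nonneg (convex_Ici 0) (by fun_prop) (by fun_prop) ?_
      intro t ht
      have ht' : 0 < t := by simpa using ht
      have hd : HasDerivAt (fun t : ℝ => t * Real.cosh t - Real.sinh t)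
          (1 * Real.cosh t + t * Real.sinh t - Real.cosh t) t :=
        ((hasDerivAt_id' t).mul (Real.hasDerivAt_cosh t)).sub (Real.hasDerivAt_sinh t)
      rw [hd.deriv]
      have := mul_nonneg ht'.le (Real.sinh_nonneg_iff.2 ht'.le)
      linarith
    have := hmono (mem_Ici.2 le_rfl) (mem_Ici.2 hx.le) hx.le
    simp only [Real.sinh_zero, zero_mul, sub_zero] at this
    linarith
  rcases lt_or_gt_of_ne h with h' | h'
  · obtain ⟨h1, h2⟩ := key (-ξ) (by linarith)
    rw [Real.tanh_neg] at h1 h2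
    rw [← neg_div_neg_eq]
    exact ⟨div_nonneg h1 (by linarith), (div_le_one (by linarith)).2 h2⟩
  · obtain ⟨h1, h2⟩ := key ξ h'
    exact ⟨div_nonneg h1 h'.le, (div_le_one h').2 h2⟩

theorem symbol_mem {a : ℝ} (ha : 0 ≤ a) (ξ : ℝ) : 0 ≤ symbol a ξ ∧ symbol a ξ ≤ 1 := by
  unfold symbol
  split_ifs with h
  · exact ⟨zero_le_one, le_rfl⟩
  · obtain ⟨h1, h2⟩ := tanh_div_mem h
    exact ⟨Real.rpow_nonneg h1 a, Real.rpow_le_one h1 h2 ha⟩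

theorem measurable_symbol (a : ℝ) : Measurable (symbol a) := by
  unfold symbol
  have ht : Measurable Real.tanh := by
    have : Real.tanh = fun x => Real.sinh x / Real.cosh x :=
      funext Real.tanh_eq_sinh_div_cosh
    rw [this]
    exact Real.measurable_sinh.div Real.measurable_cosh
  exact Measurable.ite (measurableSet_singleton 0) measurable_const
    ((ht.div measurable_id).pow_const a)

/-- Mathlib's Fourier transform has the phase `e^{-2πixξ}`, whence the factor `2π`. -/
theorem memLp_symbol {a : ℝ} (ha : 0 ≤ a) :
    MemLp (fun ξ : ℝ => (symbol a (2 * Real.pi * ξ) : ℂ)) ∞ volume := by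
  refine memLp_top_of_bound ?_ 1 (Filter.Eventually.of_forall fun ξ => ?_)
  · exact (Complex.measurable_ofReal.comp
      ((measurable_symbol a).comp (measurable_const.mul measurable_id))).aestronglyMeasurable
  · obtain ⟨h1, h2⟩ := symbol_mem ha (2 * Real.pi * ξ)
    rw [Complex.norm_real, Real.norm_eq_abs, abs_of_nonneg h1]
    exact h2

/-- The operator `L_a f = K_a * f` on `L²(ℝ)`, `a ≥ 0`: the Fourier multiplier operator with
symbol `K̂_a(ξ) = (tanh ξ / ξ) ^ a`. -/
def convK (a : ℝ) (ha : 0 ≤ a) (f : Lp (α := ℝ) ℂ 2) : Lp (α := ℝ) ℂ 2 :=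
  𝓕⁻ (((memLp_symbol ha).toLp _ • 𝓕 f : Lp (α := ℝ) ℂ 2))

/-- The functional `𝓙(f) = ‖K_{1/4} * f‖_{L²}` for real functions `f ∈ L²(ℝ)`.
(The value `0` off `L²` is never used: see `memLp_two_of_memOrlicz`.) -/
def J (f : ℝ → ℝ) : ℝ :=
  open Classical in
  if h : MemLp (fun x => (f x : ℂ)) 2 volume then ‖convK (1 / 4) (by norm_num) (h.toLp _)‖ else 0

/-- The Young function `Ψ = Ψ_α`, extended to the negative half-axis as an even function. -/
def Psi (α y : ℝ) : ℝ :=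
  if |y| < α then α * |y| ^ 2 - 1 / 3 * |y| ^ 3
  else 2 / 3 * α ^ 3 + α ^ 2 * (|y| - α) + (|y| - α) ^ 3

/-- Membership in the Orlicz space `𝓛^Ψ` over `ℝ` with Lebesgue measure. -/
def MemOrlicz (α : ℝ) (f : ℝ → ℝ) : Prop :=
  AEStronglyMeasurable f volume ∧
    ∃ c : ℝ, 0 < c ∧ ∫⁻ x, ENNReal.ofReal (Psi α (c * f x)) < ∞

/-- The gauge norm `N_Ψ(f) = inf {λ > 0 : ∫ Ψ(f / λ) ≤ 1}`. -/
def gaugeNorm (α : ℝ) (f : ℝ → ℝ) : ℝ :=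
  sInf {l : ℝ | 0 < l ∧ ∫⁻ x, ENNReal.ofReal (Psi α (f x / l)) ≤ 1}

/-- The constraint set `{f ∈ 𝓛^Ψ : N_Ψ(f) = 1}`. -/
def constraintSet (α : ℝ) : Set (ℝ → ℝ) := {f | MemOrlicz α f ∧ gaugeNorm α f = 1}

/-- `f` maximises `‖K_{1/4} * f‖_{L²}` under the constraint `N_Ψ(f) = 1`. -/
def IsMaximizer (α : ℝ) (f : ℝ → ℝ) : Prop :=
  f ∈ constraintSet α ∧ IsMaxOn J (constraintSet α) f

/-- Bell-shapedness (of the almost-everywhere class): almost everywhere equal to an even,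
nonnegative function that is nonincreasing on the open positive half-axis. -/
def BellShaped (f : ℝ → ℝ) : Prop :=
  ∃ g : ℝ → ℝ, (∀ x, 0 ≤ g x) ∧ (∀ x, g (-x) = g x) ∧ AntitoneOn g (Ioi 0) ∧ f =ᵐ[volume] g

/-- The pairing `⟨f, Ψ'(f)⟩ = ∫ f Ψ'(f) dx`. -/
def pairing (α : ℝ) (f : ℝ → ℝ) : ℝ := ∫ x, f x * deriv (Psi α) (f x)

/-- The constant `(4/√3) cos (5π/18) ≈ 1.48`. -/
def heightConst : ℝ := 4 / Real.sqrt 3 * Real.cos (5 * Real.pi / 18)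

theorem sq_le_Psi {α : ℝ} (hα : 0 < α) (y : ℝ) : α / 3 * |y| ^ 2 ≤ Psi α y := by
  unfold Psi
  have h0 := abs_nonneg y
  split_ifs with h
  · nlinarith [mul_nonneg (sq_nonneg |y|) (sub_nonneg.2 h.le)]
  · obtain ⟨s, hs⟩ : ∃ s, |y| = α + s := ⟨|y| - α, by ring⟩
    have hs0 : 0 ≤ s := by linarith
    rw [hs]
    have h1 : 0 ≤ s * (s - α) ^ 2 := mul_nonneg hs0 (sq_nonneg _)
    have h2 : 0 ≤ α * (s - α) ^ 2 := mul_nonneg hα.le (sq_nonneg _)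
    have h3 : 0 ≤ α * s ^ 2 := mul_nonneg hα.le (sq_nonneg _)
    have h4 : 0 ≤ α ^ 2 * s := by positivity
    have h5 : 0 ≤ s ^ 3 := by positivity
    have h6 : 0 < α ^ 3 := by positivity
    nlinarith

/-- Every function in the Orlicz space lies in `L²`, so `J` is the genuine functional there. -/
theorem memLp_two_of_memOrlicz {α : ℝ} (hα : 0 < α) {f : ℝ → ℝ} (hf : MemOrlicz α f) :
    MemLp (fun x => (f x : ℂ)) 2 volume := by
  obtain ⟨hm, c, hc, hint⟩ := hf
  have hm' : AEStronglyMeasurable (fun x => (f x : ℂ)) volume :=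
    Complex.continuous_ofReal.comp_aestronglyMeasurable hm
  rw [memLp_two_iff_integrable_sq_norm hm']
  have hk : 0 < α / 3 * c ^ 2 := by positivity
  have hI : Integrable (fun x => α / 3 * c ^ 2 * ‖(f x : ℂ)‖ ^ 2) volume := by
    refine ⟨(hm'.norm.pow 2).const_mul _, ?_⟩
    rw [hasFiniteIntegral_iff_ofReal (Filter.Eventually.of_forall fun x => by positivity)]
    refine lt_of_le_of_lt (lintegral_mono fun x => ENNReal.ofReal_le_ofReal ?_) hint
    have := sq_le_Psi hα (c * f x)
    rw [abs_mul, mul_pow, sq_abs c] at this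
    rw [Complex.norm_real, Real.norm_eq_abs]
    linarith
  have := hI.const_mul (α / 3 * c ^ 2)⁻¹
  refine this.congr (Filter.Eventually.of_forall fun x => ?_)
  simp only
  field_simp

end

end Whitham

namespace Whitham

open Filter Topology

/-! The square of `J` is the quadratic form of the kernel with symbol (tanh ξ / ξ)^(1/2), and
everything rests on the structure of that kernel. The function (tan z / z)^(1/2) is holomorphic in
the upper half-plane and restricts to the symbol on the imaginary axis. A contour integral over a
quarter-plane therefore writes the symbol as an average of Lorentzians s² / (s² + ξ²), s > 1,
against a probability measure `mixing`. Hence the kernel is an average of Laplace densities: even,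
nonnegative, decreasing, of mass one and with finite second moment (`isWhithamKernel_kernel`). Two
tools follow: the Riesz rearrangement inequality (`energy_le_rearr`), and `diffForm_eq`, which
expresses ∫ f² - J(f)² as a nonnegative difference form. Long low tents then show that the maximum
of J² exceeds 1/α by a quantitative amount (`exists_test`).

A bell-shaped maximiser is bounded, because cutting it off high up frees more of the constraint than
it costs (`exists_ae_le`). It solves K * f = μ Ψ'(f) with μ = J(f)² / ⟨f, Ψ'(f)⟩ (`euler_lagrange`),
and inverting Ψ' gives continuity. To bound the height, slice f into its superlevel intervals, of
half-width r(t). The equation at r(s), integrated over s, and the equation at the origin together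
give f(0) Ψ'(f(0)) ≤ 2 Ψ(f(0)), since the primitive of the kernel is odd and increasing
(`mul_dPsi_zero_le`). This is exactly f(0) ≤ `heightConst` * α. Below that height yΨ' ≤ 2Ψ, so the
pairing is below 2 and μ > 1/(2α).

The remaining bounds use this lower bound for μ and the gain over 1/α. Integrating the equation over
[-T, T] bounds the mass there (`setIntegral_bound`). The cubic term of Ψ must account for the gain,
which bounds ∫ f³ below. At the origin, the equation compares f(0) with f(r) for one fixed r, and ∫
f² ≤ 3/α then yields f(0) ≤ C α^(-1/2), stronger than the supremum bounds that are claimed for large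
α.

For existence at large α one maximises `excess`, that is J² - α⁻¹ ∫ Ψ(f), over bell-shaped functions
of height at most α. There the quadratic terms combine into minus a lower semicontinuous form, and
the rest is a cubic term that is continuous under almost everywhere convergence, so Helly selection
produces a maximiser. For large α truncation at height α does not lower `excess`. A scaling argument
shows that the constraint is saturated, and rearrangement reduces arbitrary competitors to
bell-shaped ones (`exists_maximizer`). -/

/-! ### The branch of (tan z / z)^(1/2) in the upper half-plane. -/

theorem normSq_complex_sin (z : ℂ) :
    Complex.normSq (Complex.sin z) = Real.sin z.re ^ 2 + Real.sinh z.im ^ 2 := by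
  rw [Complex.sin_eq]
  have h1 := Real.sin_sq_add_cos_sq z.re
  have h2 := Real.cosh_sq z.im
  simp only [Complex.normSq_apply, Complex.add_re, Complex.mul_re, Complex.add_im, Complex.mul_im,
    ← Complex.ofReal_sin, ← Complex.ofReal_cos, ← Complex.ofReal_sinh, ← Complex.ofReal_cosh,
    Complex.ofReal_re, Complex.ofReal_im, Complex.I_re, Complex.I_im]
  ring_nf
  rw [h2]
  linear_combination (Real.sinh z.im) ^ 2 * h1

theorem normSq_complex_cos (z : ℂ) :
    Complex.normSq (Complex.cos z) = Real.cos z.re ^ 2 + Real.sinh z.im ^ 2 := by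
  rw [Complex.cos_eq]
  have h1 := Real.sin_sq_add_cos_sq z.re
  have h2 := Real.cosh_sq z.im
  simp only [Complex.normSq_apply, Complex.sub_re, Complex.mul_re, Complex.sub_im, Complex.mul_im,
    ← Complex.ofReal_sin, ← Complex.ofReal_cos, ← Complex.ofReal_sinh, ← Complex.ofReal_cosh,
    Complex.ofReal_re, Complex.ofReal_im, Complex.I_re, Complex.I_im]
  ring_nf
  rw [h2]
  linear_combination (Real.sinh z.im) ^ 2 * h1

theorem complex_cos_ne_zero {z : ℂ} (hz : 0 < z.im) : Complex.cos z ≠ 0 := by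
  rw [← Complex.normSq_pos, normSq_complex_cos]
  have := Real.sinh_pos_iff.2 hz
  positivity

theorem complex_sin_ne_zero {z : ℂ} (hz : 0 < z.im) : Complex.sin z ≠ 0 := by
  rw [← Complex.normSq_pos, normSq_complex_sin]
  have := Real.sinh_pos_iff.2 hz
  positivity

theorem complex_tan_ne_zero {z : ℂ} (hz : 0 < z.im) : Complex.tan z ≠ 0 :=
  div_ne_zero (complex_sin_ne_zero hz) (complex_cos_ne_zero hz)

/-- The tangent preserves the upper half-plane, so the principal logarithm is holomorphic along it
and no other branch is needed. -/
theorem complex_tan_im_pos {z : ℂ} (hz : 0 < z.im) : 0 < (Complex.tan z).im := by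
  have h1 := Real.sin_sq_add_cos_sq z.re
  have hs := Real.sinh_pos_iff.2 hz
  have hc := Real.cosh_pos z.im
  have hn : 0 < Complex.normSq (Complex.cos z) := Complex.normSq_pos.2 (complex_cos_ne_zero hz)
  have : (Complex.tan z).im = Real.sinh z.im * Real.cosh z.im / Complex.normSq (Complex.cos z) := by
    have e : ∀ w : ℂ, (Complex.sin w).re = Real.sin w.re * Real.cosh w.im ∧
        (Complex.sin w).im = Real.cos w.re * Real.sinh w.im ∧
        (Complex.cos w).re = Real.cos w.re * Real.cosh w.im ∧
        (Complex.cos w).im = -(Real.sin w.re * Real.sinh w.im) := by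
      intro w
      have e1 : Complex.sin w = ((Real.sin w.re * Real.cosh w.im : ℝ) : ℂ) +
          ((Real.cos w.re * Real.sinh w.im : ℝ) : ℂ) * Complex.I := by
        rw [Complex.sin_eq]; push_cast; ring
      have e2 : Complex.cos w = ((Real.cos w.re * Real.cosh w.im : ℝ) : ℂ) +
          ((-(Real.sin w.re * Real.sinh w.im) : ℝ) : ℂ) * Complex.I := by
        rw [Complex.cos_eq]; push_cast; ring
      rw [e1, e2]
      simp only [Complex.add_re, Complex.add_im, Complex.ofReal_re, Complex.ofReal_im,
        Complex.re_ofReal_mul, Complex.im_ofReal_mul, Complex.I_re, Complex.I_im]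
      refine ⟨?_, ?_, ?_, ?_⟩ <;> ring
    obtain ⟨e1, e2, e3, e4⟩ := e z
    rw [Complex.tan, Complex.div_im, ← sub_div, e1, e2, e3, e4]
    congr 1
    linear_combination Real.sinh z.im * Real.cosh z.im * h1
  rw [this]
  positivity

theorem normSq_complex_tan (z : ℂ) : ‖Complex.tan z‖ ^ 2 =
    (Real.sin z.re ^ 2 + Real.sinh z.im ^ 2) / (Real.cos z.re ^ 2 + Real.sinh z.im ^ 2) := by
  rw [Complex.tan, norm_div, div_pow, ← Complex.normSq_eq_norm_sq, ← Complex.normSq_eq_norm_sq,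
    normSq_complex_sin, normSq_complex_cos]

theorem norm_complex_tan_le_cosh_div {z : ℂ} (hz : Real.cos z.re ≠ 0) :
    ‖Complex.tan z‖ ≤ Real.cosh z.im / |Real.cos z.re| := by
  have hc := Real.cosh_pos z.im
  refine le_of_sq_le_sq ?_ (by positivity)
  rw [normSq_complex_tan, div_pow, sq_abs, Real.cosh_sq]
  have h1 := Real.sin_sq_le_one z.re
  have h2 : 0 < Real.cos z.re ^ 2 := by positivity
  have h3 := sq_nonneg (Real.sinh z.im)
  exact div_le_div₀ (by positivity) (by linarith) h2 (by linarith)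

theorem norm_complex_tan_le_two {z : ℂ} (hz : 1 ≤ z.im) : ‖Complex.tan z‖ ≤ 2 := by
  refine le_of_sq_le_sq ?_ (by positivity)
  rw [normSq_complex_tan]
  have h0 : 1 ≤ Real.sinh z.im := hz.trans (Real.self_le_sinh_iff.2 (by linarith))
  have h1 := Real.sin_sq_le_one z.re
  have h2 := sq_nonneg (Real.cos z.re)
  have h3 : 1 ≤ Real.sinh z.im ^ 2 := by nlinarith
  rw [div_le_iff₀ (by positivity)]
  nlinarith

/-- The sine vanishes on these vertical lines, which keep away from the poles of the tangent; this
is why the contours have width n π. -/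
theorem norm_complex_tan_nat_mul_pi_le {z : ℂ} {n : ℕ} (hz : z.re = n * Real.pi) :
    ‖Complex.tan z‖ ≤ 2 := by
  refine le_of_sq_le_sq ?_ (by positivity)
  rw [normSq_complex_tan, hz, Real.sin_nat_mul_pi]
  have h2 : Real.cos (n * Real.pi) ^ 2 = 1 := by
    have := Real.sin_sq_add_cos_sq (n * Real.pi)
    rw [Real.sin_nat_mul_pi] at this
    linarith
  rw [h2, div_le_iff₀ (by positivity)]
  nlinarith [sq_nonneg (Real.sinh z.im)]

/-- The holomorphic branch of `(tan z / z) ^ (1 / 2)` in the upper half-plane. -/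
noncomputable def sqrtTan (z : ℂ) : ℂ :=
  Complex.exp ((Complex.log (Complex.tan z) - Complex.log z) / 2)

theorem norm_sqrtTan {z : ℂ} (hz : z ≠ 0) (ht : Complex.tan z ≠ 0) :
    ‖sqrtTan z‖ = Real.sqrt (‖Complex.tan z‖ / ‖z‖) := by
  have h1 : 0 < ‖z‖ := norm_pos_iff.2 hz
  have h2 : 0 < ‖Complex.tan z‖ := norm_pos_iff.2 ht
  rw [sqrtTan, Complex.norm_exp, Real.sqrt_eq_rpow, Real.rpow_def_of_pos (by positivity),
    Real.log_div h2.ne' h1.ne']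
  congr 1
  rw [show (2 : ℂ) = ((2 : ℝ) : ℂ) by norm_num, Complex.div_ofReal_re, Complex.sub_re,
    Complex.log_re, Complex.log_re]
  ring

theorem differentiableAt_sqrtTan {z : ℂ} (hz : 0 < z.im) : DifferentiableAt ℂ sqrtTan z := by
  unfold sqrtTan
  have h1 : DifferentiableAt ℂ Complex.tan z :=
    Complex.differentiableAt_tan.2 (complex_cos_ne_zero hz)
  have h2 : Complex.tan z ∈ Complex.slitPlane := Or.inr (complex_tan_im_pos hz).ne'
  have h3 : z ∈ Complex.slitPlane := Or.inr hz.ne'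
  exact (((h1.clog h2).sub (differentiableAt_id.clog h3)).div_const 2).cexp

/-- Since tan(iy) = i tanh y, the logarithms of i cancel in the difference. -/
theorem sqrtTan_mul_I {y : ℝ} (hy : 0 < y) : sqrtTan (y * Complex.I) = (symbol (1 / 2) y : ℂ) := by
  have ht : 0 < Real.tanh y := by
    rw [Real.tanh_eq_sinh_div_cosh]
    exact div_pos (Real.sinh_pos_iff.2 hy) (Real.cosh_pos y)
  rw [sqrtTan, Complex.tan_mul_I, ← Complex.ofReal_tanh, Complex.log_ofReal_mul ht Complex.I_ne_zero,
    Complex.log_ofReal_mul hy Complex.I_ne_zero, symbol, if_neg hy.ne',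
    Real.rpow_def_of_pos (by positivity), Real.log_div ht.ne' hy.ne']
  push_cast
  congr 1
  ring

/-- The boundary value of the imaginary part of `sqrtTan`. -/
noncomputable def bdryIm (x : ℝ) : ℝ := if Real.tan x < 0 then Real.sqrt (-Real.tan x / x) else 0

theorem bdryIm_nonneg (x : ℝ) : 0 ≤ bdryIm x := by
  unfold bdryIm
  split_ifs <;> positivity

/-- Where the tangent is negative its logarithm has imaginary part π, which halving turns into a
right angle; elsewhere the value is real. -/
theorem sqrtTan_im_ofReal {x : ℝ} (hx : 0 < x) (ht : Real.tan x ≠ 0) :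
    (sqrtTan x).im = bdryIm x := by
  rw [sqrtTan, bdryIm, ← Complex.ofReal_tan]
  split_ifs with h
  · have e : ((Real.tan x : ℝ) : ℂ) = ((-Real.tan x : ℝ) : ℂ) * (-1) := by push_cast; ring
    rw [e, Complex.log_ofReal_mul (by linarith) (by norm_num), Complex.log_neg_one,
      ← Complex.ofReal_log hx.le]
    have e2 : ((Real.log (-Real.tan x) : ℂ) + Real.pi * Complex.I - (Real.log x : ℂ)) / 2 =
        (((Real.log (-Real.tan x) - Real.log x) / 2 : ℝ) : ℂ) + (Real.pi / 2) * Complex.I := by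
      push_cast; ring
    rw [e2, Complex.exp_add, Complex.exp_pi_div_two_mul_I, ← Complex.ofReal_exp,
      Complex.im_ofReal_mul, Complex.I_im, mul_one, Real.sqrt_eq_rpow,
      Real.rpow_def_of_pos (div_pos (by linarith) hx), Real.log_div (by linarith) hx.ne']
    congr 1
    ring
  · have h' : 0 < Real.tan x := lt_of_le_of_ne (not_lt.1 h) ht.symm
    rw [← Complex.ofReal_log h'.le, ← Complex.ofReal_log hx.le, ← Complex.ofReal_sub,
      show (2 : ℂ) = ((2 : ℝ) : ℂ) by norm_num, ← Complex.ofReal_div, ← Complex.ofReal_exp,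
      Complex.ofReal_im]

/-- On the negative axis the logarithm jumps, but it is continuous from above, and the tangent
approaches from above by `complex_tan_im_pos`. -/
theorem tendsto_sqrtTan {x : ℝ} (hx : 0 < x) (ht : Real.tan x ≠ 0) (hc : Real.cos x ≠ 0) :
    Tendsto (fun ε : ℝ => sqrtTan (x + ε * Complex.I)) (𝓝[>] 0) (𝓝 (sqrtTan x)) := by
  have hline : Tendsto (fun ε : ℝ => (x + ε * Complex.I : ℂ)) (𝓝[>] 0) (𝓝 (x : ℂ)) := by
    have : Tendsto (fun ε : ℝ => (x + ε * Complex.I : ℂ)) (𝓝 0) (𝓝 (x + (0 : ℝ) * Complex.I)) := by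
      apply Continuous.tendsto
      fun_prop
    simpa using this.mono_left nhdsWithin_le_nhds
  have hcc : Complex.cos (x : ℂ) ≠ 0 := by
    rw [← Complex.ofReal_cos]
    exact_mod_cast hc
  have htan : Tendsto (fun ε : ℝ => Complex.tan (x + ε * Complex.I)) (𝓝[>] 0)
      (𝓝 (Complex.tan x)) := (Complex.continuousAt_tan.2 hcc).tendsto.comp hline
  have hlog : Tendsto (fun ε : ℝ => Complex.log (Complex.tan (x + ε * Complex.I))) (𝓝[>] 0)
      (𝓝 (Complex.log (Complex.tan x))) := by
    rcases lt_or_gt_of_ne ht with h | h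
    · have := Complex.continuousWithinAt_log_of_re_neg_of_im_zero (z := Complex.tan x)
        (by rwa [← Complex.ofReal_tan, Complex.ofReal_re]) (by rw [← Complex.ofReal_tan, Complex.ofReal_im])
      refine this.tendsto.comp (tendsto_nhdsWithin_iff.2 ⟨htan, ?_⟩)
      filter_upwards [self_mem_nhdsWithin] with ε hε
      refine (complex_tan_im_pos ?_).le
      simpa using hε
    · refine (ContinuousAt.tendsto ?_).comp htan
      apply continuousAt_clog
      left
      rwa [← Complex.ofReal_tan, Complex.ofReal_re]
  have hlog2 : Tendsto (fun ε : ℝ => Complex.log (x + ε * Complex.I)) (𝓝[>] 0)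
      (𝓝 (Complex.log x)) := by
    refine (ContinuousAt.tendsto ?_).comp hline
    apply continuousAt_clog
    left
    rwa [Complex.ofReal_re]
  exact (Complex.continuous_exp.tendsto _).comp ((hlog.sub hlog2).div_const 2)

/-! ### The contour integral over a quarter-plane. -/

/-- `sqrtTan` corrected by a multiple of `2iξ/(z+iξ)` so as to vanish at `iξ`. -/
noncomputable def corrected (ξ : ℝ) (z : ℂ) : ℂ :=
  sqrtTan z - symbol (1 / 2) ξ * (2 * (ξ * Complex.I) / (z + ξ * Complex.I))

/-- Off iξ this is `corrected ξ z * (z / (z ^ 2 + ξ ^ 2))`. The use of `dslope` fills the removable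
singularity at iξ, so that Cauchy's theorem applies to rectangles with iξ on their boundary; the
other pole -iξ lies in the lower half-plane. -/
noncomputable def contourFn (ξ : ℝ) (z : ℂ) : ℂ :=
  dslope (corrected ξ) (ξ * Complex.I) z * (z / (z + ξ * Complex.I))

theorem add_mul_I_ne_zero {ξ : ℝ} (hξ : 0 < ξ) {z : ℂ} (hz : 0 ≤ z.im) : z + ξ * Complex.I ≠ 0 := by
  intro h
  have := congrArg Complex.im h
  simp at this
  linarith

theorem corrected_self {ξ : ℝ} (hξ : 0 < ξ) : corrected ξ (ξ * Complex.I) = 0 := by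
  have h : (ξ : ℂ) * Complex.I ≠ 0 := mul_ne_zero (by exact_mod_cast hξ.ne') Complex.I_ne_zero
  rw [corrected, sqrtTan_mul_I hξ, ← two_mul, div_self (mul_ne_zero two_ne_zero h), mul_one, sub_self]

theorem differentiableOn_contourFn {ξ : ℝ} (hξ : 0 < ξ) :
    DifferentiableOn ℂ (contourFn ξ) {z | 0 < z.im} := by
  have hopen : IsOpen {z : ℂ | 0 < z.im} := isOpen_lt continuous_const Complex.continuous_im
  have h0 : ∀ z ∈ {z : ℂ | 0 < z.im}, z + ξ * Complex.I ≠ 0 := fun z hz =>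
    add_mul_I_ne_zero hξ (le_of_lt hz)
  have h1 : DifferentiableOn ℂ (corrected ξ) {z | 0 < z.im} := by
    unfold corrected
    refine DifferentiableOn.sub (fun z hz => (differentiableAt_sqrtTan hz).differentiableWithinAt) ?_
    exact (DifferentiableOn.div (by fun_prop) (by fun_prop) h0).const_mul _
  have h2 : DifferentiableOn ℂ (dslope (corrected ξ) (ξ * Complex.I)) {z | 0 < z.im} :=
    (Complex.differentiableOn_dslope (hopen.mem_nhds (by simpa using hξ))).2 h1
  exact h2.mul (DifferentiableOn.div (by fun_prop) (by fun_prop) h0)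

theorem contourFn_of_ne {ξ : ℝ} (hξ : 0 < ξ) {z : ℂ} (hz : z ≠ ξ * Complex.I) :
    contourFn ξ z = corrected ξ z * (z / (z ^ 2 + ξ ^ 2)) := by
  have e : z ^ 2 + (ξ : ℂ) ^ 2 = (z - ξ * Complex.I) * (z + ξ * Complex.I) := by
    linear_combination (ξ : ℂ) ^ 2 * Complex.I_sq
  rw [contourFn, dslope_of_ne _ hz, slope_def_field, corrected_self hξ, sub_zero, e]
  have := sub_ne_zero.2 hz
  rw [div_mul_div_comm, mul_div_assoc]

/-- On the imaginary axis both terms of `corrected` are real and the remaining factor is imaginary.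
Since dz is imaginary too, this side does not contribute to the imaginary part of the contour
integral. -/
theorem contourFn_mul_I_re {ξ y : ℝ} (hξ : 0 < ξ) (hy : 0 < y) (h : y ≠ ξ) :
    (contourFn ξ (y * Complex.I)).re = 0 := by
  rw [contourFn_of_ne hξ (fun e => h (by simpa using e)), corrected, sqrtTan_mul_I hy]
  have e1 : 2 * (ξ * Complex.I) / (y * Complex.I + ξ * Complex.I) = ((2 * ξ / (y + ξ) : ℝ) : ℂ) := by
    rw [← add_mul, ← mul_assoc, mul_div_mul_right _ _ Complex.I_ne_zero]
    push_cast
    rfl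
  have e2 : (y * Complex.I : ℂ) / ((y * Complex.I) ^ 2 + ξ ^ 2) =
      ((y / (ξ ^ 2 - y ^ 2) : ℝ) : ℂ) * Complex.I := by
    rw [mul_pow, Complex.I_sq]
    push_cast
    rw [mul_div_right_comm]
    congr 2
    ring
  rw [e1, e2, ← Complex.ofReal_mul, ← Complex.ofReal_sub, ← mul_assoc, ← Complex.ofReal_mul,
    Complex.re_ofReal_mul, Complex.I_re, mul_zero]

/-- Divided by R it bounds `contourFn` on the two far sides of the square; it tends to zero as R
grows. -/
noncomputable def contourBound (ξ R : ℝ) : ℝ := 4 / 3 * (Real.sqrt (2 / R) + 2 * ξ / R)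

theorem symbol_half_mem (ξ : ℝ) : 0 ≤ symbol (1 / 2) ξ ∧ symbol (1 / 2) ξ ≤ 1 :=
  symbol_mem (by norm_num) ξ

theorem norm_le_norm_add_mul_I {ξ : ℝ} (hξ : 0 < ξ) {z : ℂ} (hz : 0 ≤ z.im) :
    ‖z‖ ≤ ‖z + ξ * Complex.I‖ := by
  refine le_of_sq_le_sq ?_ (norm_nonneg _)
  rw [← Complex.normSq_eq_norm_sq, ← Complex.normSq_eq_norm_sq, Complex.normSq_apply,
    Complex.normSq_apply]
  simp
  nlinarith

theorem norm_contourFn_le {ξ R : ℝ} (hξ : 0 < ξ) (hR : 2 * ξ ≤ R) {z : ℂ} (hz : 0 < z.im)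
    (hzR : R ≤ ‖z‖) (ht : ‖Complex.tan z‖ ≤ 2) : ‖contourFn ξ z‖ ≤ contourBound ξ R / R := by
  have hR0 : 0 < R := by linarith
  have hz0 : 0 < ‖z‖ := by linarith
  have hne : z ≠ ξ * Complex.I := by
    rintro rfl
    rw [norm_mul, Complex.norm_I, mul_one, Complex.norm_real, Real.norm_eq_abs, abs_of_pos hξ] at hzR
    linarith
  obtain ⟨m0, m1⟩ := symbol_half_mem ξ
  have h1 : ‖corrected ξ z‖ ≤ Real.sqrt (2 / R) + 2 * ξ / R := by
    refine (norm_sub_le _ _).trans (add_le_add ?_ ?_)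
    · rw [norm_sqrtTan (norm_pos_iff.1 hz0) (complex_tan_ne_zero hz)]
      exact Real.sqrt_le_sqrt (div_le_div₀ (by norm_num) ht hR0 hzR)
    · rw [norm_mul, norm_div, norm_mul, norm_mul, Complex.norm_I, Complex.norm_real,
        Complex.norm_real, Real.norm_eq_abs, Real.norm_eq_abs, abs_of_pos hξ, abs_of_nonneg m0,
        Complex.norm_ofNat, mul_one]
      have : 2 * ξ / ‖z + ξ * Complex.I‖ ≤ 2 * ξ / R :=
        div_le_div_of_nonneg_left (by linarith) hR0 (hzR.trans (norm_le_norm_add_mul_I hξ hz.le))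
      calc _ ≤ 1 * (2 * ξ / R) := mul_le_mul m1 this (by positivity) (by norm_num)
        _ = _ := one_mul _
  have h2 : ‖z / (z ^ 2 + ξ ^ 2)‖ ≤ 4 / 3 / R := by
    have h3 : ‖z‖ ^ 2 - ξ ^ 2 ≤ ‖z ^ 2 + (ξ : ℂ) ^ 2‖ := by
      have := norm_sub_le (z ^ 2 + (ξ : ℂ) ^ 2) ((ξ : ℂ) ^ 2)
      rw [add_sub_cancel_right, norm_pow, norm_pow, Complex.norm_real, Real.norm_eq_abs, sq_abs] at this
      linarith
    have h4 : 3 / 4 * ‖z‖ ^ 2 ≤ ‖z ^ 2 + (ξ : ℂ) ^ 2‖ := by nlinarith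
    rw [norm_div, div_div, div_le_div_iff₀ (by nlinarith [sq_pos_of_pos hz0]) (by positivity)]
    nlinarith [mul_le_mul_of_nonneg_left hzR hz0.le]
  rw [contourFn_of_ne hξ hne, norm_mul, contourBound]
  calc _ ≤ (Real.sqrt (2 / R) + 2 * ξ / R) * (4 / 3 / R) :=
        mul_le_mul h1 h2 (norm_nonneg _) (by positivity)
    _ = _ := by ring

/-- Cauchy's theorem on [0, nπ] × [ε, nπ]: the left side drops out of the imaginary part, and the
top and right sides cost one `contourBound` each. The bottom at height ε avoids the poles of the
tangent on the real axis. -/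
theorem abs_im_integral_contourFn_le {ξ ε : ℝ} {n : ℕ} (hξ : 0 < ξ) (hn : 1 ≤ n)
    (hR : 2 * ξ ≤ n * Real.pi) (hε : 0 < ε) (hε1 : ε < 1) :
    |(∫ x : ℝ in (0 : ℝ)..(n * Real.pi), contourFn ξ (x + ε * Complex.I)).im| ≤
      2 * contourBound ξ (n * Real.pi) := by
  set R : ℝ := n * Real.pi with hRdef
  have hR3 : 3 < R := by
    have : (1 : ℝ) ≤ n := by exact_mod_cast hn
    nlinarith [Real.pi_gt_three]
  have hsub : uIcc (0 : ℝ) R ×ℂ uIcc ε R ⊆ {z : ℂ | 0 < z.im} := by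
    intro z hz
    have := hz.2
    rw [uIcc_of_le (by linarith)] at this
    exact lt_of_lt_of_le hε this.1
  have hC := Complex.integral_boundary_rect_eq_zero_of_differentiableOn (contourFn ξ)
    (⟨0, ε⟩ : ℂ) (⟨R, R⟩ : ℂ) ((differentiableOn_contourFn hξ).mono hsub)
  simp only at hC
  have hB : 0 ≤ contourBound ξ R := by unfold contourBound; positivity
  have htop : ‖∫ x : ℝ in (0 : ℝ)..R, contourFn ξ (x + R * Complex.I)‖ ≤ contourBound ξ R := by
    refine (intervalIntegral.norm_integral_le_of_norm_le_const (C := contourBound ξ R / R) ?_).trans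
      (le_of_eq ?_)
    · intro x hx
      have him : (x + R * Complex.I : ℂ).im = R := by simp
      refine norm_contourFn_le hξ hR (by rw [him]; linarith) ?_
        (norm_complex_tan_le_two (by rw [him]; linarith))
      calc R = |(x + R * Complex.I : ℂ).im| := by rw [him, abs_of_pos (by linarith)]
        _ ≤ _ := Complex.abs_im_le_norm _
    · rw [sub_zero, abs_of_pos (by linarith), div_mul_cancel₀ _ (by linarith)]
  have hside : ‖∫ y : ℝ in ε..R, contourFn ξ (R + y * Complex.I)‖ ≤ contourBound ξ R := by
    refine (intervalIntegral.norm_integral_le_of_norm_le_const (C := contourBound ξ R / R) ?_).trans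
      ?_
    · intro y hy
      rw [uIoc_of_le (by linarith)] at hy
      have hre : (R + y * Complex.I : ℂ).re = R := by simp
      have him : (R + y * Complex.I : ℂ).im = y := by simp
      refine norm_contourFn_le hξ hR (by rw [him]; linarith [hy.1]) ?_
        (norm_complex_tan_nat_mul_pi_le (n := n) hre)
      calc R = |(R + y * Complex.I : ℂ).re| := by rw [hre, abs_of_pos (by linarith)]
        _ ≤ _ := Complex.abs_re_le_norm _
    · rw [abs_of_pos (by linarith)]
      calc contourBound ξ R / R * (R - ε) ≤ contourBound ξ R / R * R := by gcongr; linarith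
        _ = _ := div_mul_cancel₀ _ (by linarith)
  have hleft : (∫ y : ℝ in ε..R, contourFn ξ ((0 : ℝ) + y * Complex.I)).re = 0 := by
    have hint : IntervalIntegrable (fun y : ℝ => contourFn ξ ((0 : ℝ) + y * Complex.I)) volume ε R := by
      apply ContinuousOn.intervalIntegrable
      refine (differentiableOn_contourFn hξ).continuousOn.comp (by fun_prop) ?_
      intro y hy
      rw [uIcc_of_le (by linarith)] at hy
      simpa using lt_of_lt_of_le hε hy.1
    have : (∫ y : ℝ in ε..R, contourFn ξ ((0 : ℝ) + y * Complex.I)).re =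
        ∫ y : ℝ in ε..R, (contourFn ξ ((0 : ℝ) + y * Complex.I)).re :=
      (ContinuousLinearMap.intervalIntegral_comp_comm Complex.reCLM hint).symm
    rw [this]
    refine intervalIntegral.integral_zero_ae ?_
    have hne : ∀ᵐ y : ℝ, y ≠ ξ := by
      simp [ae_iff, measure_singleton]
    filter_upwards [hne] with y hy hy2
    rw [uIoc_of_le (by linarith)] at hy2
    simpa using contourFn_mul_I_re hξ (hε.trans hy2.1) hy
  have him := congrArg Complex.im hC
  simp only [Complex.add_im, Complex.sub_im, smul_eq_mul, Complex.mul_im, Complex.I_re, Complex.I_im,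
    zero_mul, one_mul, zero_add, Complex.zero_im, hleft] at him
  have e1 := (Complex.abs_im_le_norm _).trans htop
  have e2 := (Complex.abs_re_le_norm _).trans hside
  rw [abs_le] at *
  constructor <;> linarith [e1.1, e1.2, e2.1, e2.2]

theorem ae_cos_ne_zero : ∀ᵐ x : ℝ, Real.cos x ≠ 0 := by
  have : {x : ℝ | Real.cos x = 0} ⊆ range (fun k : ℤ => (2 * k + 1) * Real.pi / 2) := by
    intro x hx
    obtain ⟨k, hk⟩ := Real.cos_eq_zero_iff.1 hx
    exact ⟨k, hk.symm⟩
  rw [ae_iff]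
  simp only [ne_eq, not_not]
  exact ((countable_range _).mono this).measure_zero _

theorem ae_sin_ne_zero : ∀ᵐ x : ℝ, Real.sin x ≠ 0 := by
  have : {x : ℝ | Real.sin x = 0} ⊆ range (fun k : ℤ => k * Real.pi) := by
    intro x hx
    obtain ⟨k, hk⟩ := Real.sin_eq_zero_iff.1 hx
    exact ⟨k, hk⟩
  rw [ae_iff]
  simp only [ne_eq, not_not]
  exact ((countable_range _).mono this).measure_zero _

/-- Near a zero the cosine is bounded below by the chord 1 - 2x/π, so the singularity is that of
x^(-1/2); periodicity does the rest. This function dominates the limit ε → 0. -/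
theorem intervalIntegrable_abs_cos_rpow (a b : ℝ) :
    IntervalIntegrable (fun x => Real.sqrt (1 / |Real.cos x|)) volume a b := by
  have hper : Function.Periodic (fun x => Real.sqrt (1 / |Real.cos x|)) Real.pi := by
    intro x
    simp only [Real.cos_add_pi, abs_neg]
  have hmeas : Measurable (fun x => Real.sqrt (1 / |Real.cos x|)) := by fun_prop
  have hpi := Real.pi_pos
  have hright : IntervalIntegrable (fun x => Real.sqrt (1 / |Real.cos x|)) volume 0 (Real.pi / 2) := by
    have h1 : IntervalIntegrable (fun x : ℝ => x ^ (-(1 / 2) : ℝ)) volume 0 1 :=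
      intervalIntegral.intervalIntegrable_rpow' (by norm_num)
    have h2 : IntervalIntegrable (fun x : ℝ => (1 - 2 / Real.pi * x) ^ (-(1 / 2) : ℝ)) volume 0
        (Real.pi / 2) := by
      have h3 := (h1.symm.comp_sub_left 1).comp_mul_left (c := 2 / Real.pi)
      convert h3 using 1
      · simp
      · field_simp
        norm_num
    refine h2.mono_fun hmeas.aestronglyMeasurable ?_
    rw [EventuallyLE, ae_restrict_iff' measurableSet_uIoc]
    have hne : ∀ᵐ x : ℝ, x ≠ Real.pi / 2 := by simp [ae_iff, measure_singleton]
    filter_upwards [hne] with x hxne hx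
    rw [uIoc_of_le (by linarith)] at hx
    have hlt : x < Real.pi / 2 := lt_of_le_of_ne hx.2 hxne
    have h4 := Real.one_sub_mul_le_cos hx.1.le hx.2
    have h5 : 0 < 1 - 2 / Real.pi * x := by
      have : 2 / Real.pi * x < 2 / Real.pi * (Real.pi / 2) := by gcongr
      have e : 2 / Real.pi * (Real.pi / 2) = 1 := by field_simp
      linarith
    rw [Real.norm_of_nonneg (Real.sqrt_nonneg _),
      Real.norm_of_nonneg (Real.rpow_nonneg h5.le _), Real.rpow_neg h5.le, ← Real.sqrt_eq_rpow, ← Real.sqrt_inv,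
      ← one_div, abs_of_pos (lt_of_lt_of_le h5 h4)]
    gcongr
  have hleft : IntervalIntegrable (fun x => Real.sqrt (1 / |Real.cos x|)) volume (-(Real.pi / 2)) 0 := by
    have := (hright.comp_sub_left 0).symm
    simpa using this
  refine hper.intervalIntegrable hpi.ne' (t := -(Real.pi / 2)) ?_ a b
  have := hleft.trans hright
  convert this using 1
  ring

theorem measurable_bdryIm : Measurable bdryIm := by
  have ht : Measurable Real.tan := by
    have : Real.tan = fun x => Real.sin x / Real.cos x := funext Real.tan_eq_sin_div_cos
    rw [this]
    fun_prop
  exact Measurable.ite (measurableSet_lt ht measurable_const) (by fun_prop) measurable_const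

theorem bdryIm_mul_le {x : ℝ} (hx : 0 < x) :
    bdryIm x * x ≤ Real.sqrt x * Real.sqrt (1 / |Real.cos x|) := by
  unfold bdryIm
  split_ifs with h
  · rw [← Real.sqrt_mul hx.le]
    have : Real.sqrt (-Real.tan x / x) * x = Real.sqrt (-Real.tan x * x) := by
      rw [show -Real.tan x * x = (-Real.tan x / x) * x ^ 2 by field_simp,
        Real.sqrt_mul (div_nonneg (by linarith) hx.le), Real.sqrt_sq hx.le]
    rw [this]
    apply Real.sqrt_le_sqrt
    rw [mul_comm]
    refine mul_le_mul_of_nonneg_left ?_ hx.le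
    refine (neg_le_abs _).trans ?_
    rw [Real.tan_eq_sin_div_cos, abs_div]
    exact div_le_div_of_nonneg_right (Real.abs_sin_le_one x) (abs_nonneg _)
  · rw [zero_mul]; positivity

theorem bdryIm_intervalIntegrable {ξ : ℝ} (hξ : 0 < ξ) {R : ℝ} (hR : 0 ≤ R) :
    IntervalIntegrable (fun x => bdryIm x * (x / (x ^ 2 + ξ ^ 2))) volume 0 R := by
  have h := (intervalIntegrable_abs_cos_rpow 0 R).const_mul (Real.sqrt R / ξ ^ 2)
  refine h.mono_fun (measurable_bdryIm.mul (by fun_prop)).aestronglyMeasurable ?_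
  rw [EventuallyLE, ae_restrict_iff' measurableSet_uIoc]
  refine Eventually.of_forall fun x hx => ?_
  rw [uIoc_of_le hR] at hx
  have hb := bdryIm_nonneg x
  have hx0 := hx.1
  rw [Real.norm_eq_abs, Real.norm_eq_abs, abs_of_nonneg (by positivity), abs_of_nonneg (by positivity),
    ← mul_div_assoc, div_mul_eq_mul_div]
  have hs : Real.sqrt x ≤ Real.sqrt R := Real.sqrt_le_sqrt hx.2
  refine div_le_div₀ (by positivity) ((bdryIm_mul_le hx.1).trans (by gcongr)) (by positivity) ?_
  nlinarith

theorem contourFn_ofReal_im {ξ x : ℝ} (hξ : 0 < ξ) (hx : 0 < x) (ht : Real.tan x ≠ 0) :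
    (contourFn ξ x).im = bdryIm x * (x / (x ^ 2 + ξ ^ 2)) -
      symbol (1 / 2) ξ * (2 * ξ * x ^ 2 / (x ^ 2 + ξ ^ 2) ^ 2) := by
  have hne : (x : ℂ) ≠ ξ * Complex.I := by
    intro h
    have := congrArg Complex.re h
    simp at this
    linarith
  have e1 : (x : ℂ) / ((x : ℂ) ^ 2 + (ξ : ℂ) ^ 2) = ((x / (x ^ 2 + ξ ^ 2) : ℝ) : ℂ) := by push_cast; rfl
  have e2 : (2 * (ξ * Complex.I) / (x + ξ * Complex.I) : ℂ) =
      ((2 * ξ ^ 2 / (x ^ 2 + ξ ^ 2) : ℝ) : ℂ) + ((2 * ξ * x / (x ^ 2 + ξ ^ 2) : ℝ) : ℂ) * Complex.I := by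
    have h0 : ((x ^ 2 + ξ ^ 2 : ℝ) : ℂ) ≠ 0 := by
      have : 0 < x ^ 2 + ξ ^ 2 := by positivity
      exact_mod_cast this.ne'
    push_cast at h0 ⊢
    rw [div_eq_iff (add_mul_I_ne_zero hξ (by simp)), add_mul, div_mul_eq_mul_div, div_mul_eq_mul_div,
      div_mul_eq_mul_div, ← add_div, eq_div_iff h0]
    linear_combination -(2 * (ξ : ℂ) ^ 2 * x) * Complex.I_sq
  rw [contourFn_of_ne hξ hne, e1, Complex.im_mul_ofReal, corrected, Complex.sub_im,
    sqrtTan_im_ofReal hx ht, Complex.im_ofReal_mul, e2, Complex.add_im, Complex.ofReal_im,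
    Complex.im_ofReal_mul, Complex.I_im]
  have : x ^ 2 + ξ ^ 2 ≠ 0 := by positivity
  field_simp
  ring

/-- The bound is uniform in ε: |tan(x + iε)| ≤ cosh 1 / |cos x| controls the poles of the tangent,
and ε < ξ/2 keeps the line away from iξ. -/
theorem norm_contourFn_near_le {ξ R ε x : ℝ} (hξ : 0 < ξ) (hε : 0 < ε) (hε1 : ε < 1)
    (hε2 : ε < ξ / 2) (hx : 0 < x) (hxR : x ≤ R) (hc : Real.cos x ≠ 0) :
    ‖contourFn ξ (x + ε * Complex.I)‖ ≤
      2 / ξ ^ 2 * (Real.sqrt (Real.cosh 1 * (R + 1)) * Real.sqrt (1 / |Real.cos x|) + 2 * ξ) := by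
  set z : ℂ := x + ε * Complex.I with hz
  have hre : z.re = x := by simp [hz]
  have him : z.im = ε := by simp [hz]
  have himz : 0 < z.im := by rw [him]; exact hε
  have hz0 : 0 < ‖z‖ := norm_pos_iff.2 (fun h => by rw [h] at himz; simp at himz)
  have hzR : ‖z‖ ≤ R + 1 := by
    refine (Complex.norm_le_abs_re_add_abs_im z).trans ?_
    rw [hre, him, abs_of_pos hx, abs_of_pos hε]
    linarith
  have hne : z ≠ ξ * Complex.I := by
    intro h
    have := congrArg Complex.re h
    rw [hre] at this
    simp at this
    linarith
  obtain ⟨m0, m1⟩ := symbol_half_mem ξ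
  have hden : ξ ^ 2 / 2 ≤ ‖z ^ 2 + (ξ : ℂ) ^ 2‖ := by
    have e : z ^ 2 + (ξ : ℂ) ^ 2 = (z - ξ * Complex.I) * (z + ξ * Complex.I) := by
      linear_combination (ξ : ℂ) ^ 2 * Complex.I_sq
    rw [e, norm_mul]
    have h1 : ξ / 2 ≤ ‖z - ξ * Complex.I‖ := by
      refine le_trans ?_ (Complex.abs_im_le_norm _)
      simp only [Complex.sub_im, him, Complex.im_ofReal_mul, Complex.I_im, mul_one]
      rw [abs_sub_comm, abs_of_pos (by linarith)]
      linarith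
    have h2 : ξ ≤ ‖z + ξ * Complex.I‖ := by
      refine le_trans ?_ (Complex.abs_im_le_norm _)
      simp only [Complex.add_im, him, Complex.im_ofReal_mul, Complex.I_im, mul_one]
      rw [abs_of_pos (by linarith)]
      linarith
    calc ξ ^ 2 / 2 = ξ / 2 * ξ := by ring
      _ ≤ _ := mul_le_mul h1 h2 hξ.le (norm_nonneg _)
  have hg : ‖sqrtTan z‖ * ‖z‖ ≤ Real.sqrt (Real.cosh 1 * (R + 1)) * Real.sqrt (1 / |Real.cos x|) := by
    rw [norm_sqrtTan (norm_pos_iff.1 hz0) (complex_tan_ne_zero himz)]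
    have : Real.sqrt (‖Complex.tan z‖ / ‖z‖) * ‖z‖ = Real.sqrt (‖Complex.tan z‖ * ‖z‖) := by
      rw [show ‖Complex.tan z‖ * ‖z‖ = (‖Complex.tan z‖ / ‖z‖) * ‖z‖ ^ 2 by field_simp,
        Real.sqrt_mul (by positivity), Real.sqrt_sq hz0.le]
    rw [this, ← Real.sqrt_mul (mul_nonneg (Real.cosh_pos 1).le (by linarith))]
    apply Real.sqrt_le_sqrt
    have h1 : ‖Complex.tan z‖ ≤ Real.cosh 1 / |Real.cos x| := by
      refine (norm_complex_tan_le_cosh_div (by rwa [hre])).trans ?_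
      rw [hre, him]
      refine div_le_div_of_nonneg_right ?_ (abs_nonneg _)
      rw [Real.cosh_le_cosh, abs_of_pos hε, abs_one]
      exact hε1.le
    calc _ ≤ Real.cosh 1 / |Real.cos x| * (R + 1) := by
          have := Real.cosh_pos 1
          gcongr
      _ = _ := by ring
  have hk : ‖(symbol (1 / 2) ξ * (2 * (ξ * Complex.I) / (z + ξ * Complex.I)) : ℂ)‖ * ‖z‖ ≤ 2 * ξ := by
    rw [norm_mul, norm_div, norm_mul, norm_mul, Complex.norm_I, Complex.norm_real,
      Complex.norm_real, Real.norm_eq_abs, Real.norm_eq_abs, abs_of_pos hξ, abs_of_nonneg m0,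
      Complex.norm_ofNat, mul_one]
    have h1 := norm_le_norm_add_mul_I hξ himz.le
    have h2 : 2 * ξ / ‖z + ξ * Complex.I‖ * ‖z‖ ≤ 2 * ξ := by
      rw [div_mul_eq_mul_div, div_le_iff₀ (by linarith)]
      gcongr
    calc _ = symbol (1 / 2) ξ * (2 * ξ / ‖z + ξ * Complex.I‖ * ‖z‖) := by ring
      _ ≤ 1 * (2 * ξ) := mul_le_mul m1 h2 (by positivity) (by norm_num)
      _ = _ := one_mul _
  rw [contourFn_of_ne hξ hne, norm_mul, norm_div, ← mul_div_assoc]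
  have h5 : ‖corrected ξ z‖ * ‖z‖ ≤
      Real.sqrt (Real.cosh 1 * (R + 1)) * Real.sqrt (1 / |Real.cos x|) + 2 * ξ := by
    have := norm_sub_le (sqrtTan z) (symbol (1 / 2) ξ * (2 * (ξ * Complex.I) / (z + ξ * Complex.I)))
    calc _ ≤ (‖sqrtTan z‖ + ‖(symbol (1 / 2) ξ * (2 * (ξ * Complex.I) / (z + ξ * Complex.I)) : ℂ)‖) * ‖z‖ :=
          mul_le_mul_of_nonneg_right this (norm_nonneg _)
      _ ≤ _ := by rw [add_mul]; exact add_le_add hg hk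
  calc _ ≤ (Real.sqrt (Real.cosh 1 * (R + 1)) * Real.sqrt (1 / |Real.cos x|) + 2 * ξ) / (ξ ^ 2 / 2) :=
        div_le_div₀ (by positivity) h5 (by positivity) hden
    _ = _ := by field_simp

theorem tendsto_contourFn {ξ x : ℝ} (hξ : 0 < ξ) (hx : 0 < x) (ht : Real.tan x ≠ 0)
    (hc : Real.cos x ≠ 0) :
    Tendsto (fun ε : ℝ => contourFn ξ (x + ε * Complex.I)) (𝓝[>] 0) (𝓝 (contourFn ξ x)) := by
  have hline : Tendsto (fun ε : ℝ => (x + ε * Complex.I : ℂ)) (𝓝[>] 0) (𝓝 (x : ℂ)) := by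
    have : Tendsto (fun ε : ℝ => (x + ε * Complex.I : ℂ)) (𝓝 0) (𝓝 (x + (0 : ℝ) * Complex.I)) := by
      apply Continuous.tendsto
      fun_prop
    simpa using this.mono_left nhdsWithin_le_nhds
  have hne : ∀ ε : ℝ, (x + ε * Complex.I : ℂ) ≠ ξ * Complex.I := by
    intro ε h
    have := congrArg Complex.re h
    simp at this
    linarith
  have hne0 : (x : ℂ) ≠ ξ * Complex.I := by simpa using hne 0
  have hden : (x : ℂ) ^ 2 + (ξ : ℂ) ^ 2 ≠ 0 := by
    have : 0 < x ^ 2 + ξ ^ 2 := by positivity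
    exact_mod_cast this.ne'
  rw [contourFn_of_ne hξ hne0]
  simp_rw [contourFn_of_ne hξ (hne _)]
  have hk : (x : ℂ) + ξ * Complex.I ≠ 0 := add_mul_I_ne_zero hξ (by simp)
  refine Tendsto.mul ?_ (hline.div ((hline.pow 2).add_const _) hden)
  exact (tendsto_sqrtTan hx ht hc).sub
    ((tendsto_const_nhds.div (hline.add_const _) hk).const_mul _)

theorem abs_integral_bdry_le {ξ : ℝ} {n : ℕ} (hξ : 0 < ξ) (hn : 1 ≤ n) (hR : 2 * ξ ≤ n * Real.pi) :
    |∫ x : ℝ in (0 : ℝ)..(n * Real.pi), (bdryIm x * (x / (x ^ 2 + ξ ^ 2)) -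
      symbol (1 / 2) ξ * (2 * ξ * x ^ 2 / (x ^ 2 + ξ ^ 2) ^ 2))| ≤
      2 * contourBound ξ (n * Real.pi) := by
  set R : ℝ := n * Real.pi with hRdef
  have hR0 : 0 < R := by linarith
  have hsmall : ∀ᶠ ε : ℝ in 𝓝[>] 0, 0 < ε ∧ ε < 1 ∧ ε < ξ / 2 := by
    have h1 : ∀ᶠ ε : ℝ in 𝓝[>] 0, ε < 1 := nhdsWithin_le_nhds (Iio_mem_nhds one_pos)
    have h2 : ∀ᶠ ε : ℝ in 𝓝[>] 0, ε < ξ / 2 := nhdsWithin_le_nhds (Iio_mem_nhds (by linarith))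
    filter_upwards [self_mem_nhdsWithin, h1, h2] with ε a b c using ⟨a, b, c⟩
  have hlim : Tendsto (fun ε : ℝ => ∫ x : ℝ in (0 : ℝ)..R, contourFn ξ (x + ε * Complex.I)) (𝓝[>] 0)
      (𝓝 (∫ x : ℝ in (0 : ℝ)..R, contourFn ξ x)) := by
    refine intervalIntegral.tendsto_integral_filter_of_dominated_convergence
      (fun x => 2 / ξ ^ 2 * (Real.sqrt (Real.cosh 1 * (R + 1)) * Real.sqrt (1 / |Real.cos x|) + 2 * ξ))
      ?_ ?_ ?_ ?_
    · filter_upwards [hsmall] with ε hε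
      apply Continuous.aestronglyMeasurable
      rw [← continuousOn_univ]
      refine (differentiableOn_contourFn hξ).continuousOn.comp (by fun_prop) ?_
      intro y _
      simpa using hε.1
    · filter_upwards [hsmall] with ε hε
      filter_upwards [ae_cos_ne_zero] with x hc hx
      rw [uIoc_of_le hR0.le] at hx
      exact norm_contourFn_near_le hξ hε.1 hε.2.1 hε.2.2 hx.1 hx.2 hc
    · exact (((intervalIntegrable_abs_cos_rpow 0 R).const_mul _).add (by simp)).const_mul _
    · filter_upwards [ae_cos_ne_zero, ae_sin_ne_zero] with x hc hs hx
      rw [uIoc_of_le hR0.le] at hx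
      refine tendsto_contourFn hξ hx.1 ?_ hc
      rw [Real.tan_eq_sin_div_cos]
      exact div_ne_zero hs hc
  -- Measurability of the boundary values is inherited from the continuous traces at heights `min 1
  -- (ξ / 2) / (k + 2)`, which lie strictly below both 1 and ξ/2.
  have hint : IntervalIntegrable (fun x : ℝ => contourFn ξ x) volume 0 R := by
    have hb : IntervalIntegrable (fun x => 2 / ξ ^ 2 *
        (Real.sqrt (Real.cosh 1 * (R + 1)) * Real.sqrt (1 / |Real.cos x|) + 2 * ξ)) volume 0 R :=
      (((intervalIntegrable_abs_cos_rpow 0 R).const_mul _).add (by simp)).const_mul _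
    have htend : ∀ᵐ x : ℝ, x ∈ uIoc 0 R → Tendsto (fun k : ℕ =>
        contourFn ξ (x + ((min 1 (ξ / 2) / (k + 2) : ℝ) : ℂ) * Complex.I)) atTop
        (𝓝 (contourFn ξ x)) := by
      filter_upwards [ae_cos_ne_zero, ae_sin_ne_zero] with x hc hs hx
      rw [uIoc_of_le hR0.le] at hx
      have h1 := tendsto_contourFn hξ hx.1 (by
        rw [Real.tan_eq_sin_div_cos]
        exact div_ne_zero hs hc) hc
      refine h1.comp (tendsto_nhdsWithin_iff.2 ⟨?_, Eventually.of_forall fun k => ?_⟩)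
      · exact tendsto_const_nhds.div_atTop
          (tendsto_atTop_add_const_right _ _ tendsto_natCast_atTop_atTop)
      · have : 0 < min 1 (ξ / 2) := lt_min one_pos (by linarith)
        exact div_pos this (by positivity)
    have hδ : ∀ k : ℕ, 0 < min 1 (ξ / 2) / ((k : ℝ) + 2) ∧ min 1 (ξ / 2) / ((k : ℝ) + 2) < 1 ∧
        min 1 (ξ / 2) / ((k : ℝ) + 2) < ξ / 2 := by
      intro k
      have h0 : 0 < min 1 (ξ / 2) := lt_min one_pos (by linarith)
      have h1 : min 1 (ξ / 2) / ((k : ℝ) + 2) < min 1 (ξ / 2) :=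
        div_lt_self h0 (by have : (0 : ℝ) ≤ k := k.cast_nonneg; linarith)
      exact ⟨by positivity, h1.trans_le (min_le_left _ _), h1.trans_le (min_le_right _ _)⟩
    refine hb.mono_fun ?_ ?_
    · refine aestronglyMeasurable_of_tendsto_ae atTop (f := fun (k : ℕ) (x : ℝ) =>
        contourFn ξ (x + ((min 1 (ξ / 2) / (k + 2) : ℝ) : ℂ) * Complex.I)) (fun k => ?_)
        ((ae_restrict_iff' measurableSet_uIoc).2 htend)
      apply Continuous.aestronglyMeasurable
      rw [← continuousOn_univ]
      refine (differentiableOn_contourFn hξ).continuousOn.comp (by fun_prop) ?_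
      intro y _
      simpa only [mem_ofPred_eq, Complex.add_im, Complex.ofReal_im, Complex.im_ofReal_mul,
        Complex.I_im, mul_one, zero_add] using (hδ k).1
    · rw [EventuallyLE, ae_restrict_iff' measurableSet_uIoc]
      filter_upwards [htend, ae_cos_ne_zero] with x hx hc hxm
      refine le_trans ?_ (le_abs_self _)
      refine le_of_tendsto (hx hxm).norm (Eventually.of_forall fun k => ?_)
      rw [uIoc_of_le hR0.le] at hxm
      exact norm_contourFn_near_le hξ (hδ k).1 (hδ k).2.1 (hδ k).2.2 hxm.1 hxm.2 hc
  have him : (∫ x : ℝ in (0 : ℝ)..R, contourFn ξ x).im =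
      ∫ x : ℝ in (0 : ℝ)..R, (bdryIm x * (x / (x ^ 2 + ξ ^ 2)) -
      symbol (1 / 2) ξ * (2 * ξ * x ^ 2 / (x ^ 2 + ξ ^ 2) ^ 2)) := by
    have : (∫ x : ℝ in (0 : ℝ)..R, contourFn ξ x).im = ∫ x : ℝ in (0 : ℝ)..R, (contourFn ξ x).im :=
      (ContinuousLinearMap.intervalIntegral_comp_comm Complex.imCLM hint).symm
    rw [this]
    refine intervalIntegral.integral_congr_ae ?_
    filter_upwards [ae_cos_ne_zero, ae_sin_ne_zero] with x hc hs hx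
    rw [uIoc_of_le hR0.le] at hx
    refine contourFn_ofReal_im hξ hx.1 ?_
    rw [Real.tan_eq_sin_div_cos]
    exact div_ne_zero hs hc
  rw [← him]
  refine le_of_tendsto ((Complex.continuous_im.tendsto _).comp hlim).abs ?_
  filter_upwards [hsmall] with ε hε
  exact abs_im_integral_contourFn_le hξ hn hR hε.1 hε.2.1

theorem tendsto_contourBound {ξ : ℝ} :
    Tendsto (fun n : ℕ => 2 * contourBound ξ (n * Real.pi)) atTop (𝓝 0) := by
  have hR : Tendsto (fun n : ℕ => (n : ℝ) * Real.pi) atTop atTop :=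
    tendsto_natCast_atTop_atTop.atTop_mul_const Real.pi_pos
  have h1 : Tendsto (fun n : ℕ => Real.sqrt (2 / ((n : ℝ) * Real.pi))) atTop (𝓝 0) := by
    have := (Real.continuous_sqrt.tendsto 0).comp (hR.const_div_atTop 2)
    rwa [Real.sqrt_zero] at this
  have h2 := ((h1.add (hR.const_div_atTop (2 * ξ))).const_mul (4 / 3)).const_mul 2
  simpa [contourBound] using h2

theorem integral_rational {ξ R : ℝ} (hξ : 0 < ξ) :
    ∫ x : ℝ in (0 : ℝ)..R, 2 * ξ * x ^ 2 / (x ^ 2 + ξ ^ 2) ^ 2 =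
      Real.arctan (R / ξ) - ξ * R / (R ^ 2 + ξ ^ 2) := by
  have hpos : ∀ x : ℝ, x ^ 2 + ξ ^ 2 ≠ 0 := fun x => by positivity
  have hd : ∀ x ∈ uIcc 0 R, HasDerivAt (fun x => Real.arctan (x / ξ) - ξ * x / (x ^ 2 + ξ ^ 2))
      (2 * ξ * x ^ 2 / (x ^ 2 + ξ ^ 2) ^ 2) x := by
    intro x _
    have h1 : HasDerivAt (fun x : ℝ => x / ξ) (1 / ξ) x := (hasDerivAt_id x).div_const ξ
    have h2 : HasDerivAt (fun x : ℝ => ξ * x) ξ x := by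
      simpa using (hasDerivAt_id x).const_mul ξ
    have h3 : HasDerivAt (fun x : ℝ => x ^ 2 + ξ ^ 2) (2 * x) x := by
      simpa using (hasDerivAt_pow 2 x).add_const (ξ ^ 2)
    refine (h1.arctan.sub (h2.div h3 (hpos x))).congr_deriv ?_
    have h4 := hpos x
    have h5 : 1 + (x / ξ) ^ 2 = (x ^ 2 + ξ ^ 2) / ξ ^ 2 := by field_simp; ring
    rw [h5]
    field_simp
    ring
  rw [intervalIntegral.integral_eq_sub_of_hasDerivAt hd]
  · simp
  · apply Continuous.intervalIntegrable
    exact Continuous.div (by fun_prop) (by fun_prop) fun x => pow_ne_zero _ (hpos x)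

/-- The correction term has an explicit primitive whose limit is π/2, and the contour estimate says
that the difference of the two integrals tends to zero. -/
theorem tendsto_integral_bdryIm {ξ : ℝ} (hξ : 0 < ξ) :
    Tendsto (fun n : ℕ => ∫ x : ℝ in (0 : ℝ)..(n * Real.pi), bdryIm x * (x / (x ^ 2 + ξ ^ 2)))
      atTop (𝓝 (symbol (1 / 2) ξ * (Real.pi / 2))) := by
  have hR : Tendsto (fun n : ℕ => (n : ℝ) * Real.pi) atTop atTop :=
    tendsto_natCast_atTop_atTop.atTop_mul_const Real.pi_pos
  have hrat : Tendsto (fun n : ℕ => Real.arctan ((n * Real.pi) / ξ) -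
      ξ * (n * Real.pi) / ((n * Real.pi) ^ 2 + ξ ^ 2)) atTop (𝓝 (Real.pi / 2)) := by
    have h1 : Tendsto (fun R : ℝ => Real.arctan (R / ξ)) atTop (𝓝 (Real.pi / 2)) :=
      (tendsto_nhds_of_tendsto_nhdsWithin Real.tendsto_arctan_atTop).comp
        (tendsto_id.atTop_div_const hξ)
    have h2 : Tendsto (fun R : ℝ => ξ * R / (R ^ 2 + ξ ^ 2)) atTop (𝓝 0) := by
      refine squeeze_zero' (g := fun R => ξ / R) ?_ ?_ (tendsto_id.const_div_atTop ξ)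
      · filter_upwards [eventually_gt_atTop 0] with R hR
        positivity
      · filter_upwards [eventually_gt_atTop 0] with R hR
        rw [div_le_div_iff₀ (by positivity) hR]
        nlinarith [pow_pos hξ 3]
    have := (h1.sub h2).comp hR
    rwa [sub_zero] at this
  have hdiff : Tendsto (fun n : ℕ => ∫ x : ℝ in (0 : ℝ)..(n * Real.pi),
      (bdryIm x * (x / (x ^ 2 + ξ ^ 2)) -
        symbol (1 / 2) ξ * (2 * ξ * x ^ 2 / (x ^ 2 + ξ ^ 2) ^ 2))) atTop (𝓝 0) := by
    refine squeeze_zero_norm' ?_ (tendsto_contourBound (ξ := ξ))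
    filter_upwards [eventually_ge_atTop 1, hR.eventually_ge_atTop (2 * ξ)] with n h1 h2
    exact abs_integral_bdry_le hξ h1 h2
  have hsum := hdiff.add (hrat.const_mul (symbol (1 / 2) ξ))
  rw [zero_add] at hsum
  refine hsum.congr fun n => ?_
  have hn : (0 : ℝ) ≤ n * Real.pi := by positivity
  have hpos : ∀ x : ℝ, x ^ 2 + ξ ^ 2 ≠ 0 := fun x => by positivity
  rw [intervalIntegral.integral_sub (bdryIm_intervalIntegrable hξ hn),
    intervalIntegral.integral_const_mul, integral_rational hξ]
  · ring
  · apply Continuous.intervalIntegrable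
    exact (Continuous.div (by fun_prop) (by fun_prop) fun x => pow_ne_zero _ (hpos x)).const_mul _

/-- The tangent is nonnegative up to π/2 > 1. The resulting gap confines `mixing` to s > 1 and makes
the moments of the kernel finite. -/
theorem bdryIm_eq_zero {x : ℝ} (h0 : 0 ≤ x) (h1 : x ≤ 1) : bdryIm x = 0 := by
  refine if_neg (not_lt.2 (Real.tan_nonneg_of_nonneg_of_le_pi_div_two h0 ?_))
  linarith [Real.pi_gt_three]

theorem lintegral_bdryIm {ξ : ℝ} (hξ : 0 < ξ) :
    ∫⁻ x in Ioi (0 : ℝ), ENNReal.ofReal (bdryIm x * (x / (x ^ 2 + ξ ^ 2))) =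
      ENNReal.ofReal (symbol (1 / 2) ξ * (Real.pi / 2)) := by
  have hR : Tendsto (fun n : ℕ => (n : ℝ) * Real.pi) atTop atTop :=
    tendsto_natCast_atTop_atTop.atTop_mul_const Real.pi_pos
  have hnn : ∀ x ∈ Ioi (0 : ℝ), 0 ≤ bdryIm x * (x / (x ^ 2 + ξ ^ 2)) := fun x hx => by
    have := bdryIm_nonneg x
    have hx' : 0 < x := hx
    positivity
  have ht := tendsto_integral_bdryIm hξ
  have hI : IntegrableOn (fun x => bdryIm x * (x / (x ^ 2 + ξ ^ 2))) (Ioi 0) := by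
    refine integrableOn_Ioi_of_intervalIntegral_norm_tendsto (l := atTop)
      (b := fun n : ℕ => (n : ℝ) * Real.pi) (symbol (1 / 2) ξ * (Real.pi / 2)) 0 (fun n => ?_) hR ?_
    · exact (intervalIntegrable_iff_integrableOn_Ioc_of_le (by positivity)).1
        (bdryIm_intervalIntegrable hξ (by positivity))
    · refine ht.congr fun n => ?_
      refine intervalIntegral.integral_congr_ae (Eventually.of_forall fun x hx => ?_)
      rw [uIoc_of_le (by positivity)] at hx
      exact (Real.norm_of_nonneg (hnn x hx.1)).symm
  rw [← ofReal_integral_eq_lintegral_ofReal hI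
    ((ae_restrict_iff' measurableSet_Ioi).2 (Eventually.of_forall hnn))]
  congr 1
  exact tendsto_nhds_unique (intervalIntegral_tendsto_integral_Ioi 0 hI hR) ht

/-! ### The symbol as a mixture of Lorentzians. -/

/-- The mixing measure: `(tanh ξ / ξ) ^ (1 / 2) = ∫ s² / (s² + ξ²) dν(s)`. -/
noncomputable def mixing : Measure ℝ :=
  (volume.restrict (Ioi 1)).withDensity fun s => ENNReal.ofReal (2 / Real.pi * (bdryIm s / s))

theorem lintegral_mixing {g : ℝ → ℝ≥0∞} (hg : Measurable g) :
    ∫⁻ s, g s ∂mixing = ∫⁻ s in Ioi (1 : ℝ), ENNReal.ofReal (2 / Real.pi * (bdryIm s / s)) * g s := by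
  rw [mixing, lintegral_withDensity_eq_lintegral_mul _ _ hg]
  · rfl
  · exact ((measurable_bdryIm.div measurable_id).const_mul _).ennreal_ofReal

theorem ae_mixing_one_lt : ∀ᵐ s ∂mixing, 1 < s :=
  (withDensity_absolutelyContinuous _ _).ae_le (ae_restrict_mem measurableSet_Ioi)

theorem lintegral_mixing_symbol_of_pos {ξ : ℝ} (hξ : 0 < ξ) :
    ∫⁻ s, ENNReal.ofReal (s ^ 2 / (s ^ 2 + ξ ^ 2)) ∂mixing = ENNReal.ofReal (symbol (1 / 2) ξ) := by
  have hpi := Real.pi_pos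
  rw [lintegral_mixing (by fun_prop)]
  have e : ∀ s ∈ Ioi (1 : ℝ), ENNReal.ofReal (2 / Real.pi * (bdryIm s / s)) *
      ENNReal.ofReal (s ^ 2 / (s ^ 2 + ξ ^ 2)) =
      ENNReal.ofReal (2 / Real.pi) * ENNReal.ofReal (bdryIm s * (s / (s ^ 2 + ξ ^ 2))) := by
    intro s hs
    have h1 : (1 : ℝ) < s := hs
    have h2 := bdryIm_nonneg s
    rw [← ENNReal.ofReal_mul (by positivity), ← ENNReal.ofReal_mul (by positivity)]
    congr 1
    field_simp
  rw [setLIntegral_congr_fun measurableSet_Ioi e, lintegral_const_mul' _ _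
    ENNReal.ofReal_ne_top]
  have h3 : ∫⁻ s in Ioi (1 : ℝ), ENNReal.ofReal (bdryIm s * (s / (s ^ 2 + ξ ^ 2))) =
      ∫⁻ s in Ioi (0 : ℝ), ENNReal.ofReal (bdryIm s * (s / (s ^ 2 + ξ ^ 2))) := by
    rw [← lintegral_indicator measurableSet_Ioi, ← lintegral_indicator measurableSet_Ioi]
    refine lintegral_congr fun s => ?_
    by_cases h1 : 1 < s
    · rw [indicator_of_mem (by exact h1), indicator_of_mem (show s ∈ Ioi 0 from one_pos.trans h1)]
    · by_cases h0 : 0 < s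
      · rw [indicator_of_notMem (by exact h1), indicator_of_mem (by exact h0),
          bdryIm_eq_zero h0.le (not_lt.1 h1), zero_mul, ENNReal.ofReal_zero]
      · rw [indicator_of_notMem (by exact h1), indicator_of_notMem (by exact h0)]
  rw [h3, lintegral_bdryIm hξ, ← ENNReal.ofReal_mul (by positivity)]
  congr 1
  field_simp

theorem tendsto_symbol_zero :
    Tendsto (fun n : ℕ => symbol (1 / 2) (1 / ((n : ℝ) + 1))) atTop (𝓝 1) := by
  have h1 : Tendsto (fun x : ℝ => Real.tanh x / x) (𝓝[≠] 0) (𝓝 1) := by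
    have hd : HasDerivAt Real.tanh 1 0 := by
      have : HasDerivAt (fun x => Real.sinh x / Real.cosh x)
          ((Real.cosh 0 * Real.cosh 0 - Real.sinh 0 * Real.sinh 0) / Real.cosh 0 ^ 2) 0 :=
        (Real.hasDerivAt_sinh 0).div (Real.hasDerivAt_cosh 0) (Real.cosh_pos 0).ne'
      have e : Real.tanh = fun x => Real.sinh x / Real.cosh x := funext Real.tanh_eq_sinh_div_cosh
      rw [e]
      simpa using this
    have := hd.tendsto_slope_zero
    refine this.congr fun x => ?_
    simp [div_eq_inv_mul]
  have h2 : Tendsto (fun n : ℕ => 1 / ((n : ℝ) + 1)) atTop (𝓝[≠] 0) :=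
    tendsto_nhdsWithin_iff.2 ⟨tendsto_one_div_add_atTop_nhds_zero_nat,
      Eventually.of_forall fun n => by
        have : 0 < 1 / ((n : ℝ) + 1) := by positivity
        exact this.ne'⟩
  have h3 := (h1.comp h2).rpow_const (p := 1 / 2) (Or.inl one_ne_zero)
  rw [Real.one_rpow] at h3
  refine h3.congr fun n => ?_
  have : 1 / ((n : ℝ) + 1) ≠ 0 := by positivity
  rw [symbol, if_neg this]
  rfl

/-- Let ξ decrease to 0 in the Lorentzian representation: the Lorentzians increase to 1 and the
symbol tends to 1. -/
theorem mixing_univ : mixing univ = 1 := by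
  have h1 : Tendsto (fun n : ℕ => ∫⁻ s, ENNReal.ofReal (s ^ 2 / (s ^ 2 + (1 / ((n : ℝ) + 1)) ^ 2)) ∂mixing)
      atTop (𝓝 (∫⁻ _, 1 ∂mixing)) := by
    refine lintegral_tendsto_of_tendsto_of_monotone (fun n => by fun_prop) ?_ ?_
    · filter_upwards [ae_mixing_one_lt] with s hs
      intro n k hnk
      have : (n : ℝ) ≤ k := by exact_mod_cast hnk
      dsimp only
      gcongr
    · filter_upwards [ae_mixing_one_lt] with s hs
      have h2 : Tendsto (fun n : ℕ => s ^ 2 / (s ^ 2 + (1 / ((n : ℝ) + 1)) ^ 2)) atTop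
          (𝓝 (s ^ 2 / (s ^ 2 + 0 ^ 2))) :=
        tendsto_const_nhds.div (tendsto_const_nhds.add
          (tendsto_one_div_add_atTop_nhds_zero_nat.pow 2)) (by positivity)
      have h3 : s ^ 2 / (s ^ 2 + 0 ^ 2) = 1 := by
        have : s ≠ 0 := by linarith
        simp [this]
      rw [h3] at h2
      simpa only [ENNReal.ofReal_one] using ENNReal.tendsto_ofReal h2
  have h2 : Tendsto (fun n : ℕ => ENNReal.ofReal (symbol (1 / 2) (1 / ((n : ℝ) + 1)))) atTop (𝓝 1) := by
    simpa only [ENNReal.ofReal_one] using ENNReal.tendsto_ofReal tendsto_symbol_zero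
  have h3 := tendsto_nhds_unique h1 (h2.congr fun n => (lintegral_mixing_symbol_of_pos (by positivity)).symm)
  simpa using h3

theorem symbol_neg (a ξ : ℝ) : symbol a (-ξ) = symbol a ξ := by
  simp [symbol, Real.tanh_neg, neg_div_neg_eq]

theorem lintegral_mixing_symbol (ξ : ℝ) :
    ∫⁻ s, ENNReal.ofReal (s ^ 2 / (s ^ 2 + ξ ^ 2)) ∂mixing = ENNReal.ofReal (symbol (1 / 2) ξ) := by
  rcases lt_trichotomy ξ 0 with h | h | h
  · rw [← symbol_neg, ← lintegral_mixing_symbol_of_pos (neg_pos.2 h)]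
    simp
  · subst h
    have : ∫⁻ s, ENNReal.ofReal (s ^ 2 / (s ^ 2 + (0 : ℝ) ^ 2)) ∂mixing = ∫⁻ _, 1 ∂mixing := by
      refine lintegral_congr_ae ?_
      filter_upwards [ae_mixing_one_lt] with s hs
      have : s ≠ 0 := by linarith
      simp [this]
    rw [this]
    simp [mixing_univ, symbol]
  · exact lintegral_mixing_symbol_of_pos h

/-! ### The kernel as a mixture of Laplace densities. -/

/-- The properties of the Whitham kernel `K_{1/2}`. -/
structure IsWhithamKernel (W : ℝ → ℝ) : Prop where
  measurable : Measurable W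
  nonneg : ∀ z, 0 ≤ W z
  even : ∀ z, W (-z) = W z
  antitoneOn : AntitoneOn W (Ioi 0)
  integrable : Integrable W
  integral_eq_one : ∫ z, W z = 1
  integrable_sq_mul : Integrable fun z => W z * z ^ 2
  integral_mul_cos : ∀ ξ, ∫ z, W z * Real.cos (ξ * z) = symbol (1 / 2) ξ

instance : IsProbabilityMeasure mixing := ⟨mixing_univ⟩

theorem integral_exp_neg_mul_cos {s : ℝ} (hs : 0 < s) (ξ : ℝ) :
    ∫ z, s / 2 * Real.exp (-s * |z|) * Real.cos (ξ * z) = s ^ 2 / (s ^ 2 + ξ ^ 2) := by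
  have h1 : ∫ z, s / 2 * Real.exp (-s * |z|) * Real.cos (ξ * z) =
      ∫ z, (fun z => s / 2 * Real.exp (-s * z) * Real.cos (ξ * z)) |z| := by
    refine integral_congr_ae (Eventually.of_forall fun z => ?_)
    have : Real.cos (ξ * |z|) = Real.cos (ξ * z) := by
      rcases abs_choice z with h | h <;> rw [h]
      rw [mul_neg, Real.cos_neg]
    simp only [this]
  rw [h1, integral_comp_abs (f := fun z => s / 2 * Real.exp (-s * z) * Real.cos (ξ * z))]
  have hre : ((-s : ℝ) + ξ * Complex.I : ℂ).re < 0 := by simpa using hs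
  have h2 := integral_exp_mul_complex_Ioi (a := ((-s : ℝ) + ξ * Complex.I : ℂ)) hre 0
  have h3 := integrableOn_exp_mul_complex_Ioi hre 0
  have h4 : ∫ z in Ioi (0 : ℝ), s / 2 * Real.exp (-s * z) * Real.cos (ξ * z) =
      s / 2 * (∫ z in Ioi (0 : ℝ), Complex.exp (((-s : ℝ) + ξ * Complex.I : ℂ) * z)).re := by
    have : (∫ z in Ioi (0 : ℝ), Complex.exp (((-s : ℝ) + ξ * Complex.I : ℂ) * z)).re =
      ∫ z in Ioi (0 : ℝ), (Complex.exp (((-s : ℝ) + ξ * Complex.I : ℂ) * z)).re :=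
      (ContinuousLinearMap.integral_comp_comm Complex.reCLM h3).symm
    rw [this, ← integral_const_mul]
    refine integral_congr_ae (Eventually.of_forall fun z => ?_)
    simp [Complex.exp_re, mul_assoc]
  rw [h4, h2]
  have hne : ((-s : ℝ) + ξ * Complex.I : ℂ) ≠ 0 := fun h => by rw [h] at hre; simp at hre
  have h5 : (-Complex.exp (((-s : ℝ) + ξ * Complex.I : ℂ) * (0 : ℝ)) / ((-s : ℝ) + ξ * Complex.I : ℂ)).re =
      s / (s ^ 2 + ξ ^ 2) := by
    rw [Complex.ofReal_zero, mul_zero, Complex.exp_zero, Complex.div_re]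
    simp [Complex.normSq_apply]
    ring_nf
  rw [h5]
  ring

theorem integrable_exp_neg_mul_abs {s : ℝ} (hs : 0 < s) :
    Integrable fun z : ℝ => s / 2 * Real.exp (-s * |z|) := by
  -- A nonintegrable function has Bochner integral `0`, whereas this integral is 1.
  by_contra h
  have h1 := integral_exp_neg_mul_cos hs 0
  simp only [zero_mul, Real.cos_zero, mul_one] at h1
  rw [integral_undef h] at h1
  have : s ^ 2 / (s ^ 2 + 0 ^ 2) = 1 := by field_simp; ring
  linarith

theorem integral_exp_neg_mul_abs {s : ℝ} (hs : 0 < s) :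
    ∫ z : ℝ, s / 2 * Real.exp (-s * |z|) = 1 := by
  have h1 := integral_exp_neg_mul_cos hs 0
  simp only [zero_mul, Real.cos_zero, mul_one] at h1
  rw [h1]
  field_simp
  ring

/-- Half of the exponential absorbs z², leaving a Laplace density of rate s/2; s > 1 makes the
constant independent of s. -/
theorem sq_mul_exp_le {s : ℝ} (hs : 1 < s) (z : ℝ) :
    s / 2 * Real.exp (-s * |z|) * z ^ 2 ≤ 16 * (s / 2 / 2 * Real.exp (-(s / 2) * |z|)) := by
  have h4 : Real.exp (-s * |z|) = Real.exp (-(s / 2) * |z|) * (Real.exp (s / 2 * |z|))⁻¹ := by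
    rw [← Real.exp_neg, ← Real.exp_add]
    congr 1
    ring
  have h5 : z ^ 2 * (Real.exp (s / 2 * |z|))⁻¹ ≤ 8 := by
    rw [← div_eq_mul_inv, div_le_iff₀ (Real.exp_pos _)]
    have := Real.quadratic_le_exp_of_nonneg (show 0 ≤ s / 2 * |z| by positivity)
    have h6 : z ^ 2 ≤ s ^ 2 * z ^ 2 := le_mul_of_one_le_left (sq_nonneg z) (by nlinarith)
    have h7 : (s / 2 * |z|) ^ 2 = s ^ 2 * z ^ 2 / 4 := by rw [mul_pow, sq_abs]; ring
    have h8 : 0 ≤ s / 2 * |z| := by positivity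
    rw [h7] at this
    linarith
  rw [h4]
  have h6 := Real.exp_pos (-(s / 2) * |z|)
  nlinarith [mul_le_mul_of_nonneg_left h5 (show 0 ≤ s / 2 * Real.exp (-(s / 2) * |z|) by positivity)]

/-- The cosine transform of each Laplace density is a Lorentzian, so this mixture has the required
symbol. Monotonicity is only claimed away from the origin, where the integral may diverge. -/
noncomputable def kernel (z : ℝ) : ℝ := ∫ s, s / 2 * Real.exp (-s * |z|) ∂mixing

theorem integrable_kernel_mul {φ : ℝ → ℝ} (hφ : Measurable φ) {C : ℝ}
    (hint : ∀ s, 1 < s → Integrable fun z => s / 2 * Real.exp (-s * |z|) * φ z)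
    (hbd : ∀ s, 1 < s → ∫ z, ‖s / 2 * Real.exp (-s * |z|) * φ z‖ ≤ C) :
    Integrable (fun z => kernel z * φ z) ∧
      ∫ z, kernel z * φ z = ∫ s, (∫ z, s / 2 * Real.exp (-s * |z|) * φ z) ∂mixing := by
  have hm : Measurable fun p : ℝ × ℝ => p.1 / 2 * Real.exp (-p.1 * |p.2|) * φ p.2 := by fun_prop
  have hI : Integrable (fun p : ℝ × ℝ => p.1 / 2 * Real.exp (-p.1 * |p.2|) * φ p.2)
      (mixing.prod volume) := by
    rw [integrable_prod_iff hm.aestronglyMeasurable]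
    refine ⟨?_, ?_⟩
    · filter_upwards [ae_mixing_one_lt] with s hs using hint s hs
    · refine Integrable.of_bound (C := C) ?_ ?_
      · exact hm.norm.stronglyMeasurable.integral_prod_right'.aestronglyMeasurable
      · filter_upwards [ae_mixing_one_lt] with s hs
        rw [Real.norm_of_nonneg (integral_nonneg fun z => norm_nonneg _)]
        exact hbd s hs
  have e : ∀ z, kernel z * φ z = ∫ s, s / 2 * Real.exp (-s * |z|) * φ z ∂mixing := fun z => by
    rw [kernel, integral_mul_const]
  simp_rw [e]
  exact ⟨hI.integral_prod_right, (integral_integral_swap hI).symm⟩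

theorem kernel_integrand_le {s z : ℝ} (hs : 0 < s) (hz : z ≠ 0) :
    s / 2 * Real.exp (-s * |z|) ≤ 1 / |z| := by
  have hz' := abs_pos.2 hz
  have h1 : s * |z| ≤ Real.exp (s * |z|) := by
    have := Real.add_one_le_exp (s * |z|)
    linarith
  rw [neg_mul, Real.exp_neg, ← div_eq_mul_inv, div_le_div_iff₀ (Real.exp_pos _) hz']
  nlinarith [mul_pos hs hz']

theorem integrable_kernel_integrand {z : ℝ} (hz : z ≠ 0) :
    Integrable (fun s => s / 2 * Real.exp (-s * |z|)) mixing := by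
  refine Integrable.of_bound (C := 1 / |z|) (by fun_prop) ?_
  filter_upwards [ae_mixing_one_lt] with s hs
  rw [Real.norm_of_nonneg (by positivity)]
  exact kernel_integrand_le (by linarith) hz

/-- Each property holds for all Laplace densities of rate s > 1, with bounds uniform in s, and
passes to the average by Fubini. -/
theorem isWhithamKernel_kernel : IsWhithamKernel kernel where
  measurable := by
    have hm : Measurable fun p : ℝ × ℝ => p.2 / 2 * Real.exp (-p.2 * |p.1|) := by fun_prop
    exact hm.stronglyMeasurable.integral_prod_right'.measurable
  nonneg z := by
    refine integral_nonneg_of_ae ?_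
    filter_upwards [ae_mixing_one_lt] with s hs
    positivity
  even z := by simp [kernel]
  antitoneOn := by
    intro x hx y hy hxy
    have hx' : 0 < x := hx
    have hy' : 0 < y := hy
    refine integral_mono_ae (integrable_kernel_integrand hy'.ne') (integrable_kernel_integrand hx'.ne') ?_
    filter_upwards [ae_mixing_one_lt] with s hs
    rw [abs_of_pos hx', abs_of_pos hy']
    have : -s * y ≤ -s * x := by nlinarith
    have := Real.exp_le_exp.2 this
    gcongr
  integrable := by
    have := (integrable_kernel_mul (φ := fun _ => 1) measurable_const (C := 1)
      (fun s hs => by simpa using integrable_exp_neg_mul_abs (one_pos.trans hs)) (fun s hs => ?_)).1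
    · simpa using this
    · simp only [mul_one]
      rw [← integral_exp_neg_mul_abs (one_pos.trans hs)]
      refine (integral_congr_ae (Eventually.of_forall fun z => ?_)).le
      exact Real.norm_of_nonneg (by positivity)
  integral_eq_one := by
    have := (integrable_kernel_mul (φ := fun _ => 1) measurable_const (C := 1)
      (fun s hs => by simpa using integrable_exp_neg_mul_abs (one_pos.trans hs)) (fun s hs => ?_)).2
    · simp only [mul_one] at this
      rw [this]
      have h2 : ∫ s, (∫ z, s / 2 * Real.exp (-s * |z|)) ∂mixing = ∫ _, (1 : ℝ) ∂mixing := by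
        refine integral_congr_ae ?_
        filter_upwards [ae_mixing_one_lt] with s hs using integral_exp_neg_mul_abs (one_pos.trans hs)
      rw [h2]
      simp
    · simp only [mul_one]
      rw [← integral_exp_neg_mul_abs (one_pos.trans hs)]
      refine (integral_congr_ae (Eventually.of_forall fun z => ?_)).le
      exact Real.norm_of_nonneg (by positivity)
  integrable_sq_mul := by
    have hI : ∀ s : ℝ, 1 < s → Integrable fun z : ℝ =>
        16 * (s / 2 / 2 * Real.exp (-(s / 2) * |z|)) := fun s hs =>
      (integrable_exp_neg_mul_abs (s := s / 2) (by linarith)).const_mul 16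
    have hint : ∀ s : ℝ, 1 < s → Integrable fun z : ℝ => s / 2 * Real.exp (-s * |z|) * z ^ 2 := by
      intro s hs
      refine (hI s hs).mono' (by fun_prop) (Eventually.of_forall fun z => ?_)
      rw [Real.norm_of_nonneg (by positivity)]
      exact sq_mul_exp_le hs z
    refine (integrable_kernel_mul (φ := fun z => z ^ 2) (by fun_prop) (C := 16) hint
      (fun s hs => ?_)).1
    calc _ ≤ ∫ z : ℝ, 16 * (s / 2 / 2 * Real.exp (-(s / 2) * |z|)) := by
          refine integral_mono (hint s hs).norm (hI s hs) fun z => ?_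
          dsimp only
          rw [Real.norm_of_nonneg (by positivity)]
          exact sq_mul_exp_le hs z
      _ = 16 := by rw [integral_const_mul, integral_exp_neg_mul_abs (by linarith), mul_one]
  integral_mul_cos ξ := by
    have hint : ∀ s : ℝ, 1 < s → Integrable fun z : ℝ =>
        s / 2 * Real.exp (-s * |z|) * Real.cos (ξ * z) := by
      intro s hs
      refine (integrable_exp_neg_mul_abs (one_pos.trans hs)).mono' (by fun_prop)
        (Eventually.of_forall fun z => ?_)
      rw [norm_mul, Real.norm_of_nonneg (by positivity)]
      exact mul_le_of_le_one_right (by positivity) (Real.abs_cos_le_one _)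
    rw [(integrable_kernel_mul (φ := fun z => Real.cos (ξ * z)) (by fun_prop) (C := 1) hint
      (fun s hs => ?_)).2]
    · have h2 : ∫ s, (∫ z, s / 2 * Real.exp (-s * |z|) * Real.cos (ξ * z)) ∂mixing =
          ∫ s, s ^ 2 / (s ^ 2 + ξ ^ 2) ∂mixing := by
        refine integral_congr_ae ?_
        filter_upwards [ae_mixing_one_lt] with s hs using
          integral_exp_neg_mul_cos (one_pos.trans hs) ξ
      rw [h2, integral_eq_lintegral_of_nonneg_ae (Eventually.of_forall fun s => by positivity)
        (Measurable.aestronglyMeasurable (by fun_prop)), lintegral_mixing_symbol, ENNReal.toReal_ofReal (symbol_half_mem ξ).1]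
    · rw [← integral_exp_neg_mul_abs (one_pos.trans hs)]
      refine integral_mono (hint s hs).norm (integrable_exp_neg_mul_abs (one_pos.trans hs)) fun z => ?_
      dsimp only
      rw [norm_mul, Real.norm_of_nonneg (by positivity)]
      exact mul_le_of_le_one_right (by positivity) (Real.abs_cos_le_one _)

/-! ### The functional as a difference form. -/

theorem measurePreserving_add_const (z : ℝ) : MeasurePreserving (fun x : ℝ => x + z) volume volume :=
  measurePreserving_add_right volume z

theorem memLp_phase (z : ℝ) :
    MemLp (fun ξ : ℝ => Complex.exp ((2 * Real.pi * (z * ξ) : ℝ) * Complex.I)) ∞ volume := by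
  refine memLp_top_of_bound ?_ 1 (Eventually.of_forall fun ξ => ?_)
  · exact Continuous.aestronglyMeasurable (by fun_prop)
  · rw [Complex.norm_exp_ofReal_mul_I]

/-- Both sides are continuous in F, so Schwartz functions suffice, for which the transform is an
honest integral and translation is a change of variables. -/
theorem fourier_translate (z : ℝ) (F : Lp (α := ℝ) ℂ 2 volume) :
    𝓕 (Lp.compMeasurePreserving _ (measurePreserving_add_const z) F) =
      ((memLp_phase z).toLp _ • 𝓕 F : Lp (α := ℝ) ℂ 2 volume) := by
  have hsm : Continuous fun G : Lp (α := ℝ) ℂ 2 volume => ((memLp_phase z).toLp _ • G : Lp (α := ℝ) ℂ 2 volume) :=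
    AddMonoidHomClass.continuous_of_bound
      (AddMonoidHom.mk' (fun G : Lp (α := ℝ) ℂ 2 volume => ((memLp_phase z).toLp _ • G : Lp (α := ℝ) ℂ 2 volume))
        (Lp.add_smul _)) ‖(memLp_phase z).toLp _‖ (Lp.norm_smul_le _)
  have hF : Continuous fun G : Lp (α := ℝ) ℂ 2 volume => 𝓕 G := FourierTransform.continuous_fourier
  refine DenseRange.induction_on (p := fun F : Lp (α := ℝ) ℂ 2 volume =>
      𝓕 (Lp.compMeasurePreserving _ (measurePreserving_add_const z) F) =
      ((memLp_phase z).toLp _ • 𝓕 F : Lp (α := ℝ) ℂ 2 volume))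
    (SchwartzMap.denseRange_toLpCLM (E := ℝ) (F := ℂ) (p := 2) (μ := volume) ENNReal.ofNat_ne_top) F ?_ ?_
  · exact isClosed_eq (hF.comp (Lp.isometry_compMeasurePreserving _).continuous) (hsm.comp hF)
  · intro f
    have hg : Function.HasTemperateGrowth fun x : ℝ => x + z := by fun_prop
    have hanti : AntilipschitzWith 1 fun x : ℝ => x + z := (isometry_add_right z).antilipschitz
    set g : SchwartzMap ℝ ℂ := SchwartzMap.compCLMOfAntilipschitz ℂ hg hanti f with hgdef
    have h1 : Lp.compMeasurePreserving _ (measurePreserving_add_const z)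
        (SchwartzMap.toLpCLM ℝ ℂ 2 volume f) = g.toLp 2 := by
      refine Lp.ext ?_
      refine (Lp.coeFn_compMeasurePreserving _ _).trans ?_
      have h2 := (measurePreserving_add_const z).quasiMeasurePreserving.ae_eq_comp
        (SchwartzMap.coeFn_toLp f 2 volume)
      refine h2.trans ?_
      exact (SchwartzMap.coeFn_toLp g 2 volume).symm
    rw [h1, SchwartzMap.toLp_fourier_eq, SchwartzMap.toLpCLM_apply, SchwartzMap.toLp_fourier_eq]
    refine Lp.ext ?_
    refine (SchwartzMap.coeFn_toLp _ 2 volume).trans ?_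
    refine EventuallyEq.trans ?_ (Lp.coeFn_lpSMul _ _).symm
    filter_upwards [(memLp_phase z).coeFn_toLp, SchwartzMap.coeFn_toLp (𝓕 f) 2 volume] with ξ e1 e2
    rw [Pi.smul_apply', e1, e2, SchwartzMap.fourier_coe, SchwartzMap.fourier_coe]
    have h3 := congrFun (VectorFourier.fourierIntegral_comp_add_right Real.fourierChar volume
      (innerₗ ℝ) (f : ℝ → ℂ) z) ξ
    rw [Circle.smul_def, Real.fourierChar_apply] at h3
    have e3 : ((2 * Real.pi * (z * ξ) : ℝ) : ℂ) * Complex.I =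
        ((2 * Real.pi * (innerₗ ℝ z ξ) : ℝ) : ℂ) * Complex.I := by
      congr 3
      simp [mul_comm]
    rw [e3]
    exact h3

theorem norm_sq_Lp_two (G : Lp (α := ℝ) ℂ 2 volume) :
    ‖G‖ ^ 2 = ∫ x, ‖G x‖ ^ 2 ∧ Integrable fun x => ‖G x‖ ^ 2 := by
  constructor
  · have h1 := inner_self_eq_norm_sq_to_K (𝕜 := ℂ) G
    rw [L2.inner_def] at h1
    have h2 : ∀ x, inner ℂ (G x) (G x) = ((‖G x‖ ^ 2 : ℝ) : ℂ) := fun x => by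
      rw [inner_self_eq_norm_sq_to_K]; push_cast; rfl
    simp_rw [h2] at h1
    rw [integral_complex_ofReal] at h1
    exact (Complex.ofReal_injective (h1.trans (by push_cast; rfl))).symm
  · exact (memLp_two_iff_integrable_sq_norm (Lp.aestronglyMeasurable G)).1 (Lp.memLp G)

theorem ofReal_norm_sq_Lp_two (G : Lp (α := ℝ) ℂ 2 volume) :
    ENNReal.ofReal (‖G‖ ^ 2) = ∫⁻ x, ENNReal.ofReal (‖G x‖ ^ 2) := by
  obtain ⟨h1, h2⟩ := norm_sq_Lp_two G
  rw [h1, ofReal_integral_eq_lintegral_ofReal h2 (Eventually.of_forall fun x => by positivity)]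

/-- Plancherel together with |e^{iθ} - 1|² = 2 - 2 cos θ. -/
theorem lintegral_sub_translate (z : ℝ) (F : Lp (α := ℝ) ℂ 2 volume) :
    ∫⁻ x, ENNReal.ofReal (‖F (x + z) - F x‖ ^ 2) =
      ∫⁻ ξ, ENNReal.ofReal ((2 - 2 * Real.cos (2 * Real.pi * ξ * z)) * ‖(𝓕 F : Lp (α := ℝ) ℂ 2 volume) ξ‖ ^ 2) := by
  set T := Lp.compMeasurePreserving _ (measurePreserving_add_const z) F with hT
  have h1 : ∫⁻ x, ENNReal.ofReal (‖F (x + z) - F x‖ ^ 2) = ENNReal.ofReal (‖T - F‖ ^ 2) := by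
    rw [ofReal_norm_sq_Lp_two]
    refine lintegral_congr_ae ?_
    filter_upwards [Lp.coeFn_sub T F, Lp.coeFn_compMeasurePreserving F (measurePreserving_add_const z)]
      with x e1 e2
    rw [e1, Pi.sub_apply, hT, e2]
    rfl
  have h2 : ‖T - F‖ = ‖(𝓕 T : Lp (α := ℝ) ℂ 2 volume) - 𝓕 F‖ := by
    rw [← Lp.norm_fourier_eq (T - F)]
    exact congrArg norm ((Lp.fourierTransformₗᵢ ℝ ℂ).map_sub T F)
  rw [h1, h2, ofReal_norm_sq_Lp_two, hT, fourier_translate]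
  refine lintegral_congr_ae ?_
  filter_upwards [Lp.coeFn_sub ((memLp_phase z).toLp _ • 𝓕 F : Lp (α := ℝ) ℂ 2 volume) (𝓕 F),
    Lp.coeFn_lpSMul (r := 2) ((memLp_phase z).toLp _) (𝓕 F : Lp (α := ℝ) ℂ 2 volume),
    (memLp_phase z).coeFn_toLp] with ξ e1 e2 e3
  rw [e1, Pi.sub_apply, e2, Pi.smul_apply', e3, smul_eq_mul, ← sub_one_mul, norm_mul, mul_pow]
  congr 2
  rw [← Complex.normSq_eq_norm_sq, Complex.normSq_apply]
  simp only [Complex.sub_re, Complex.sub_im, Complex.exp_ofReal_mul_I_re, Complex.exp_ofReal_mul_I_im,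
    Complex.one_re, Complex.one_im, sub_zero]
  have h3 := Real.sin_sq_add_cos_sq (2 * Real.pi * (z * ξ))
  rw [show 2 * Real.pi * ξ * z = 2 * Real.pi * (z * ξ) by ring]
  linear_combination h3

theorem symbol_quarter_sq (ξ : ℝ) : symbol (1 / 4) ξ ^ 2 = symbol (1 / 2) ξ := by
  unfold symbol
  split_ifs with h
  · norm_num
  · rw [← Real.rpow_natCast, ← Real.rpow_mul (tanh_div_mem h).1]
    norm_num

theorem memLp_ofReal {f : ℝ → ℝ} (hf : MemLp f 2 volume) :
    MemLp (fun x => (f x : ℂ)) 2 volume := hf.ofReal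

theorem J_sq_eq {f : ℝ → ℝ} (hf : MemLp f 2 volume) :
    J f ^ 2 = ∫ ξ, symbol (1 / 2) (2 * Real.pi * ξ) *
      ‖(𝓕 ((memLp_ofReal hf).toLp _) : Lp (α := ℝ) ℂ 2 volume) ξ‖ ^ 2 := by
  rw [J, dif_pos (memLp_ofReal hf), convK]
  have h1 : ∀ G : Lp (α := ℝ) ℂ 2 volume, ‖(𝓕⁻ G : Lp (α := ℝ) ℂ 2 volume)‖ = ‖G‖ :=
    (Lp.fourierTransformₗᵢ ℝ ℂ).symm.norm_map
  rw [h1, (norm_sq_Lp_two _).1]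
  refine integral_congr_ae ?_
  filter_upwards [Lp.coeFn_lpSMul (r := 2) ((memLp_symbol (a := 1 / 4) (by norm_num)).toLp _)
    (𝓕 ((memLp_ofReal hf).toLp _) : Lp (α := ℝ) ℂ 2 volume),
    (memLp_symbol (a := 1 / 4) (by norm_num)).coeFn_toLp] with ξ e1 e2
  rw [e1, Pi.smul_apply', e2, smul_eq_mul, norm_mul, mul_pow, Complex.norm_real, Real.norm_eq_abs,
    sq_abs, symbol_quarter_sq]

theorem norm_fourier_toLp_sq {f : ℝ → ℝ} (hf : MemLp f 2 volume) :
    ∫ ξ, ‖(𝓕 ((memLp_ofReal hf).toLp _) : Lp (α := ℝ) ℂ 2 volume) ξ‖ ^ 2 = ∫ x, f x ^ 2 := by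
  rw [← (norm_sq_Lp_two _).1, Lp.norm_fourier_eq, (norm_sq_Lp_two _).1]
  refine integral_congr_ae ?_
  filter_upwards [(memLp_ofReal hf).coeFn_toLp] with x e
  rw [e, Complex.norm_real, Real.norm_eq_abs, sq_abs]

theorem J_nonneg (f : ℝ → ℝ) : 0 ≤ J f := by
  unfold J
  split_ifs
  · exact norm_nonneg _
  · exact le_rfl

theorem integrable_symbol_mul {f : ℝ → ℝ} (hf : MemLp f 2 volume) :
    Integrable fun ξ => symbol (1 / 2) (2 * Real.pi * ξ) *
      ‖(𝓕 ((memLp_ofReal hf).toLp _) : Lp (α := ℝ) ℂ 2 volume) ξ‖ ^ 2 := by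
  refine (norm_sq_Lp_two (𝓕 ((memLp_ofReal hf).toLp _))).2.mono' ?_ ?_
  · exact (((measurable_symbol _).comp (by fun_prop)).aestronglyMeasurable).mul
      (norm_sq_Lp_two _).2.aestronglyMeasurable
  · refine Eventually.of_forall fun ξ => ?_
    obtain ⟨m0, m1⟩ := symbol_half_mem (2 * Real.pi * ξ)
    rw [Real.norm_of_nonneg (by positivity)]
    exact mul_le_of_le_one_left (by positivity) m1

theorem J_sq_le {f : ℝ → ℝ} (hf : MemLp f 2 volume) : J f ^ 2 ≤ ∫ x, f x ^ 2 := by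
  rw [J_sq_eq hf, ← norm_fourier_toLp_sq hf]
  refine integral_mono (integrable_symbol_mul hf) (norm_sq_Lp_two _).2 fun ξ => ?_
  exact mul_le_of_le_one_left (by positivity) (symbol_half_mem _).2

/-- The quadratic form `∬ W(z) (f(x+z) - f(x))² dx dz`. -/
noncomputable def diffForm (W f : ℝ → ℝ) : ℝ≥0∞ :=
  ∫⁻ z, ENNReal.ofReal (W z) * ∫⁻ x, ENNReal.ofReal ((f (x + z) - f x) ^ 2)

theorem lintegral_kernel_cos {W : ℝ → ℝ} (hW : IsWhithamKernel W) (ξ : ℝ) :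
    ∫⁻ z, ENNReal.ofReal (W z) * ENNReal.ofReal (2 - 2 * Real.cos (ξ * z)) =
      ENNReal.ofReal (2 - 2 * symbol (1 / 2) ξ) := by
  have hc : Integrable fun z => W z * Real.cos (ξ * z) := by
    refine hW.integrable.mono' (hW.measurable.mul (by fun_prop)).aestronglyMeasurable
      (Eventually.of_forall fun z => ?_)
    rw [norm_mul, Real.norm_of_nonneg (hW.nonneg z)]
    exact mul_le_of_le_one_right (hW.nonneg z) (Real.abs_cos_le_one _)
  have h1 : Integrable fun z => 2 * W z - 2 * (W z * Real.cos (ξ * z)) :=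
    (hW.integrable.const_mul 2).sub (hc.const_mul 2)
  have h2 : ∫ z, (2 * W z - 2 * (W z * Real.cos (ξ * z))) = 2 - 2 * symbol (1 / 2) ξ := by
    rw [integral_sub (hW.integrable.const_mul 2) (hc.const_mul 2), integral_const_mul,
      integral_const_mul, hW.integral_eq_one, hW.integral_mul_cos, mul_one]
  have hp : ∀ z, 0 ≤ 2 * W z - 2 * (W z * Real.cos (ξ * z)) := fun z => by
    nlinarith [hW.nonneg z, Real.cos_le_one (ξ * z)]
  rw [← h2, ofReal_integral_eq_lintegral_ofReal h1 (Eventually.of_forall hp)]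
  refine lintegral_congr fun z => ?_
  rw [← ENNReal.ofReal_mul (hW.nonneg z)]
  congr 1
  ring

/-- Plancherel in x turns the inner integral into one with weight 2 - 2 cos(2πξz); averaging this
weight over z against W leaves 2 - 2 m, with m the symbol. Positivity of W lets Tonelli apply. -/
theorem diffForm_eq {W f : ℝ → ℝ} (hW : IsWhithamKernel W) (hf : MemLp f 2 volume) :
    diffForm W f = ENNReal.ofReal (2 * ((∫ x, f x ^ 2) - J f ^ 2)) := by
  set F := (memLp_ofReal hf).toLp _ with hF
  set A : ℝ → ℝ := fun ξ => ‖(𝓕 F : Lp (α := ℝ) ℂ 2 volume) ξ‖ ^ 2 with hA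
  have hAm : Measurable A := ((Lp.stronglyMeasurable (𝓕 F)).measurable.norm.pow_const 2)
  have h1 : ∀ z, ∫⁻ x, ENNReal.ofReal ((f (x + z) - f x) ^ 2) =
      ∫⁻ ξ, ENNReal.ofReal (2 - 2 * Real.cos (2 * Real.pi * ξ * z)) * ENNReal.ofReal (A ξ) := by
    intro z
    have e : ∫⁻ x, ENNReal.ofReal ((f (x + z) - f x) ^ 2) =
        ∫⁻ x, ENNReal.ofReal (‖F (x + z) - F x‖ ^ 2) := by
      refine lintegral_congr_ae ?_
      have h2 := (memLp_ofReal hf).coeFn_toLp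
      have h3 := (measurePreserving_add_const z).quasiMeasurePreserving.ae_eq_comp h2
      filter_upwards [h2, h3] with x e1 e2
      simp only [Function.comp_apply] at e2
      rw [hF, e1, e2, ← Complex.ofReal_sub, Complex.norm_real, Real.norm_eq_abs, sq_abs]
    rw [e, lintegral_sub_translate]
    refine lintegral_congr fun ξ => ?_
    rw [← ENNReal.ofReal_mul]
    linarith [Real.cos_le_one (2 * Real.pi * ξ * z)]
  have h2 : diffForm W f = ∫⁻ ξ, ENNReal.ofReal (A ξ) *
      ENNReal.ofReal (2 - 2 * symbol (1 / 2) (2 * Real.pi * ξ)) := by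
    unfold diffForm
    simp_rw [h1]
    have hWm := hW.measurable
    calc _ = ∫⁻ z, ∫⁻ ξ, ENNReal.ofReal (W z) *
          (ENNReal.ofReal (2 - 2 * Real.cos (2 * Real.pi * ξ * z)) * ENNReal.ofReal (A ξ)) := by
          refine lintegral_congr fun z => ?_
          rw [lintegral_const_mul' _ _ ENNReal.ofReal_ne_top]
      _ = ∫⁻ ξ, ∫⁻ z, ENNReal.ofReal (W z) *
          (ENNReal.ofReal (2 - 2 * Real.cos (2 * Real.pi * ξ * z)) * ENNReal.ofReal (A ξ)) := by
          refine lintegral_lintegral_swap (Measurable.aemeasurable ?_)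
          unfold Function.uncurry
          fun_prop
      _ = _ := by
          refine lintegral_congr fun ξ => ?_
          rw [← lintegral_kernel_cos hW, ← lintegral_const_mul' _ _ ENNReal.ofReal_ne_top]
          refine lintegral_congr fun z => ?_
          ring
  have hI1 := (norm_sq_Lp_two (𝓕 F)).2
  have hI2 := integrable_symbol_mul hf
  have h3 : 2 * ((∫ x, f x ^ 2) - J f ^ 2) =
      ∫ ξ, (2 * A ξ - 2 * (symbol (1 / 2) (2 * Real.pi * ξ) * A ξ)) := by
    rw [integral_sub (hI1.const_mul 2) (hI2.const_mul 2), integral_const_mul, integral_const_mul,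
      J_sq_eq hf, ← norm_fourier_toLp_sq hf]
    ring
  rw [h2, h3, ofReal_integral_eq_lintegral_ofReal (f := fun ξ =>
    2 * A ξ - 2 * (symbol (1 / 2) (2 * Real.pi * ξ) * A ξ)) ((hI1.const_mul 2).sub (hI2.const_mul 2))
    (Eventually.of_forall fun ξ => ?_)]
  · refine lintegral_congr fun ξ => ?_
    rw [← ENNReal.ofReal_mul (by positivity)]
    congr 1
    ring
  · have := (symbol_half_mem (2 * Real.pi * ξ)).2
    have hA0 : 0 ≤ A ξ := by positivity
    simp only [Pi.zero_apply]
    nlinarith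

/-! ### The Riesz rearrangement inequality for sets. -/

/-- A lower set of reals either has a greatest element or is a countable directed union of rational
half-lines. -/
theorem measure_inter_isLowerSet_le {B L : Set ℝ} {c : ℝ≥0∞} (hL : IsLowerSet L)
    (h : ∀ y ∈ L, volume (B ∩ Iic y) ≤ c) : volume (B ∩ L) ≤ c := by
  by_cases hm : ∃ m, IsGreatest L m
  · obtain ⟨m, hm1, hm2⟩ := hm
    exact (measure_mono (inter_subset_inter_right _ fun y hy => hm2 hy)).trans (h m hm1)
  · push Not at hm
    have hU : B ∩ L ⊆ ⋃ q : {q : ℚ // (q : ℝ) ∈ L}, B ∩ Iic ((q : ℚ) : ℝ) := by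
      rintro y ⟨hyB, hyL⟩
      have : ∃ y' ∈ L, y < y' := by
        by_contra hcon
        push Not at hcon
        exact hm y ⟨hyL, hcon⟩
      obtain ⟨y', hy', hlt⟩ := this
      obtain ⟨q, hq1, hq2⟩ := exists_rat_btwn hlt
      exact mem_iUnion.2 ⟨⟨q, hL hq2.le hy'⟩, hyB, hq1.le⟩
    refine (measure_mono hU).trans ?_
    rw [Directed.measure_iUnion]
    · exact iSup_le fun q => h _ q.2
    · intro q q'
      rcases le_total (q : ℚ) q' with hq | hq
      · exact ⟨q', inter_subset_inter_right _ (Iic_subset_Iic.2 (by exact_mod_cast hq)), Subset.rfl⟩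
      · exact ⟨q, Subset.rfl, inter_subset_inter_right _ (Iic_subset_Iic.2 (by exact_mod_cast hq))⟩

theorem measure_inter_isUpperSet_le {B L : Set ℝ} {c : ℝ≥0∞} (hL : IsUpperSet L)
    (h : ∀ y ∈ L, volume (B ∩ Ici y) ≤ c) : volume (B ∩ L) ≤ c := by
  have e : ∀ S : Set ℝ, volume (-S) = volume S := fun S => Measure.measure_neg _ S
  rw [← e, inter_neg]
  refine measure_inter_isLowerSet_le (fun x y hxy hx => ?_) fun y hy => ?_
  · exact hL (neg_le_neg hxy) hx
  · rw [← e, inter_neg, neg_neg, neg_Iic]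
    exact h (-y) hy

/-- The measure of `B` to the left of a point. -/
noncomputable def leftMass (B : Set ℝ) (y : ℝ) : ℝ≥0∞ := volume (B ∩ Iic y)

theorem leftMass_mono (B : Set ℝ) : Monotone (leftMass B) := fun _ _ h =>
  measure_mono (inter_subset_inter_right _ (Iic_subset_Iic.2 h))

theorem leftMass_le_add (B : Set ℝ) (z y : ℝ) : leftMass B y ≤ leftMass B z + ENNReal.ofReal (y - z) := by
  rw [← Real.volume_Ioc]
  refine (measure_mono ?_).trans (measure_union_le _ _)
  rintro x ⟨hxB, hx⟩
  by_cases hxz : x ≤ z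
  · exact Or.inl ⟨hxB, hxz⟩
  · exact Or.inr ⟨not_le.1 hxz, hx⟩

theorem measure_leftMass_lt_le (B : Set ℝ) (c : ℝ≥0∞) : volume (B ∩ {y | leftMass B y < c}) ≤ c :=
  measure_inter_isLowerSet_le (fun _ _ hab ha => lt_of_le_of_lt (leftMass_mono B hab) ha)
    fun _ hy => le_of_lt hy

/-- Every point y with left mass at least t leaves at most |B| - t of B to its right, since single
points are null; hence the set of such points in B is no larger than that. -/
theorem le_measure_leftMass_lt {B : Set ℝ} (hfin : volume B ≠ ∞) {t : ℝ≥0∞}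
    (ht : t ≤ volume B) : t ≤ volume (B ∩ {y | leftMass B y < t}) := by
  have htfin : t ≠ ∞ := ne_top_of_le_ne_top hfin ht
  have hup : volume (B ∩ {y | t ≤ leftMass B y}) ≤ volume B - t := by
    refine measure_inter_isUpperSet_le (fun a b hab ha => le_trans ha (leftMass_mono B hab)) ?_
    intro y hy
    refine ENNReal.le_sub_of_add_le_right htfin ?_
    have h1 : volume (B ∩ Ici y) = volume (B ∩ Ioi y) := by
      refine measure_congr ?_
      exact (ae_eq_refl B).inter Ioi_ae_eq_Ici.symm
    rw [h1]
    calc volume (B ∩ Ioi y) + t ≤ volume (B ∩ Ioi y) + volume (B ∩ Iic y) := by gcongr; exact hy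
      _ = volume B := by
        rw [add_comm, ← measure_inter_add_sdiff B (measurableSet_Iic (a := y)), sdiff_eq, compl_Iic]
  have hm : MeasurableSet {y | leftMass B y < t} :=
    measurableSet_lt (leftMass_mono B).measurable measurable_const
  have h2 := measure_inter_add_sdiff (μ := volume) B hm
  have h3 : B \ {y | leftMass B y < t} = B ∩ {y | t ≤ leftMass B y} := by
    ext y; simp
  rw [h3] at h2
  have h4 : volume B ≤ volume (B ∩ {y | leftMass B y < t}) + (volume B - t) := by
    rw [← h2] at hup ⊢
    gcongr
  have h5 : t + (volume B - t) ≤ volume (B ∩ {y | leftMass B y < t}) + (volume B - t) := by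
    rwa [add_tsub_cancel_of_le ht]
  exact (ENNReal.add_le_add_iff_right (ne_top_of_le_ne_top hfin tsub_le_self)).1 h5

/-- A continuous analogue of Pollard's theorem for an arbitrary set and an interval. -/
theorem le_lintegral_min_measure_inter_Ioo {B : Set ℝ} (hB : MeasurableSet B)
    (hfin : volume B ≠ ∞) {r t : ℝ} (ht : t ≤ 2 * r)
    (htB : ENNReal.ofReal t ≤ volume B) :
    ENNReal.ofReal t * (volume B + ENNReal.ofReal (2 * r)) ≤
      (∫⁻ x, min (volume (B ∩ Ioo (x - r) (x + r))) (ENNReal.ofReal t)) +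
        ENNReal.ofReal t * ENNReal.ofReal t := by
  set T := ENNReal.ofReal t with hT
  -- The measure of S is counted in both orders. For fixed x the slice consists of the first T units
  -- of B to the right of x - r, within the window.
  set S : Set (ℝ × ℝ) := {p | p.2 ∈ B ∧ p.2 ∈ Ioo (p.1 - r) (p.1 + r) ∧
    leftMass B p.2 < leftMass B (p.1 - r) + T} with hS
  have hFm := (leftMass_mono B).measurable
  have hSm : MeasurableSet S := by
    refine (measurable_snd hB).inter (MeasurableSet.inter ?_ ?_)
    · exact (measurableSet_lt (f := fun p : ℝ × ℝ => p.1 - r) (g := fun p => p.2) (by fun_prop)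
        (by fun_prop)).inter (measurableSet_lt (f := fun p : ℝ × ℝ => p.2) (g := fun p => p.1 + r)
        (by fun_prop) (by fun_prop))
    · exact measurableSet_lt (f := fun p : ℝ × ℝ => leftMass B p.2)
        (g := fun p => leftMass B (p.1 - r) + T) (by fun_prop) (by fun_prop)
  have hx : ∀ x, volume (Prod.mk x ⁻¹' S) ≤ min (volume (B ∩ Ioo (x - r) (x + r))) T := by
    intro x
    refine le_min (measure_mono fun y hy => ⟨hy.1, hy.2.1⟩) ?_
    set p := x - r with hp
    have hpf : leftMass B p ≠ ∞ := ne_top_of_le_ne_top hfin (measure_mono inter_subset_left)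
    have h1 := measure_leftMass_lt_le B (leftMass B p + T)
    rcases eq_or_ne T 0 with hT0 | hT0
    · rw [hT0, nonpos_iff_eq_zero]
      have : Prod.mk x ⁻¹' S = ∅ := by
        ext y
        simp only [mem_preimage, mem_empty_iff_false, iff_false]
        rintro ⟨_, h2, h3⟩
        simp only [hT0, add_zero] at h3
        exact absurd (leftMass_mono B h2.1.le) (not_le.2 h3)
      rw [this, measure_empty]
    · have hdis : Disjoint (B ∩ Iic p) (Prod.mk x ⁻¹' S) := by
        rw [Set.disjoint_left]
        rintro y ⟨_, hy⟩ ⟨_, h2, _⟩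
        exact absurd h2.1 (not_lt.2 hy)
      have h2 : leftMass B p + volume (Prod.mk x ⁻¹' S) ≤ leftMass B p + T := by
        refine le_trans ?_ h1
        rw [leftMass, ← measure_union hdis (measurable_prodMk_left hSm)]
        refine measure_mono ?_
        rintro y (hy | hy)
        · exact ⟨hy.1, lt_of_le_of_lt (leftMass_mono B hy.2) (ENNReal.lt_add_right hpf hT0)⟩
        · exact ⟨hy.1, hy.2.2⟩
      exact (ENNReal.add_le_add_iff_left hpf).1 h2
  -- For fixed y: if less than T of B lies to its left, all x within r count; otherwise those with x
  -- - r > y - t do, because left mass grows at most at unit speed.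
  have hy : ∀ y ∈ B, (if leftMass B y < T then ENNReal.ofReal (2 * r) else T) ≤
      volume ((fun x => (x, y)) ⁻¹' S) := by
    intro y hyB
    split_ifs with h
    · have e : ENNReal.ofReal (2 * r) = volume (Ioo (y - r) (y + r)) := by
        rw [Real.volume_Ioo]; congr 1; ring
      rw [e]
      refine measure_mono fun x hx => ⟨hyB, ⟨by dsimp only; linarith [hx.2], by dsimp only; linarith [hx.1]⟩, ?_⟩
      exact h.trans_le le_add_self
    · have e : T = volume (Ioo (y - t + r) (y + r)) := by
        rw [Real.volume_Ioo, hT]; congr 1; ring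
      rw [e]
      refine measure_mono fun x hx => ⟨hyB, ⟨by dsimp only; linarith [hx.2], by dsimp only; linarith [hx.1]⟩, ?_⟩
      refine (leftMass_le_add B (x - r) y).trans_lt ?_
      refine (ENNReal.add_lt_add_iff_left (ne_top_of_le_ne_top hfin (measure_mono inter_subset_left))).2 ?_
      exact (ENNReal.ofReal_lt_ofReal_iff_of_nonneg (by linarith [hx.2])).2 (by linarith [hx.1])
  have hprod1 : (volume.prod volume) S ≤ ∫⁻ x, min (volume (B ∩ Ioo (x - r) (x + r))) T := by
    rw [Measure.prod_apply hSm]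
    exact lintegral_mono hx
  have hmlt : MeasurableSet {y | leftMass B y < T} := measurableSet_lt hFm measurable_const
  have hprod2 : ∫⁻ y in B, (if leftMass B y < T then ENNReal.ofReal (2 * r) else T) ≤
      (volume.prod volume) S := by
    rw [Measure.prod_apply_symm hSm]
    exact (setLIntegral_mono' hB hy).trans (setLIntegral_le_lintegral _ _)
  set κ := volume (B ∩ {y | leftMass B y < T}) with hκ
  have hsplit : ∫⁻ y in B, (if leftMass B y < T then ENNReal.ofReal (2 * r) else T) =
      ENNReal.ofReal (2 * r) * κ + T * volume (B \ {y | leftMass B y < T}) := by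
    rw [← lintegral_inter_add_sdiff _ B hmlt]
    congr 1
    · rw [setLIntegral_congr_fun (g := fun _ => ENNReal.ofReal (2 * r)) (hB.inter hmlt)
        (fun y hy => if_pos (show leftMass B y < T from hy.2)), setLIntegral_const]
    · rw [setLIntegral_congr_fun (g := fun _ => T) (hB.diff hmlt)
        (fun y hy => if_neg (show ¬ leftMass B y < T from hy.2)), setLIntegral_const]
  have hκT : κ = T := le_antisymm (measure_leftMass_lt_le B T) (le_measure_leftMass_lt hfin htB)
  have htot : κ + volume (B \ {y | leftMass B y < T}) = volume B := measure_inter_add_sdiff B hmlt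
  have hfinal := hprod2.trans hprod1
  rw [hsplit] at hfinal
  calc T * (volume B + ENNReal.ofReal (2 * r))
      = (ENNReal.ofReal (2 * r) * κ + T * volume (B \ {y | leftMass B y < T})) + T * T := by
        rw [← htot, hκT]; ring
    _ ≤ _ := by gcongr

theorem lintegral_measure_inter_Ioo {B : Set ℝ} (hB : MeasurableSet B) (r : ℝ) :
    ∫⁻ x, volume (B ∩ Ioo (x - r) (x + r)) = volume B * ENNReal.ofReal (2 * r) := by
  set S : Set (ℝ × ℝ) := {p | p.2 ∈ B ∧ p.2 ∈ Ioo (p.1 - r) (p.1 + r)} with hS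
  have hSm : MeasurableSet S := by
    refine (measurable_snd hB).inter ?_
    exact (measurableSet_lt (f := fun p : ℝ × ℝ => p.1 - r) (g := fun p => p.2) (by fun_prop)
        (by fun_prop)).inter (measurableSet_lt (f := fun p : ℝ × ℝ => p.2) (g := fun p => p.1 + r)
        (by fun_prop) (by fun_prop))
  have h1 : (volume.prod volume) S = ∫⁻ x, volume (B ∩ Ioo (x - r) (x + r)) := by
    rw [Measure.prod_apply hSm]
    rfl
  rw [← h1, Measure.prod_apply_symm hSm]
  have h2 : ∀ y, volume ((fun x => (x, y)) ⁻¹' S) = B.indicator (fun _ => ENNReal.ofReal (2 * r)) y := by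
    intro y
    by_cases hy : y ∈ B
    · rw [indicator_of_mem hy]
      have e : (fun x => (x, y)) ⁻¹' S = Ioo (y - r) (y + r) := by
        ext x
        simp only [hS, mem_preimage, mem_ofPred_eq, mem_Ioo, hy, true_and]
        constructor <;> rintro ⟨h1, h2⟩ <;> constructor <;> linarith
      rw [e, Real.volume_Ioo]
      congr 1
      ring
    · rw [indicator_of_notMem hy]
      have e : (fun x => (x, y)) ⁻¹' S = ∅ := by
        ext x
        simp [hS, hy]
      rw [e, measure_empty]
  simp_rw [h2]
  rw [lintegral_indicator hB, setLIntegral_const, mul_comm]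

theorem lintegral_min_tent {c t : ℝ} (ht0 : 0 ≤ t) (ht : t ≤ c) :
    ∫⁻ x : ℝ, ENNReal.ofReal (min t (c - |x|)) = ENNReal.ofReal (2 * c * t - t ^ 2) := by
  set S : Set (ℝ × ℝ) := {p | p.2 ∈ Ioo 0 t ∧ |p.1| < c - p.2} with hS
  have hSm : MeasurableSet S := by
    refine (measurable_snd measurableSet_Ioo).inter ?_
    exact measurableSet_lt (f := fun p : ℝ × ℝ => |p.1|) (g := fun p => c - p.2) (by fun_prop)
      (by fun_prop)
  have h1 : (volume.prod volume) S = ∫⁻ x : ℝ, ENNReal.ofReal (min t (c - |x|)) := by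
    rw [Measure.prod_apply hSm]
    refine lintegral_congr fun x => ?_
    have e : Prod.mk x ⁻¹' S = Ioo 0 (min t (c - |x|)) := by
      ext s
      simp only [hS, mem_preimage, mem_ofPred_eq, mem_Ioo, lt_min_iff]
      constructor
      · rintro ⟨⟨h1, h2⟩, h3⟩; exact ⟨h1, h2, by linarith⟩
      · rintro ⟨h1, h2, h3⟩; exact ⟨⟨h1, h2⟩, by linarith⟩
    rw [e, Real.volume_Ioo, sub_zero]
  rw [← h1, Measure.prod_apply_symm hSm]
  have h2 : ∀ s, volume ((fun x => (x, s)) ⁻¹' S) =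
      (Ioo 0 t).indicator (fun s => ENNReal.ofReal (2 * (c - s))) s := by
    intro s
    by_cases hs : s ∈ Ioo 0 t
    · rw [indicator_of_mem hs]
      have e : (fun x => (x, s)) ⁻¹' S = Ioo (-(c - s)) (c - s) := by
        ext x
        simp only [hS, mem_preimage, mem_ofPred_eq, mem_Ioo, abs_lt]
        exact and_iff_right hs
      rw [e, Real.volume_Ioo]
      congr 1
      ring
    · rw [indicator_of_notMem hs]
      have e : (fun x => (x, s)) ⁻¹' S = ∅ := by
        ext x
        simp only [hS, mem_preimage, mem_ofPred_eq, hs, false_and, mem_empty_iff_false]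
      rw [e, measure_empty]
  simp_rw [h2]
  rw [lintegral_indicator measurableSet_Ioo, Measure.restrict_congr_set Ioo_ae_eq_Ioc,
    ← ofReal_integral_eq_lintegral_ofReal]
  · rw [← intervalIntegral.integral_of_le ht0]
    congr 1
    have : ∀ s ∈ uIcc 0 t, HasDerivAt (fun s => 2 * c * s - s ^ 2) (2 * (c - s)) s := by
      intro s _
      have h1 : HasDerivAt (fun s : ℝ => 2 * c * s) (2 * c) s := by
        simpa using (hasDerivAt_id s).const_mul (2 * c)
      refine (h1.sub (hasDerivAt_pow 2 s)).congr_deriv ?_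
      simp; ring
    rw [intervalIntegral.integral_eq_sub_of_hasDerivAt this (Continuous.intervalIntegrable (by fun_prop) _ _)]
    ring
  · exact (Continuous.integrableOn_Icc (by fun_prop)).mono_set Ioc_subset_Icc_self
  · refine (ae_restrict_iff' measurableSet_Ioc).2 (Eventually.of_forall fun s hs => ?_)
    have := hs.2
    simp only [Pi.zero_apply]
    linarith

theorem measure_Ioo_inter_Ioo (b r x : ℝ) : volume (Ioo (-b) b ∩ Ioo (x - r) (x + r)) =
    ENNReal.ofReal (min b (x + r) - max (-b) (x - r)) := by
  rw [Ioo_inter_Ioo, Real.volume_Ioo]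

theorem measure_Ioo_inter_Ioo_le (b r x : ℝ) : volume (Ioo (-b) b ∩ Ioo (x - r) (x + r)) ≤
    ENNReal.ofReal (b + r - |x|) := by
  rw [measure_Ioo_inter_Ioo]
  apply ENNReal.ofReal_le_ofReal
  have h1 := min_le_left b (x + r)
  have h2 := min_le_right b (x + r)
  have h3 := le_max_left (-b) (x - r)
  have h4 := le_max_right (-b) (x - r)
  rcases abs_cases x with ⟨h, _⟩ | ⟨h, _⟩ <;> rw [h] <;> linarith

theorem le_measure_Ioo_inter_Ioo {b r x t : ℝ} (h1 : t ≤ 2 * b) (h2 : t ≤ 2 * r) (h3 : t ≤ b + r - |x|) :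
    ENNReal.ofReal t ≤ volume (Ioo (-b) b ∩ Ioo (x - r) (x + r)) := by
  rw [measure_Ioo_inter_Ioo]
  apply ENNReal.ofReal_le_ofReal
  have h4 := le_abs_self x
  have h5 := neg_abs_le x
  rcases min_cases b (x + r) with ⟨e1, _⟩ | ⟨e1, _⟩ <;>
    rcases max_cases (-b) (x - r) with ⟨e2, _⟩ | ⟨e2, _⟩ <;> rw [e1, e2] <;> linarith

/-- The Riesz rearrangement inequality for two sets and a centred interval. -/
theorem riesz_sets {A B : Set ℝ} (hA : MeasurableSet A) (hB : MeasurableSet B) {a b r : ℝ}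
    (ha0 : 0 ≤ a) (hb0 : 0 ≤ b) (hr : 0 ≤ r) (ha : volume A = ENNReal.ofReal (2 * a))
    (hb : volume B = ENNReal.ofReal (2 * b)) :
    ∫⁻ x in A, volume (B ∩ Ioo (x - r) (x + r)) ≤
      ∫⁻ x in Ioo (-a) a, volume (Ioo (-b) b ∩ Ioo (x - r) (x + r)) := by
  set φ : ℝ → ℝ≥0∞ := fun x => volume (B ∩ Ioo (x - r) (x + r)) with hφ
  set ψ : ℝ → ℝ≥0∞ := fun x => volume (Ioo (-b) b ∩ Ioo (x - r) (x + r)) with hψ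
  have hvolA : volume (Ioo (-a) a) = ENNReal.ofReal (2 * a) := by
    rw [Real.volume_Ioo]; congr 1; ring
  have hvolB : volume (Ioo (-b) b) = ENNReal.ofReal (2 * b) := by
    rw [Real.volume_Ioo]; congr 1; ring
  have hφB : ∀ x, φ x ≤ ENNReal.ofReal (2 * b) := fun x =>
    (measure_mono inter_subset_left).trans hb.le
  have hφr : ∀ x, φ x ≤ ENNReal.ofReal (2 * r) := fun x =>
    (measure_mono inter_subset_right).trans (by rw [Real.volume_Ioo]; exact ENNReal.ofReal_le_ofReal (by linarith))
  -- The bathtub level: t is the value at |x| = a of the tent b + r - |x|, so for centred intervals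
  -- the overlap exceeds t exactly inside (-a, a) and the estimate `hpt1` becomes an equality.
  set t : ℝ := max 0 (b + r - a) with ht
  have ht0 : 0 ≤ t := le_max_left _ _
  have htc : t ≤ b + r := max_le (by linarith) (by linarith)
  by_cases hcase : t ≤ 2 * b ∧ t ≤ 2 * r
  · obtain ⟨htb, htr⟩ := hcase
    have hmeas : Measurable φ := by
      have hS : MeasurableSet {p : ℝ × ℝ | p.2 ∈ B ∧ p.2 ∈ Ioo (p.1 - r) (p.1 + r)} := by
        refine (measurable_snd hB).inter ?_
        exact (measurableSet_lt (f := fun p : ℝ × ℝ => p.1 - r) (g := fun p => p.2) (by fun_prop)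
          (by fun_prop)).inter (measurableSet_lt (f := fun p : ℝ × ℝ => p.2) (g := fun p => p.1 + r)
          (by fun_prop) (by fun_prop))
      exact measurable_measure_prodMk_left hS
    have hmeasψ : Measurable ψ := by
      have : ψ = fun x => ENNReal.ofReal (min b (x + r) - max (-b) (x - r)) :=
        funext fun x => measure_Ioo_inter_Ioo b r x
      rw [this]
      fun_prop
    set T := ENNReal.ofReal t with hT
    have hP := le_lintegral_min_measure_inter_Ioo hB (by rw [hb]; exact ENNReal.ofReal_ne_top) htr
      (by rw [hb]; exact ENNReal.ofReal_le_ofReal htb)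
    rw [hb] at hP
    have hI1 : (∫⁻ x, min (ψ x) T) + T * T ≤ T * (ENNReal.ofReal (2 * b) + ENNReal.ofReal (2 * r)) := by
      have h1 : ∫⁻ x, min (ψ x) T ≤ ENNReal.ofReal (2 * (b + r) * t - t ^ 2) := by
        rw [← lintegral_min_tent ht0 htc]
        refine lintegral_mono fun x => ?_
        rw [ENNReal.ofReal_min, min_comm]
        exact min_le_min le_rfl (measure_Ioo_inter_Ioo_le b r x)
      calc _ ≤ ENNReal.ofReal (2 * (b + r) * t - t ^ 2) + T * T := by gcongr
        _ = _ := by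
          rw [hT, ← ENNReal.ofReal_add (by linarith) (by linarith), ← ENNReal.ofReal_mul ht0,
            ← ENNReal.ofReal_mul ht0, ← ENNReal.ofReal_add (by nlinarith) (by positivity)]
          congr 1
          ring
    -- Pointwise, 1_A φ + min(φ, t) ≤ t 1_A + φ, and ∫ φ depends only on the measures. So ∫_A φ is
    -- large only if ∫ min(φ, t) is small, and the preceding double count shows that intervals
    -- minimise the latter.
    have hpt1 : (∫⁻ x in A, φ x) + ∫⁻ x, min (φ x) T ≤
        T * ENNReal.ofReal (2 * a) + ENNReal.ofReal (2 * b) * ENNReal.ofReal (2 * r) := by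
      rw [← hb, ← lintegral_measure_inter_Ioo hB r, ← ha, ← setLIntegral_const, ← lintegral_indicator hA,
        ← lintegral_indicator hA, ← lintegral_add_right _ (hmeas.min measurable_const),
        ← lintegral_add_right _ hmeas]
      refine lintegral_mono fun x => ?_
      dsimp only
      by_cases hx : x ∈ A
      · rw [indicator_of_mem hx, indicator_of_mem hx, add_comm]
        exact add_le_add (min_le_right _ _) le_rfl
      · rw [indicator_of_notMem hx, indicator_of_notMem hx]
        exact add_le_add le_rfl (min_le_left _ _)
    have hpt2 : T * ENNReal.ofReal (2 * a) + ENNReal.ofReal (2 * b) * ENNReal.ofReal (2 * r) ≤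
        (∫⁻ x in Ioo (-a) a, ψ x) + ∫⁻ x, min (ψ x) T := by
      rw [← hvolB, ← lintegral_measure_inter_Ioo measurableSet_Ioo r, ← hvolA, ← setLIntegral_const,
        ← lintegral_indicator measurableSet_Ioo, ← lintegral_indicator measurableSet_Ioo,
        ← lintegral_add_right _ (hmeasψ.min measurable_const), ← lintegral_add_right _ hmeasψ]
      refine lintegral_mono fun x => ?_
      dsimp only
      by_cases hx : x ∈ Ioo (-a) a
      · rw [indicator_of_mem hx, indicator_of_mem hx, add_comm]
        refine add_le_add le_rfl ?_
        rcases max_cases 0 (b + r - a) with ⟨e, _⟩ | ⟨e, _⟩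
        · rw [hT, ht, e, ENNReal.ofReal_zero]
          exact zero_le
        · refine le_min (le_measure_Ioo_inter_Ioo htb htr ?_) le_rfl
          rw [ht, e]
          linarith [abs_lt.2 hx]
      · rw [indicator_of_notMem hx, indicator_of_notMem hx]
        refine add_le_add le_rfl (le_min le_rfl ((measure_Ioo_inter_Ioo_le b r x).trans ?_))
        apply ENNReal.ofReal_le_ofReal
        have : a ≤ |x| := by
          by_contra h
          exact hx (abs_lt.1 (not_le.1 h))
        exact le_max_of_le_right (by linarith)
    have hTT : T * T ≠ ∞ := ENNReal.mul_ne_top ENNReal.ofReal_ne_top ENNReal.ofReal_ne_top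
    have hmin : ∫⁻ x, min (ψ x) T ≤ ∫⁻ x, min (φ x) T :=
      (ENNReal.add_le_add_iff_right hTT).1 (hI1.trans hP)
    have hfin : ∫⁻ x, min (φ x) T ≠ ∞ := by
      refine ne_top_of_le_ne_top ?_ (le_add_self.trans hpt1)
      finiteness
    refine (ENNReal.add_le_add_iff_right hfin).1 ?_
    exact (hpt1.trans hpt2).trans (by gcongr)
  -- Here A is so short that every point of (-a, a) sees the full overlap min(2b, 2r), the largest
  -- value that φ can take anywhere.
  · have hlt : 2 * b < t ∨ 2 * r < t := by
      by_contra h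
      push Not at h
      exact hcase h
    set h : ℝ := min (2 * b) (2 * r) with hh
    have hh1 : h < t := by
      rcases hlt with h1 | h1
      · exact (min_le_left _ _).trans_lt h1
      · exact (min_le_right _ _).trans_lt h1
    have hh0 : 0 ≤ h := le_min (by linarith) (by linarith)
    have ht' : t = b + r - a := by
      rcases max_cases 0 (b + r - a) with ⟨e, _⟩ | ⟨e, _⟩
      · rw [ht, e] at hh1; linarith
      · rw [ht, e]
    calc ∫⁻ x in A, φ x ≤ ∫⁻ _ in A, ENNReal.ofReal h := by
          refine lintegral_mono fun x => ?_
          rw [hh, ENNReal.ofReal_min]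
          exact le_min (hφB x) (hφr x)
      _ = ∫⁻ _ in Ioo (-a) a, ENNReal.ofReal h := by
          rw [setLIntegral_const, setLIntegral_const, ha, hvolA]
      _ ≤ _ := by
          refine setLIntegral_mono' measurableSet_Ioo fun x hx => ?_
          refine le_measure_Ioo_inter_Ioo (min_le_left _ _) (min_le_right _ _) ?_
          linarith [abs_lt.2 hx]

theorem measurable_of_even_antitoneOn {f : ℝ → ℝ} (he : ∀ x, f (-x) = f x)
    (ha : AntitoneOn f (Ioi 0)) : Measurable f := by
  refine measurable_of_Ioi fun t => ?_
  set S : Set ℝ := Ioi 0 ∩ f ⁻¹' Ioi t with hS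
  have hSo : S.OrdConnected := by
    refine ⟨fun x hx y hy z hz => ?_⟩
    have hz0 : 0 < z := lt_of_lt_of_le hx.1 hz.1
    exact ⟨hz0, lt_of_lt_of_le hy.2 (ha hz0 hy.1 hz.2)⟩
  have e : f ⁻¹' Ioi t = (S ∪ -S) ∪ ({0} ∩ f ⁻¹' Ioi t) := by
    ext x
    simp only [hS, mem_union, mem_inter_iff, mem_Ioi, mem_preimage, Set.mem_neg, mem_singleton_iff, he]
    constructor
    · intro h
      rcases lt_trichotomy x 0 with hx | hx | hx
      · exact Or.inl (Or.inr ⟨by linarith, h⟩)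
      · exact Or.inr ⟨hx, h⟩
      · exact Or.inl (Or.inl ⟨hx, h⟩)
    · rintro ((h | h) | h)
      exacts [h.2, h.2, h.2]
  rw [e]
  exact (hSo.measurableSet.union hSo.measurableSet.neg).union
    ((subsingleton_singleton.anti inter_subset_left).measurableSet)

/-! ### Layer-cake form of the interaction energy. -/

theorem IsWhithamKernel.le_one_div {W : ℝ → ℝ} (hW : IsWhithamKernel W) {z : ℝ} (hz : 0 < z) :
    W z ≤ 1 / z := by
  rw [le_div_iff₀ hz]
  calc W z * z = ∫ _ in Ioc 0 z, W z := by
        rw [setIntegral_const, Measure.real, Real.volume_Ioc, sub_zero, ENNReal.toReal_ofReal hz.le,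
          smul_eq_mul, mul_comm]
    _ ≤ ∫ x in Ioc 0 z, W x := by
        refine setIntegral_mono_on (by simp) hW.integrable.integrableOn measurableSet_Ioc fun x hx => ?_
        exact hW.antitoneOn hx.1 hz hx.2
    _ ≤ ∫ x, W x := setIntegral_le_integral hW.integrable (Eventually.of_forall hW.nonneg)
    _ = 1 := hW.integral_eq_one

theorem IsWhithamKernel.abs_eq {W : ℝ → ℝ} (hW : IsWhithamKernel W) (z : ℝ) : W |z| = W z := by
  rcases abs_choice z with h | h <;> rw [h]
  exact hW.even z

/-- Evenness and monotonicity make superlevel sets centred intervals, bounded because W(z) ≤ 1/z.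
The endpoints and the origin are left out, as W is uncontrolled there; they are null. -/
theorem IsWhithamKernel.exists_level {W : ℝ → ℝ} (hW : IsWhithamKernel W) {τ : ℝ} (hτ : 0 < τ) :
    ∃ ρ, 0 ≤ ρ ∧ ∀ z, z ≠ 0 → |z| ≠ ρ → (τ < W z ↔ |z| < ρ) := by
  set E : Set ℝ := {z | 0 < z ∧ τ < W z} with hE
  have hbd : ∀ z ∈ E, z ≤ 1 / τ := by
    rintro z ⟨h0, h1⟩
    have h2 := h1.trans_le (hW.le_one_div h0)
    rw [lt_div_iff₀ h0] at h2
    rw [le_div_iff₀ hτ]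
    linarith
  have hbdd : BddAbove E := ⟨1 / τ, hbd⟩
  refine ⟨sSup E, Real.sSup_nonneg fun z hz => hz.1.le, fun z hz hzne => ?_⟩
  have hz0 : 0 < |z| := abs_pos.2 hz
  rw [← hW.abs_eq z]
  constructor
  · intro h
    exact lt_of_le_of_ne (le_csSup hbdd ⟨hz0, h⟩) hzne
  · intro h
    have hne : E.Nonempty := by
      by_contra hcon
      rw [not_nonempty_iff_eq_empty] at hcon
      rw [hcon, Real.sSup_empty] at h
      linarith
    obtain ⟨y, hy, hlt⟩ := exists_lt_of_lt_csSup hne h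
    exact hy.2.trans_le (hW.antitoneOn hz0 hy.1 hlt.le)

theorem ofReal_eq_lintegral_indicator (u : ℝ) :
    ENNReal.ofReal u = ∫⁻ t in Ioi (0 : ℝ), (Iio u).indicator (fun _ => (1 : ℝ≥0∞)) t := by
  rw [lintegral_indicator measurableSet_Iio, Measure.restrict_restrict measurableSet_Iio,
    setLIntegral_const, one_mul, inter_comm, Ioi_inter_Iio, Real.volume_Ioo, sub_zero]

theorem lintegral_ofReal_mul_eq_layer {f : ℝ → ℝ} (hf : Measurable f) {g : ℝ → ℝ≥0∞}
    (hg : Measurable g) :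
    ∫⁻ x, ENNReal.ofReal (f x) * g x = ∫⁻ s in Ioi (0 : ℝ), ∫⁻ x in {x | s < f x}, g x := by
  have hm : Measurable fun p : ℝ × ℝ => (Iio (f p.1)).indicator (fun _ => (1 : ℝ≥0∞)) p.2 := by
    have : (fun p : ℝ × ℝ => (Iio (f p.1)).indicator (fun _ => (1 : ℝ≥0∞)) p.2) =
        {p : ℝ × ℝ | p.2 < f p.1}.indicator fun _ => 1 := by
      ext p; simp [indicator]
    rw [this]
    exact measurable_const.indicator (measurableSet_lt (by fun_prop) (by fun_prop))
  calc ∫⁻ x, ENNReal.ofReal (f x) * g x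
      = ∫⁻ x, ∫⁻ s in Ioi (0 : ℝ), (Iio (f x)).indicator (fun _ => (1 : ℝ≥0∞)) s * g x := by
        refine lintegral_congr fun x => ?_
        rw [ofReal_eq_lintegral_indicator,
          lintegral_mul_const _ (measurable_const.indicator measurableSet_Iio)]
    _ = ∫⁻ s in Ioi (0 : ℝ), ∫⁻ x, (Iio (f x)).indicator (fun _ => (1 : ℝ≥0∞)) s * g x := by
        refine lintegral_lintegral_swap (Measurable.aemeasurable ?_)
        exact hm.mul (hg.comp measurable_fst)
    _ = _ := by
        refine lintegral_congr fun s => ?_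
        rw [← lintegral_indicator (measurableSet_lt measurable_const hf)]
        refine lintegral_congr fun x => ?_
        by_cases h : s < f x
        · rw [indicator_of_mem (by exact h), indicator_of_mem (by exact h), one_mul]
        · rw [indicator_of_notMem (by exact h), indicator_of_notMem (by exact h), zero_mul]

/-- The interaction `∫_A ∫_B W(y - x) dy dx`. -/
noncomputable def interaction (W : ℝ → ℝ) (A B : Set ℝ) : ℝ≥0∞ :=
  ∫⁻ x in A, ∫⁻ y in B, ENNReal.ofReal (W (y - x))

theorem interaction_eq_layer {W : ℝ → ℝ} (hW : Measurable W) {A B : Set ℝ} (hB : MeasurableSet B) :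
    interaction W A B = ∫⁻ τ in Ioi (0 : ℝ), ∫⁻ x in A, volume (B ∩ {y | τ < W (y - x)}) := by
  have hm : MeasurableSet {p : (ℝ × ℝ) × ℝ | p.2 ∈ B ∧ p.1.2 < W (p.2 - p.1.1)} :=
    (measurable_snd hB).inter (measurableSet_lt (f := fun p : (ℝ × ℝ) × ℝ => p.1.2)
      (g := fun p => W (p.2 - p.1.1)) (by fun_prop) (by fun_prop))
  have hm2 : Measurable fun p : ℝ × ℝ => volume (B ∩ {y | p.2 < W (y - p.1)}) :=
    measurable_measure_prodMk_left hm
  unfold interaction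
  rw [← lintegral_lintegral_swap (f := fun x τ => volume (B ∩ {y | τ < W (y - x)})) hm2.aemeasurable]
  refine lintegral_congr fun x => ?_
  have h1 := lintegral_ofReal_mul_eq_layer (f := fun y => W (y - x)) (by fun_prop)
    (g := B.indicator fun _ => 1) (measurable_const.indicator hB)
  rw [← lintegral_indicator hB]
  calc ∫⁻ y, B.indicator (fun y => ENNReal.ofReal (W (y - x))) y
      = ∫⁻ y, ENNReal.ofReal (W (y - x)) * B.indicator (fun _ => 1) y := by
        refine lintegral_congr fun y => ?_
        by_cases hy : y ∈ B
        · rw [indicator_of_mem hy, indicator_of_mem hy, mul_one]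
        · rw [indicator_of_notMem hy, indicator_of_notMem hy, mul_zero]
    _ = _ := by
        rw [h1]
        refine lintegral_congr fun τ => ?_
        rw [lintegral_indicator hB, Measure.restrict_restrict hB, setLIntegral_const, one_mul]

/-- Slicing W by height replaces it by indicators of centred intervals, to which `riesz_sets`
applies. -/
theorem interaction_le {W : ℝ → ℝ} (hW : IsWhithamKernel W) {A B : Set ℝ} (hA : MeasurableSet A)
    (hB : MeasurableSet B) {a b : ℝ} (ha0 : 0 ≤ a) (hb0 : 0 ≤ b)
    (ha : volume A = ENNReal.ofReal (2 * a)) (hb : volume B = ENNReal.ofReal (2 * b)) :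
    interaction W A B ≤ interaction W (Ioo (-a) a) (Ioo (-b) b) := by
  rw [interaction_eq_layer hW.measurable hB, interaction_eq_layer hW.measurable measurableSet_Ioo]
  refine setLIntegral_mono' measurableSet_Ioi fun τ hτ => ?_
  obtain ⟨ρ, hρ0, hρ⟩ := hW.exists_level hτ
  have key : ∀ (S : Set ℝ) (x : ℝ), volume (S ∩ {y | τ < W (y - x)}) =
      volume (S ∩ Ioo (x - ρ) (x + ρ)) := by
    intro S x
    refine measure_congr ((ae_eq_refl S).inter ?_)
    have h : ∀ c : ℝ, ∀ᵐ y : ℝ, y ≠ c := fun c => by simp [ae_iff, measure_singleton]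
    filter_upwards [h x, h (x + ρ), h (x - ρ)] with y h1 h2 h3
    refine propext ?_
    change τ < W (y - x) ↔ y ∈ Ioo (x - ρ) (x + ρ)
    rw [hρ (y - x) (sub_ne_zero.2 h1), abs_lt, mem_Ioo]
    · constructor <;> rintro ⟨e1, e2⟩ <;> constructor <;> linarith
    · intro h4
      rcases abs_choice (y - x) with h5 | h5 <;> rw [h5] at h4
      · exact h2 (by linarith)
      · exact h3 (by linarith)
  simp_rw [key]
  exact riesz_sets hA hB ha0 hb0 hρ0 ha hb

/-- The interaction energy `∬ f(x) W(y - x) f(y) dx dy` of a nonnegative function. -/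
noncomputable def energy (W f : ℝ → ℝ) : ℝ≥0∞ :=
  ∫⁻ x, ENNReal.ofReal (f x) * ∫⁻ y, ENNReal.ofReal (f y) * ENNReal.ofReal (W (y - x))

theorem energy_eq_layer {W f : ℝ → ℝ} (hW : Measurable W) (hf : Measurable f) :
    energy W f = ∫⁻ s in Ioi (0 : ℝ), ∫⁻ t in Ioi (0 : ℝ), interaction W {x | s < f x} {x | t < f x} := by
  have hm1 : Measurable fun x => ∫⁻ y, ENNReal.ofReal (f y) * ENNReal.ofReal (W (y - x)) := by
    refine Measurable.lintegral_prod_right' (f := fun p : ℝ × ℝ =>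
      ENNReal.ofReal (f p.2) * ENNReal.ofReal (W (p.2 - p.1))) ?_
    fun_prop
  unfold energy
  rw [lintegral_ofReal_mul_eq_layer hf hm1]
  refine lintegral_congr fun s => ?_
  unfold interaction
  rw [← lintegral_lintegral_swap (f := fun x t => ∫⁻ y in {x | t < f x}, ENNReal.ofReal (W (y - x)))]
  · refine lintegral_congr fun x => ?_
    exact lintegral_ofReal_mul_eq_layer hf (by fun_prop)
  · have : (Function.uncurry fun x t => ∫⁻ y in {x | t < f x}, ENNReal.ofReal (W (y - x))) =
        fun p : ℝ × ℝ => ∫⁻ y, {q : (ℝ × ℝ) × ℝ | q.1.2 < f q.2}.indicator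
          (fun q => ENNReal.ofReal (W (q.2 - q.1.1))) (p, y) := by
      ext p
      simp only [Function.uncurry]
      rw [← lintegral_indicator (measurableSet_lt measurable_const hf)]
      rfl
    rw [this]
    refine (Measurable.lintegral_prod_right' ?_).aemeasurable
    exact Measurable.indicator (by fun_prop) (measurableSet_lt (by fun_prop) (by fun_prop))

/-! ### Symmetric decreasing rearrangement of functions. -/

/-- The symmetric decreasing rearrangement. -/
noncomputable def rearr (f : ℝ → ℝ) (x : ℝ) : ℝ :=
  sSup {t | 0 < t ∧ ENNReal.ofReal (2 * |x|) < volume {y | t < f y}}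

theorem rearr_nonneg (f : ℝ → ℝ) (x : ℝ) : 0 ≤ rearr f x := Real.sSup_nonneg fun _ h => h.1.le

theorem rearr_neg (f : ℝ → ℝ) (x : ℝ) : rearr f (-x) = rearr f x := by simp [rearr]

section Rearrangement

variable {f : ℝ → ℝ} {C : ℝ}

/-- The hypothesis `hC` is Chebyshev's inequality for a square-integrable function; a level above 1
+ C/|x| would contradict it. -/
theorem bddAbove_rearr_set (hC : ∀ t, 0 < t → volume {y | t < f y} ≤ ENNReal.ofReal (C / t ^ 2))
    {x : ℝ} (hx : x ≠ 0) :
    BddAbove {t | 0 < t ∧ ENNReal.ofReal (2 * |x|) < volume {y | t < f y}} := by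
  have hx0 : 0 < |x| := abs_pos.2 hx
  refine ⟨1 + C / |x|, ?_⟩
  rintro t ⟨ht0, ht⟩
  have h1 := (ENNReal.ofReal_lt_ofReal_iff_of_nonneg (by positivity)).1 (ht.trans_le (hC t ht0))
  rw [lt_div_iff₀ (by positivity)] at h1
  by_contra hcon
  push Not at hcon
  have hC0 : 0 < C := lt_trans (by positivity) h1
  have h2 : 1 < t := by
    have : 0 < C / |x| := by positivity
    linarith
  have h3 : C / |x| < t := by linarith
  rw [div_lt_iff₀ hx0] at h3
  nlinarith

/-- The origin is excluded because the set of levels may be unbounded there, and `sSup` would then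
return its default value 0. -/
theorem lt_rearr_iff (hC : ∀ t, 0 < t → volume {y | t < f y} ≤ ENNReal.ofReal (C / t ^ 2))
    {x s : ℝ} (hx : x ≠ 0) (hs : 0 < s) :
    s < rearr f x ↔ ENNReal.ofReal (2 * |x|) < volume {y | s < f y} := by
  constructor
  · intro h
    have hne : {t | 0 < t ∧ ENNReal.ofReal (2 * |x|) < volume {y | t < f y}}.Nonempty := by
      by_contra hcon
      rw [not_nonempty_iff_eq_empty] at hcon
      rw [rearr, hcon, Real.sSup_empty] at h
      linarith
    obtain ⟨t, ht, hlt⟩ := exists_lt_of_lt_csSup hne h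
    exact ht.2.trans_le (measure_mono fun y hy => hlt.trans hy)
  · intro h
    -- The volume of superlevel sets is continuous from the right in the level, so a strict
    -- inequality at s persists slightly above s.
    have hU : {y | s < f y} = ⋃ n : ℕ, {y | s + 1 / ((n : ℝ) + 1) < f y} := by
      ext y
      simp only [mem_ofPred_eq, mem_iUnion]
      constructor
      · intro hy
        obtain ⟨n, hn⟩ := exists_nat_one_div_lt (sub_pos.2 hy)
        exact ⟨n, by linarith⟩
      · rintro ⟨n, hn⟩
        have : 0 < 1 / ((n : ℝ) + 1) := by positivity
        linarith
    have hmono : Monotone fun n : ℕ => {y | s + 1 / ((n : ℝ) + 1) < f y} := by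
      intro n m hnm y hy
      have : 1 / ((m : ℝ) + 1) ≤ 1 / ((n : ℝ) + 1) := by
        have : (n : ℝ) ≤ m := by exact_mod_cast hnm
        gcongr
      have hy' : s + 1 / ((n : ℝ) + 1) < f y := hy
      exact lt_of_le_of_lt (show s + 1 / ((m : ℝ) + 1) ≤ s + 1 / ((n : ℝ) + 1) by linarith) hy'
    rw [hU, hmono.measure_iUnion, lt_iSup_iff] at h
    obtain ⟨n, hn⟩ := h
    have hpos : 0 < 1 / ((n : ℝ) + 1) := by positivity
    exact lt_of_lt_of_le (by linarith) (le_csSup (bddAbove_rearr_set hC hx) ⟨by linarith, hn⟩)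

theorem rearr_antitoneOn (hC : ∀ t, 0 < t → volume {y | t < f y} ≤ ENNReal.ofReal (C / t ^ 2)) :
    AntitoneOn (rearr f) (Ioi 0) := by
  intro x hx y hy hxy
  have hx0 : 0 < x := hx
  have hy0 : 0 < y := hy
  refine le_of_forall_lt fun s hs => ?_
  rcases le_or_gt s 0 with h0 | h0
  · by_contra hcon
    push Not at hcon
    have h1 : rearr f x = 0 := le_antisymm (hcon.trans h0) (rearr_nonneg f x)
    have h2 : 0 < rearr f y := lt_of_le_of_ne (rearr_nonneg f y) fun h => by
      rw [h1] at hcon; rw [← h] at hs; linarith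
    obtain ⟨u, hu0, hu⟩ := exists_between h2
    have h3 := (lt_rearr_iff hC hy0.ne' hu0).1 hu
    have h4 : u < rearr f x := (lt_rearr_iff hC hx0.ne' hu0).2
      (lt_of_le_of_lt (ENNReal.ofReal_le_ofReal (by rw [abs_of_pos hx0, abs_of_pos hy0]; linarith)) h3)
    linarith
  · rw [lt_rearr_iff hC hy0.ne' h0] at hs
    rw [lt_rearr_iff hC hx0.ne' h0]
    exact lt_of_le_of_lt (ENNReal.ofReal_le_ofReal (by rw [abs_of_pos hx0, abs_of_pos hy0]; linarith)) hs

theorem measurable_rearr (hC : ∀ t, 0 < t → volume {y | t < f y} ≤ ENNReal.ofReal (C / t ^ 2)) :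
    Measurable (rearr f) :=
  measurable_of_even_antitoneOn (rearr_neg f) (rearr_antitoneOn hC)

theorem rearr_level_ae (hC : ∀ t, 0 < t → volume {y | t < f y} ≤ ENNReal.ofReal (C / t ^ 2))
    {s : ℝ} (hs : 0 < s) : {x | s < rearr f x} =ᵐ[volume]
      Ioo (-((volume {y | s < f y}).toReal / 2)) ((volume {y | s < f y}).toReal / 2) := by
  have hfin : volume {y | s < f y} ≠ ∞ := ne_top_of_le_ne_top ENNReal.ofReal_ne_top (hC s hs)
  have h : ∀ᵐ y : ℝ, y ≠ 0 := by simp [ae_iff, measure_singleton]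
  filter_upwards [h] with x hx
  refine propext ?_
  change s < rearr f x ↔ x ∈ Ioo _ _
  rw [lt_rearr_iff hC hx hs, mem_Ioo, ← abs_lt, ENNReal.ofReal_lt_iff_lt_toReal (by positivity) hfin]
  constructor <;> intro <;> linarith

theorem volume_rearr_level (hC : ∀ t, 0 < t → volume {y | t < f y} ≤ ENNReal.ofReal (C / t ^ 2))
    {s : ℝ} (hs : 0 < s) : volume {x | s < rearr f x} = volume {y | s < f y} := by
  have hfin : volume {y | s < f y} ≠ ∞ := ne_top_of_le_ne_top ENNReal.ofReal_ne_top (hC s hs)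
  rw [measure_congr (rearr_level_ae hC hs), Real.volume_Ioo, sub_neg_eq_add, add_halves,
    ENNReal.ofReal_toReal hfin]

/-- The Riesz rearrangement inequality for the interaction energy. -/
theorem energy_le_rearr {W : ℝ → ℝ} (hW : IsWhithamKernel W) (hf : Measurable f)
    (hC : ∀ t, 0 < t → volume {y | t < f y} ≤ ENNReal.ofReal (C / t ^ 2)) :
    energy W f ≤ energy W (rearr f) := by
  rw [energy_eq_layer hW.measurable hf, energy_eq_layer hW.measurable (measurable_rearr hC)]
  refine setLIntegral_mono' measurableSet_Ioi fun s hs => ?_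
  refine setLIntegral_mono' measurableSet_Ioi fun t ht => ?_
  have hvol : ∀ u : ℝ, 0 < u → volume {y | u < f y} =
      ENNReal.ofReal (2 * ((volume {y | u < f y}).toReal / 2)) := fun u hu => by
    rw [mul_div_cancel₀ _ two_ne_zero, ENNReal.ofReal_toReal
      (ne_top_of_le_ne_top ENNReal.ofReal_ne_top (hC u hu))]
  refine (interaction_le hW (measurableSet_lt measurable_const hf) (measurableSet_lt measurable_const hf)
    (by positivity) (by positivity) (hvol s hs) (hvol t ht)).trans (le_of_eq ?_)
  unfold interaction
  rw [Measure.restrict_congr_set (rearr_level_ae hC hs), Measure.restrict_congr_set (rearr_level_ae hC ht)]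

/-- By the layer-cake formula the integral depends only on the volumes of superlevel sets, which
rearrangement preserves. -/
theorem lintegral_comp_rearr (hf0 : ∀ x, 0 ≤ f x) (hf : Measurable f)
    (hC : ∀ t, 0 < t → volume {y | t < f y} ≤ ENNReal.ofReal (C / t ^ 2)) {g G : ℝ → ℝ}
    (hg : Continuous g) (hg0 : ∀ t, 0 ≤ t → 0 ≤ g t)
    (hG : ∀ y, 0 ≤ y → ∫ t in (0 : ℝ)..y, g t = G y) :
    ∫⁻ x, ENNReal.ofReal (G (rearr f x)) = ∫⁻ x, ENNReal.ofReal (G (f x)) := by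
  have hgn : ∀ᵐ t ∂volume.restrict (Ioi 0), 0 ≤ g t :=
    (ae_restrict_iff' measurableSet_Ioi).2 (Eventually.of_forall fun t ht => hg0 t (le_of_lt ht))
  have h1 := lintegral_comp_eq_lintegral_meas_lt_mul volume (Eventually.of_forall hf0) hf.aemeasurable
    (g := g) (fun t _ => hg.intervalIntegrable _ _) hgn
  have h2 := lintegral_comp_eq_lintegral_meas_lt_mul volume (Eventually.of_forall (rearr_nonneg f))
    (measurable_rearr hC).aemeasurable (g := g) (fun t _ => hg.intervalIntegrable _ _) hgn
  simp_rw [hG _ (hf0 _)] at h1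
  simp_rw [hG _ (rearr_nonneg f _)] at h2
  rw [h1, h2]
  refine setLIntegral_congr_fun measurableSet_Ioi fun t ht => ?_
  rw [volume_rearr_level hC ht]

end Rearrangement

/-! ### Growth and smoothness of the Young function. -/

section Young

variable {α : ℝ}

theorem Psi_abs (α y : ℝ) : Psi α |y| = Psi α y := by simp [Psi]

theorem Psi_neg (α y : ℝ) : Psi α (-y) = Psi α y := by simp [Psi]

theorem Psi_of_lt {y : ℝ} (h0 : 0 ≤ y) (h : y < α) : Psi α y = α * y ^ 2 - 1 / 3 * y ^ 3 := by
  rw [Psi, abs_of_nonneg h0, if_pos h]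

theorem Psi_of_ge (hα : 0 < α) {y : ℝ} (h : α ≤ y) :
    Psi α y = 2 / 3 * α ^ 3 + α ^ 2 * (y - α) + (y - α) ^ 3 := by
  rw [Psi, abs_of_nonneg (hα.le.trans h), if_neg (not_lt.2 h)]

theorem Psi_of_le (hα : 0 < α) {y : ℝ} (h0 : 0 ≤ y) (h : y ≤ α) :
    Psi α y = α * y ^ 2 - 1 / 3 * y ^ 3 := by
  rcases h.lt_or_eq with h | h
  · exact Psi_of_lt h0 h
  · rw [Psi_of_ge hα h.ge, h]; ring

theorem Psi_zero (hα : 0 < α) : Psi α 0 = 0 := by rw [Psi_of_lt le_rfl hα]; ring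

theorem Psi_nonneg (hα : 0 < α) (y : ℝ) : 0 ≤ Psi α y :=
  le_trans (by positivity) (sq_le_Psi hα y)

theorem continuous_Psi (α : ℝ) : Continuous (Psi α) := by
  unfold Psi
  refine Continuous.if_le (f' := fun y => 2 / 3 * α ^ 3 + α ^ 2 * (|y| - α) + (|y| - α) ^ 3)
    (g' := fun y => α * |y| ^ 2 - 1 / 3 * |y| ^ 3) (f := fun _ => α) (g := fun y => |y|)
    (by fun_prop) (by fun_prop) (by fun_prop) (by fun_prop) ?_ |>.congr fun y => ?_
  · intro y hy
    rw [← hy]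
    ring
  · by_cases h : |y| < α
    · rw [if_neg (not_le.2 h), if_pos h]
    · rw [if_pos (not_lt.1 h), if_neg h]

/-- The derivative of `Psi` on the nonnegative half-axis. -/
noncomputable def dPsi (α y : ℝ) : ℝ :=
  if y < α then 2 * α * y - y ^ 2 else α ^ 2 + 3 * (y - α) ^ 2

theorem continuous_dPsi (α : ℝ) : Continuous (dPsi α) := by
  unfold dPsi
  refine Continuous.if_le (f' := fun y => α ^ 2 + 3 * (y - α) ^ 2)
    (g' := fun y => 2 * α * y - y ^ 2) (f := fun _ => α) (g := fun y => y)
    (by fun_prop) (by fun_prop) (by fun_prop) (by fun_prop) ?_ |>.congr fun y => ?_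
  · intro y hy
    rw [← hy]
    ring
  · by_cases h : y < α
    · rw [if_neg (not_le.2 h), if_pos h]
    · rw [if_pos (not_lt.1 h), if_neg h]

theorem hasDerivAt_Psi {y : ℝ} (hα : 0 < α) (hy : 0 < y) : HasDerivAt (Psi α) (dPsi α y) y := by
  have hlow : HasDerivAt (fun y => α * y ^ 2 - 1 / 3 * y ^ 3) (2 * α * y - y ^ 2) y := by
    refine (((hasDerivAt_pow 2 y).const_mul α).sub ((hasDerivAt_pow 3 y).const_mul (1 / 3))).congr_deriv ?_
    norm_num; ring
  have hhigh : HasDerivAt (fun y => 2 / 3 * α ^ 3 + α ^ 2 * (y - α) + (y - α) ^ 3)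
      (α ^ 2 + 3 * (y - α) ^ 2) y := by
    have h1 : HasDerivAt (fun y : ℝ => y - α) 1 y := (hasDerivAt_id y).sub_const α
    refine (((h1.const_mul (α ^ 2)).const_add (2 / 3 * α ^ 3)).add (h1.pow 3)).congr_deriv ?_
    norm_num
  rcases lt_trichotomy y α with h | h | h
  · rw [dPsi, if_pos h]
    refine hlow.congr_of_eventuallyEq ?_
    filter_upwards [Ioo_mem_nhds hy h] with x hx using Psi_of_lt hx.1.le hx.2
  · have e1 : 2 * α * y - y ^ 2 = dPsi α y := by rw [dPsi, if_neg (not_lt.2 h.ge), h]; ring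
    have e2 : α ^ 2 + 3 * (y - α) ^ 2 = dPsi α y := by rw [dPsi, if_neg (not_lt.2 h.ge)]
    rw [e1] at hlow
    rw [e2] at hhigh
    rw [← hasDerivWithinAt_univ, ← Iic_union_Ici (a := y)]
    refine HasDerivWithinAt.union ?_ ?_
    · refine hlow.hasDerivWithinAt.congr_of_eventuallyEq ?_ (Psi_of_le hα hy.le h.le)
      filter_upwards [mem_nhdsWithin_of_mem_nhds (Ioi_mem_nhds hy), self_mem_nhdsWithin] with x hx hx2
      exact Psi_of_le hα (le_of_lt hx) (h ▸ hx2)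
    · exact hhigh.hasDerivWithinAt.congr (fun x hx => Psi_of_ge hα (h ▸ hx)) (Psi_of_ge hα h.ge)
  · rw [dPsi, if_neg (not_lt.2 h.le)]
    refine hhigh.congr_of_eventuallyEq ?_
    filter_upwards [Ioi_mem_nhds h] with x hx using Psi_of_ge hα (le_of_lt hx)

theorem integral_dPsi (hα : 0 < α) {y : ℝ} (hy : 0 ≤ y) : ∫ t in (0 : ℝ)..y, dPsi α t = Psi α y := by
  have := intervalIntegral.integral_eq_sub_of_hasDeriv_right_of_le hy (continuous_Psi α).continuousOn
    (f' := dPsi α) (fun t ht => (hasDerivAt_Psi hα ht.1).hasDerivWithinAt)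
    ((continuous_dPsi α).intervalIntegrable _ _)
  rw [this, Psi_zero hα, sub_zero]

theorem mul_deriv_Psi (hα : 0 < α) {y : ℝ} (hy : 0 ≤ y) : y * deriv (Psi α) y = y * dPsi α y := by
  rcases hy.eq_or_lt with h | h
  · rw [← h, zero_mul, zero_mul]
  · rw [(hasDerivAt_Psi hα h).deriv]

theorem dPsi_strictMonoOn (α : ℝ) : StrictMonoOn (dPsi α) (Ici 0) := by
  intro x hx y hy hxy
  have hx0 : 0 ≤ x := hx
  unfold dPsi
  split_ifs with h1 h2 h2
  · nlinarith
  · nlinarith [sq_nonneg (y - α), mul_pos (sub_pos.2 h1) (sub_pos.2 h1)]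
  · linarith
  · have : (x - α) ^ 2 < (y - α) ^ 2 := pow_lt_pow_left₀ (by linarith) (by linarith) two_ne_zero
    linarith

theorem dPsi_zero (hα : 0 < α) : dPsi α 0 = 0 := by rw [dPsi, if_pos hα]; ring

theorem dPsi_nonneg (hα : 0 < α) {y : ℝ} (hy : 0 ≤ y) : 0 ≤ dPsi α y := by
  rw [← dPsi_zero hα]
  exact (dPsi_strictMonoOn α).monotoneOn (mem_Ici.2 le_rfl) hy hy

/-- The left side is α² - (y - α)², and the upper branch only adds to α². -/
theorem le_dPsi (y : ℝ) : 2 * α * y - y ^ 2 ≤ dPsi α y := by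
  unfold dPsi
  split_ifs with h
  · exact le_rfl
  · nlinarith [sq_nonneg (y - α)]

theorem linear_le_dPsi {y : ℝ} (hy : 0 ≤ y) : 9 / 10 * α * y ≤ dPsi α y := by
  unfold dPsi
  split_ifs with h
  · nlinarith [mul_nonneg hy (sub_pos.2 h).le]
  -- The quadratic 3y² - 6.9αy + 4α² has its minimum at y = 23α/20, where it is still nonnegative.
  · nlinarith [sq_nonneg (y - 23 / 20 * α)]

theorem dPsi_le (hα : 0 < α) {y M : ℝ} (hy : 0 ≤ y) (hM : y ≤ M) : dPsi α y ≤ (2 * α + 3 * M) * y := by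
  unfold dPsi
  split_ifs with h
  · nlinarith
  · have h' := not_lt.1 h
    nlinarith [mul_nonneg hy (sub_nonneg.2 hM), mul_nonneg hα.le (sub_nonneg.2 h')]

/-- The inverse of `dPsi` on the nonnegative half-axis. -/
noncomputable def dPsiInv (α z : ℝ) : ℝ :=
  α - Real.sqrt (α ^ 2 - z) + Real.sqrt ((z - α ^ 2) / 3)

theorem continuous_dPsiInv (α : ℝ) : Continuous (dPsiInv α) := by
  unfold dPsiInv
  fun_prop

theorem dPsiInv_dPsi (α y : ℝ) : dPsiInv α (dPsi α y) = y := by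
  unfold dPsi dPsiInv
  split_ifs with h
  -- Only one of the two roots is active on each branch, since `Real.sqrt` vanishes on negative
  -- numbers.
  · rw [show α ^ 2 - (2 * α * y - y ^ 2) = (α - y) ^ 2 by ring, Real.sqrt_sq (by linarith),
      Real.sqrt_eq_zero_of_nonpos (by nlinarith [sq_nonneg (α - y)])]
    ring
  · rw [Real.sqrt_eq_zero_of_nonpos (by nlinarith [sq_nonneg (y - α)]),
      show (α ^ 2 + 3 * (y - α) ^ 2 - α ^ 2) / 3 = (y - α) ^ 2 by ring, Real.sqrt_sq (by linarith)]
    ring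

theorem Psi_ge_cubic (hα : 0 < α) {y : ℝ} (hy : 0 ≤ y) : α * y ^ 2 - 1 / 3 * y ^ 3 ≤ Psi α y := by
  rcases lt_or_ge y α with h | h
  · rw [Psi_of_lt hy h]
  · rw [Psi_of_ge hα h]
    nlinarith [pow_nonneg (sub_nonneg.2 h) 3]

/-- Although Ψ grows cubically, the exponent 3 would fail for y > 2α because of the shift in (y -
α)³; 4 suffices for the doubling condition. -/
theorem dPsi_mul_le (hα : 0 < α) {y : ℝ} (hy : 0 ≤ y) : y * dPsi α y ≤ 4 * Psi α y := by
  rcases lt_or_ge y α with h | h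
  · rw [Psi_of_lt hy h, dPsi, if_pos h]
    nlinarith [mul_nonneg (sq_nonneg y) (sub_pos.2 h).le, pow_nonneg hy 3]
  · rw [Psi_of_ge hα h, dPsi, if_neg (not_lt.2 h)]
    obtain ⟨u, rfl⟩ : ∃ u, y = α + u := ⟨y - α, by ring⟩
    have hu : 0 ≤ u := by linarith
    have h0 : 0 ≤ α ^ 2 * u := by positivity
    have h2 : 0 ≤ u * (u - 3 / 2 * α) ^ 2 := by positivity
    have h3 : 0 ≤ α ^ 3 := by positivity
    nlinarith

theorem Psi_mono (hα : 0 < α) {x y : ℝ} (hx : 0 ≤ x) (hxy : x ≤ y) : Psi α x ≤ Psi α y := by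
  have hmono : MonotoneOn (Psi α) (Ici 0) := by
    refine monotoneOn_of_deriv_nonneg (convex_Ici 0) (continuous_Psi α).continuousOn ?_ ?_
    · intro t ht
      rw [interior_Ici] at ht
      exact (hasDerivAt_Psi hα ht).differentiableAt.differentiableWithinAt
    · intro t ht
      rw [interior_Ici] at ht
      rw [(hasDerivAt_Psi hα ht).deriv]
      exact dPsi_nonneg hα (le_of_lt ht)
  exact hmono hx (hx.trans hxy) hxy

theorem Psi_lt_mul_dPsi (hα : 0 < α) {y : ℝ} (hy : 0 < y) : Psi α y < y * dPsi α y := by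
  rcases lt_or_ge y α with h | h
  · rw [Psi_of_lt hy.le h, dPsi, if_pos h]
    nlinarith [mul_pos (sq_pos_of_pos hy) (sub_pos.2 h), mul_pos (sq_pos_of_pos hy) hα]
  · rw [Psi_of_ge hα h, dPsi, if_neg (not_lt.2 h)]
    obtain ⟨u, rfl⟩ : ∃ u, y = α + u := ⟨y - α, by ring⟩
    have hu : 0 ≤ u := by linarith
    have h1 : 0 ≤ α * u ^ 2 := by positivity
    have h2 : 0 ≤ u ^ 3 := by positivity
    have h3 : 0 < α ^ 3 := by positivity
    nlinarith

/-- If `y φ'(y) ≤ n φ(y)` then `φ(sy) ≤ sⁿ φ(y)` for `s ≥ 1`, applied to `Psi`. -/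
theorem Psi_mul_le (hα : 0 < α) {s : ℝ} (hs : 1 ≤ s) (y : ℝ) : Psi α (s * y) ≤ s ^ 4 * Psi α y := by
  wlog hy : 0 ≤ y generalizing y
  · have := this (-y) (by linarith)
    rwa [mul_neg, Psi_neg, Psi_neg] at this
  rcases hy.eq_or_lt with h | h
  · rw [← h, mul_zero, Psi_zero hα, mul_zero]
  have hanti : AntitoneOn (fun t => Psi α (t * y) / t ^ 4) (Ici 1) := by
    have hd : ∀ t : ℝ, 1 ≤ t → HasDerivAt (fun t => Psi α (t * y) / t ^ 4)
        ((dPsi α (t * y) * y * t ^ 4 - Psi α (t * y) * (4 * t ^ 3)) / (t ^ 4) ^ 2) t := by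
      intro t ht
      have h1 : HasDerivAt (fun t : ℝ => t * y) y t := by simpa using (hasDerivAt_id t).mul_const y
      have h2 := (hasDerivAt_Psi hα (show 0 < t * y by positivity)).comp t h1
      have h3 : HasDerivAt (fun t : ℝ => t ^ 4) (4 * t ^ 3) t := by simpa using hasDerivAt_pow 4 t
      exact h2.div h3 (by positivity)
    refine antitoneOn_of_deriv_nonpos (convex_Ici 1)
      (fun t ht => (hd t ht).continuousAt.continuousWithinAt) ?_ ?_
    · intro t ht
      rw [interior_Ici] at ht
      exact (hd t (le_of_lt ht)).differentiableAt.differentiableWithinAt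
    · intro t ht
      rw [interior_Ici] at ht
      have ht1 : 1 ≤ t := le_of_lt ht
      rw [(hd t ht1).deriv]
      refine div_nonpos_of_nonpos_of_nonneg ?_ (by positivity)
      have := dPsi_mul_le hα (show 0 ≤ t * y by positivity)
      have h3 : 0 ≤ t ^ 3 := by positivity
      nlinarith
  have := hanti (mem_Ici.2 le_rfl) (mem_Ici.2 hs) hs
  simp only [one_mul, one_pow, div_one] at this
  rw [div_le_iff₀ (by positivity)] at this
  linarith

/-- The companion of `Psi_mul_le`: Ψ(ty)/t increases in t because Ψ(y) < yΨ'(y). -/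
theorem mul_Psi_le (hα : 0 < α) {s : ℝ} (hs : 1 ≤ s) (y : ℝ) : s * Psi α y ≤ Psi α (s * y) := by
  wlog hy : 0 ≤ y generalizing y
  · have := this (-y) (by linarith)
    rwa [mul_neg, Psi_neg, Psi_neg] at this
  rcases hy.eq_or_lt with h | h
  · rw [← h, mul_zero, Psi_zero hα, mul_zero]
  have hmono : MonotoneOn (fun t => Psi α (t * y) / t) (Ici 1) := by
    have hd : ∀ t : ℝ, 1 ≤ t → HasDerivAt (fun t => Psi α (t * y) / t)
        ((dPsi α (t * y) * y * t - Psi α (t * y) * 1) / t ^ 2) t := by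
      intro t ht
      have h1 : HasDerivAt (fun t : ℝ => t * y) y t := by simpa using (hasDerivAt_id t).mul_const y
      have h2 := (hasDerivAt_Psi hα (show 0 < t * y by positivity)).comp t h1
      exact h2.div (hasDerivAt_id t) (show t ≠ 0 by positivity)
    refine monotoneOn_of_deriv_nonneg (convex_Ici 1)
      (fun t ht => (hd t ht).continuousAt.continuousWithinAt) ?_ ?_
    · intro t ht
      rw [interior_Ici] at ht
      exact (hd t (le_of_lt ht)).differentiableAt.differentiableWithinAt
    · intro t ht
      rw [interior_Ici] at ht
      have ht1 : 1 ≤ t := le_of_lt ht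
      rw [(hd t ht1).deriv]
      refine div_nonneg ?_ (by positivity)
      have := Psi_lt_mul_dPsi hα (show 0 < t * y by positivity)
      nlinarith
  have := hmono (mem_Ici.2 le_rfl) (mem_Ici.2 hs) hs
  simp only [one_mul, div_one] at this
  rw [le_div_iff₀ (by positivity)] at this
  linarith

/-- The ratio Ψ(y)/y² is at least 2α/3 for y ≤ α and at most 2α/3 on [α, 2α], with equality at 2α;
hence the restriction s ≤ 2. The exponent 2 is what makes scaling favourable for `excess`. -/
theorem Psi_mul_le_sq (hα : 0 < α) {s y : ℝ} (hs1 : 1 ≤ s) (hs2 : s ≤ 2) (hy0 : 0 ≤ y) (hy : y ≤ α) :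
    Psi α (s * y) ≤ s ^ 2 * Psi α y := by
  rw [Psi_of_le hα hy0 hy]
  have hsy : 0 ≤ s * y := by positivity
  rcases lt_or_ge (s * y) α with h | h
  · rw [Psi_of_lt hsy h]
    have h1 : 0 ≤ s ^ 2 * y ^ 3 := by positivity
    nlinarith
  · rw [Psi_of_ge hα h]
    have h1 : s * y ≤ 2 * α := by nlinarith
    have h2 : 2 / 3 * α ^ 3 + α ^ 2 * (s * y - α) + (s * y - α) ^ 3 ≤ 2 / 3 * α * (s * y) ^ 2 := by
      obtain ⟨u, hu⟩ : ∃ u, s * y = α + u := ⟨s * y - α, by ring⟩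
      rw [hu] at h h1 ⊢
      have hu0 : 0 ≤ u := by linarith
      have hu1 : u ≤ α := by linarith
      nlinarith [mul_nonneg (mul_nonneg hu0 (sub_nonneg.2 hu1)) (show 0 ≤ α / 3 + u by linarith)]
    have h3 : 0 ≤ (s * y) ^ 2 * (α - y) := by
      have := sub_nonneg.2 hy
      positivity
    nlinarith

/-- Beyond α + 2K the cubic growth beats K y². This prices the cut-off in
`IsMaximizer.exists_ae_le`. -/
theorem Psi_sub_ge (hα : 0 < α) {K M y : ℝ} (hK : 0 < K) (hM : α + 2 * K ≤ M) (hy : M ≤ y) :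
    K * (y ^ 2 - M ^ 2) ≤ Psi α y - Psi α M := by
  rw [Psi_of_ge hα (by linarith), Psi_of_ge hα (by linarith)]
  obtain ⟨s, rfl⟩ : ∃ s, y = α + s := ⟨y - α, by ring⟩
  obtain ⟨r, rfl⟩ : ∃ r, M = α + r := ⟨M - α, by ring⟩
  have hr : 2 * K ≤ r := by linarith
  have hs : r ≤ s := by linarith
  have h1 : K * (s + r + 2 * α) ≤ α ^ 2 + (s ^ 2 + s * r + r ^ 2) := by
    nlinarith [sq_nonneg (α - K), mul_nonneg (sub_nonneg.2 hr) (show 0 ≤ r by linarith),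
      mul_nonneg (show 0 ≤ s - 2 * K by linarith) (show 0 ≤ s by linarith)]
  have h2 := mul_le_mul_of_nonneg_left h1 (sub_nonneg.2 hs)
  nlinarith

/-- A quadratic upper bound for the first-order Taylor remainder. -/
theorem Psi_taylor_le (hα : 0 < α) {M y h : ℝ} (hy0 : 0 ≤ y) (hyM : y ≤ M) (hhα : |h| ≤ α) :
    Psi α (y + h) ≤ Psi α y + dPsi α y * h + (3 * M + 5 * α) * h ^ 2 := by
  obtain ⟨hh1, hh2⟩ := abs_le.1 hhα
  have hM0 : 0 ≤ M := hy0.trans hyM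
  rcases lt_or_ge (y + h) 0 with hneg | hpos
  · have e : Psi α (y + h) = Psi α (-(y + h)) := (Psi_neg α _).symm
    have hlt : y < α := by linarith
    rw [e, Psi_of_le hα (by linarith) (by linarith), Psi_of_lt hy0 hlt, dPsi, if_pos hlt]
    have hyh : y ≤ -h := by linarith
    have h1 : 0 ≤ (-(y + h)) ^ 3 := by
      have : 0 ≤ -(y + h) := by linarith
      positivity
    have h2 : 0 ≤ y ^ 2 * (-h - y) := mul_nonneg (sq_nonneg y) (by linarith)
    have h3 : 0 ≤ y ^ 3 := by positivity
    have h4 : 0 ≤ M * h ^ 2 := by positivity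
    have h5 : 0 ≤ α * h ^ 2 := by positivity
    nlinarith
  · obtain ⟨w, rfl⟩ : ∃ w, h = w - y := ⟨y + h, by ring⟩
    rw [add_sub_cancel] at hpos ⊢
    have hwM : w ≤ M + α := by linarith
    have h4 : 0 ≤ M * (w - y) ^ 2 := by positivity
    have h5 : 0 ≤ α * (w - y) ^ 2 := by positivity
    rcases lt_or_ge y α with hya | hya <;> rcases lt_or_ge w α with hwa | hwa
    · rw [Psi_of_lt hpos hwa, Psi_of_lt hy0 hya, dPsi, if_pos hya]
      have h6 : 0 ≤ (w + 2 * y) * (w - y) ^ 2 := by positivity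
      nlinarith
    · rw [Psi_of_ge hα hwa, Psi_of_lt hy0 hya, dPsi, if_pos hya]
      obtain ⟨p, rfl⟩ : ∃ p, y = α - p := ⟨α - y, by ring⟩
      obtain ⟨q, rfl⟩ : ∃ q, w = α + q := ⟨w - α, by ring⟩
      have hp : 0 < p := by linarith
      have hq : 0 ≤ q := by linarith
      have hpa : p ≤ α := by linarith
      have hqa : q ≤ α := by linarith
      have h6 : 0 ≤ (α - p) * p * q := mul_nonneg (mul_nonneg (by linarith) hp.le) hq
      have h7 : 0 ≤ (α - q) * q * q := mul_nonneg (mul_nonneg (by linarith) hq) hq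
      have h8 : 0 ≤ (α - p) * p * p := mul_nonneg (mul_nonneg (by linarith) hp.le) hp.le
      have h9 : 0 ≤ α * (p * q) := by positivity
      have h10 : 0 ≤ α * p ^ 2 := by positivity
      have h11 : 0 ≤ α * q ^ 2 := by positivity
      have h12 : 0 ≤ p ^ 3 := by positivity
      nlinarith
    · rw [Psi_of_lt hpos hwa, Psi_of_ge hα hya, dPsi, if_neg (not_lt.2 hya)]
      obtain ⟨p, rfl⟩ : ∃ p, w = α - p := ⟨α - w, by ring⟩
      obtain ⟨q, rfl⟩ : ∃ q, y = α + q := ⟨y - α, by ring⟩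
      have hp : 0 < p := by linarith
      have hpa : p ≤ α := by linarith
      have hqa : q ≤ α := by linarith
      have hq : 0 ≤ q := by linarith
      have h6 : 0 ≤ (α - p) * p * p := mul_nonneg (mul_nonneg (by linarith) hp.le) hp.le
      have h7 : 0 ≤ (α - q) * q * q := mul_nonneg (mul_nonneg (by linarith) hq) hq
      have h8 : 0 ≤ (α - q) * q * p := mul_nonneg (mul_nonneg (by linarith) hq) hp.le
      have h9 : 0 ≤ α * (p * q) := by positivity
      have h10 : 0 ≤ α * p ^ 2 := by positivity
      have h11 : 0 ≤ α * q ^ 2 := by positivity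
      nlinarith
    · rw [Psi_of_ge hα hwa, Psi_of_ge hα hya, dPsi, if_neg (not_lt.2 hya)]
      have h6 : 0 ≤ (M + α - w) * (w - y) ^ 2 := mul_nonneg (by linarith) (sq_nonneg _)
      have h7 : 0 ≤ (M - y) * (w - y) ^ 2 := mul_nonneg (by linarith) (sq_nonneg _)
      nlinarith

end Young

/-! ### The height constant. -/

/-- The elementary facts about the constant `heightConst`. -/
theorem heightConst_spec : 3 * heightConst ^ 3 - 12 * heightConst + 8 = 0 ∧
    1.475 < heightConst ∧ heightConst < 1.485 := by
  have hs : Real.sqrt 3 ^ 2 = 3 := Real.sq_sqrt (by norm_num)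
  have hs0 : 0 < Real.sqrt 3 := Real.sqrt_pos.2 (by norm_num)
  set c := Real.cos (5 * Real.pi / 18) with hc
  -- The triple angle 5π/6 has cosine -√3/2. With y = αt, the equation yΨ'(y) = 2Ψ(y) on the upper
  -- branch is 3t³ - 12t + 8 = 0, solved here trigonometrically.
  have h3 : 4 * c ^ 3 - 3 * c = -(Real.sqrt 3 / 2) := by
    rw [hc, ← Real.cos_three_mul, ← Real.cos_pi_div_six, ← Real.cos_pi_sub]
    congr 1
    ring
  have ht : heightConst = 4 / Real.sqrt 3 * c := rfl
  have hcub : 3 * heightConst ^ 3 - 12 * heightConst + 8 = 0 := by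
    have h4 : Real.sqrt 3 * heightConst = 4 * c := by rw [ht]; field_simp
    have h5 : Real.sqrt 3 * (3 * heightConst ^ 3 - 12 * heightConst + 8) = 0 := by
      have h6 : Real.sqrt 3 * heightConst ^ 3 * 3 = (Real.sqrt 3 * heightConst) ^ 3 := by
        rw [mul_pow, pow_succ (Real.sqrt 3) 2, hs]; ring
      calc _ = Real.sqrt 3 * heightConst ^ 3 * 3 - 12 * (Real.sqrt 3 * heightConst) + 8 * Real.sqrt 3 := by ring
        _ = 0 := by rw [h6, h4]; linear_combination 16 * h3
    exact (mul_eq_zero.1 h5).resolve_left hs0.ne'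
  have hclow : 1 / 2 < c := by
    rw [hc, ← Real.cos_pi_div_three]
    refine Real.cos_lt_cos_of_nonneg_of_le_pi (by positivity) ?_ ?_ <;> linarith [Real.pi_pos]
  have hchigh : c ≤ 3 / 4 := by
    have h1 : c ≤ Real.cos (Real.pi / 4) := by
      rw [hc]
      refine Real.cos_le_cos_of_nonneg_of_le_pi (by positivity) ?_ ?_ <;> linarith [Real.pi_pos]
    rw [Real.cos_pi_div_four] at h1
    have h2 : Real.sqrt 2 < 3 / 2 := by
      rw [Real.sqrt_lt' (by norm_num)]; norm_num
    linarith
  have hs1 : Real.sqrt 3 < 1.7321 := by rw [Real.sqrt_lt' (by norm_num)]; norm_num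
  have hs2 : 1.732 < Real.sqrt 3 := by rw [Real.lt_sqrt (by norm_num)]; norm_num
  -- A rough lower bound singles out the largest root: the cofactor of t - 1.475 (or of t - 1.485)
  -- is then positive.
  have hlow : 1.15 < heightConst := by
    rw [ht, div_mul_eq_mul_div, lt_div_iff₀ hs0]; linarith
  have hhigh : heightConst < 1.8 := by
    rw [ht, div_mul_eq_mul_div, div_lt_iff₀ hs0]; linarith
  refine ⟨hcub, ?_, ?_⟩
  · by_contra h
    push Not at h
    set t := heightConst
    have : 3 * t ^ 3 - 12 * t + 8 - (3 * 1.475 ^ 3 - 12 * 1.475 + 8) =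
      3 * (t - 1.475) * (t ^ 2 + 1.475 * t + 1.475 ^ 2 - 4) := by ring
    nlinarith [mul_nonneg (sub_nonneg.2 h) (show 0 ≤ t ^ 2 + 1.475 * t + 1.475 ^ 2 - 4 by nlinarith)]
  · by_contra h
    push Not at h
    set t := heightConst
    have : 3 * t ^ 3 - 12 * t + 8 - (3 * 1.485 ^ 3 - 12 * 1.485 + 8) =
      3 * (t - 1.485) * (t ^ 2 + 1.485 * t + 1.485 ^ 2 - 4) := by ring
    nlinarith [mul_nonneg (sub_nonneg.2 h) (show 0 ≤ t ^ 2 + 1.485 * t + 1.485 ^ 2 - 4 by nlinarith)]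

/-! ### Gauge norm versus modular. -/

/-- The modular `∫ Ψ(f)`. -/
noncomputable def modular (α : ℝ) (f : ℝ → ℝ) : ℝ≥0∞ := ∫⁻ x, ENNReal.ofReal (Psi α (f x))

section Orlicz

variable {α : ℝ} {f g : ℝ → ℝ}

theorem J_congr (h : f =ᵐ[volume] g) : J f = J g := by
  have h' : (fun x => (f x : ℂ)) =ᵐ[volume] fun x => (g x : ℂ) := h.mono fun x hx => by simp [hx]
  unfold J
  by_cases hf : MemLp (fun x => (f x : ℂ)) 2 volume
  · have hg := (memLp_congr_ae h').1 hf
    rw [dif_pos hf, dif_pos hg, (MemLp.toLp_eq_toLp_iff hf hg).2 h']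
  · rw [dif_neg hf, dif_neg fun hg => hf ((memLp_congr_ae h').2 hg)]

/-- Homogeneity is read off from `diffForm_eq`, since the difference form and ∫ f² are both visibly
quadratic. -/
theorem J_smul (c : ℝ) (hf : MemLp f 2 volume) : J (fun x => c * f x) ^ 2 = c ^ 2 * J f ^ 2 := by
  have hcf : MemLp (fun x => c * f x) 2 volume := hf.const_mul c
  have h1 := diffForm_eq isWhithamKernel_kernel hf
  have h2 := diffForm_eq isWhithamKernel_kernel hcf
  have h3 : diffForm kernel (fun x => c * f x) = ENNReal.ofReal (c ^ 2) * diffForm kernel f := by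
    unfold diffForm
    rw [← lintegral_const_mul' _ _ ENNReal.ofReal_ne_top]
    refine lintegral_congr fun z => ?_
    rw [mul_left_comm]
    congr 1
    rw [← lintegral_const_mul' _ _ ENNReal.ofReal_ne_top]
    refine lintegral_congr fun x => ?_
    rw [← ENNReal.ofReal_mul (sq_nonneg c)]
    congr 1
    ring
  have e1 := J_sq_le hf
  have e2 := J_sq_le hcf
  have e3 : ∫ x, (c * f x) ^ 2 = c ^ 2 * ∫ x, f x ^ 2 := by
    rw [← integral_const_mul]
    exact integral_congr_ae (Eventually.of_forall fun x => by ring)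
  rw [h1, h2, ← ENNReal.ofReal_mul (sq_nonneg c),
    ENNReal.ofReal_eq_ofReal_iff (by linarith) (mul_nonneg (sq_nonneg c) (by linarith)), e3] at h3
  linarith

theorem modular_congr (h : f =ᵐ[volume] g) : modular α f = modular α g :=
  lintegral_congr_ae (h.mono fun x hx => by simp only [hx])

theorem aemeasurable_Psi (α : ℝ) (hf : AEStronglyMeasurable f volume) :
    AEMeasurable (fun x => ENNReal.ofReal (Psi α (f x))) volume :=
  (((continuous_Psi α).comp_aestronglyMeasurable hf).aemeasurable).ennreal_ofReal

theorem modular_mul_le (hα : 0 < α) {s : ℝ} (hs : 1 ≤ s) (f : ℝ → ℝ) :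
    modular α (fun x => s * f x) ≤ ENNReal.ofReal (s ^ 4) * modular α f := by
  unfold modular
  rw [← lintegral_const_mul' _ _ ENNReal.ofReal_ne_top]
  refine lintegral_mono fun x => ?_
  rw [← ENNReal.ofReal_mul (by positivity)]
  exact ENNReal.ofReal_le_ofReal (Psi_mul_le hα hs _)

theorem mul_modular_le (hα : 0 < α) {s : ℝ} (hs : 1 ≤ s) (f : ℝ → ℝ) :
    ENNReal.ofReal s * modular α f ≤ modular α (fun x => s * f x) := by
  unfold modular
  rw [← lintegral_const_mul' _ _ ENNReal.ofReal_ne_top]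
  refine lintegral_mono fun x => ?_
  rw [← ENNReal.ofReal_mul (by positivity)]
  exact ENNReal.ofReal_le_ofReal (mul_Psi_le hα hs _)

theorem ofReal_mul_lintegral_sq_le (hα : 0 < α) (f : ℝ → ℝ) :
    ENNReal.ofReal (α / 3) * ∫⁻ x, ENNReal.ofReal (f x ^ 2) ≤ modular α f := by
  unfold modular
  rw [← lintegral_const_mul' _ _ ENNReal.ofReal_ne_top]
  refine lintegral_mono fun x => ?_
  rw [← ENNReal.ofReal_mul (by positivity), ← sq_abs]
  exact ENNReal.ofReal_le_ofReal (sq_le_Psi hα _)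

theorem memLp_two_of_modular (hα : 0 < α) (hf : AEStronglyMeasurable f volume)
    (h : modular α f ≠ ∞) : MemLp f 2 volume := by
  rw [memLp_two_iff_integrable_sq hf]
  refine ⟨hf.pow 2, ?_⟩
  rw [hasFiniteIntegral_iff_ofReal (Eventually.of_forall fun x => sq_nonneg _)]
  by_contra hc
  rw [not_lt, top_le_iff] at hc
  have := ofReal_mul_lintegral_sq_le hα f
  rw [hc, ENNReal.mul_top (by simpa using hα), top_le_iff] at this
  exact h this

theorem integral_sq_le_of_modular (hα : 0 < α) (hf : AEStronglyMeasurable f volume)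
    {q : ℝ} (hq : 0 ≤ q) (h : modular α f ≤ ENNReal.ofReal q) : ∫ x, f x ^ 2 ≤ 3 * q / α := by
  have h2 := memLp_two_of_modular hα hf (ne_top_of_le_ne_top ENNReal.ofReal_ne_top h)
  have h3 := (ofReal_mul_lintegral_sq_le hα f).trans h
  rw [← ofReal_integral_eq_lintegral_ofReal h2.integrable_sq
    (Eventually.of_forall fun x => sq_nonneg _), ← ENNReal.ofReal_mul (by positivity),
    ENNReal.ofReal_le_ofReal_iff hq] at h3
  rw [le_div_iff₀ hα]
  linarith

theorem ae_eq_zero_of_modular (hα : 0 < α) (hf : AEStronglyMeasurable f volume)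
    (h : modular α f = 0) : f =ᵐ[volume] 0 := by
  rw [modular, lintegral_eq_zero_iff' (aemeasurable_Psi α hf)] at h
  filter_upwards [h] with x hx
  have h1 := ENNReal.ofReal_eq_zero.1 hx
  have h2 := sq_le_Psi hα (f x)
  have h3 : |f x| ^ 2 ≤ 0 := by
    by_contra hc
    nlinarith [mul_pos hα (not_le.1 hc)]
  simpa using le_antisymm h3 (sq_nonneg _)

theorem modular_zero (hα : 0 < α) : modular α 0 = 0 := by
  simp [modular, Psi_zero hα]

theorem mem_constraintSet_of_modular_eq_one (hα : 0 < α) (hf : AEStronglyMeasurable f volume)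
    (h : modular α f = 1) : f ∈ constraintSet α := by
  refine ⟨⟨hf, 1, one_pos, ?_⟩, le_antisymm ?_ ?_⟩
  · simp only [one_mul]
    exact (show modular α f < ∞ from h ▸ ENNReal.one_lt_top)
  · refine csInf_le ⟨0, fun l hl => hl.1.le⟩ ⟨one_pos, ?_⟩
    simp only [div_one]
    exact h.le
  · refine le_csInf ⟨1, one_pos, by simp only [div_one]; exact h.le⟩ ?_
    rintro l ⟨hl, hl1⟩
    by_contra hc
    push Not at hc
    have h1 := mul_modular_le hα (s := 1 / l) (by rw [le_div_iff₀ hl]; linarith) f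
    have h2 : modular α (fun x => 1 / l * f x) ≤ 1 := by
      refine le_trans (le_of_eq ?_) hl1
      unfold modular
      simp only [one_div_mul_eq_div]
    rw [h, mul_one] at h1
    have h3 := h1.trans h2
    rw [ENNReal.ofReal_le_one, div_le_one hl] at h3
    linarith

/-- Functions of modular at most one are, up to a factor at most one, in the constraint set. -/
theorem exists_smul_mem_constraintSet (hα : 0 < α) (hf : AEStronglyMeasurable f volume)
    (h : modular α f ≤ 1) (h0 : modular α f ≠ 0) :
    ∃ s : ℝ, 1 ≤ s ∧ (fun x => s * f x) ∈ constraintSet α := by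
  set S := {l : ℝ | 0 < l ∧ ∫⁻ x, ENNReal.ofReal (Psi α (f x / l)) ≤ 1} with hS
  have hmod : ∀ l : ℝ, ∫⁻ x, ENNReal.ofReal (Psi α (f x / l)) = modular α (fun x => 1 / l * f x) := by
    intro l
    unfold modular
    simp only [one_div_mul_eq_div]
  have hbd : BddBelow S := ⟨0, fun l hl => hl.1.le⟩
  have h1S : (1 : ℝ) ∈ S := ⟨one_pos, by simp only [div_one]; exact h⟩
  have hN1 : sInf S ≤ 1 := csInf_le hbd h1S
  have hfin : modular α f ≠ ∞ := ne_top_of_le_ne_top ENNReal.one_ne_top h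
  have hm : 0 < (modular α f).toReal := ENNReal.toReal_pos h0 hfin
  have hm1 : (modular α f).toReal ≤ 1 := by
    have := ENNReal.toReal_mono ENNReal.one_ne_top h
    simpa using this
  have hN : 0 < sInf S := by
    refine lt_of_lt_of_le hm (le_csInf ⟨1, h1S⟩ ?_)
    rintro l ⟨hl, hl1⟩
    rcases le_or_gt 1 l with hc | hc
    · linarith
    have h1 := mul_modular_le hα (s := 1 / l) (by rw [le_div_iff₀ hl]; linarith) f
    rw [hmod] at hl1
    have h2 := h1.trans hl1
    rw [← ENNReal.ofReal_toReal hfin, ← ENNReal.ofReal_mul (by positivity), ENNReal.ofReal_le_one,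
      one_div_mul_eq_div, div_le_one hl] at h2
    exact h2
  refine ⟨1 / sInf S, by rw [le_div_iff₀ hN]; linarith, ⟨hf.const_mul _, sInf S, hN, ?_⟩, ?_⟩
  · have : ∀ x, sInf S * (1 / sInf S * f x) = f x := fun x => by field_simp
    simp only [this]
    exact hfin.lt_top
  · unfold gaugeNorm
    have hset : {l : ℝ | 0 < l ∧ ∫⁻ x, ENNReal.ofReal (Psi α (1 / sInf S * f x / l)) ≤ 1} =
        {l : ℝ | l * sInf S ∈ S} := by
      ext l
      have e : ∀ x, 1 / sInf S * f x / l = f x / (l * sInf S) := fun x => by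
        rw [div_mul_eq_mul_div, one_mul, div_div, mul_comm]
      rw [mem_ofPred_eq, mem_ofPred_eq, hS, mem_ofPred_eq, ← hS]
      simp only [e]
      exact and_congr_left fun _ => (mul_pos_iff_of_pos_right hN).symm
    rw [hset]
    refine le_antisymm ?_ ?_
    · refine le_of_forall_gt_imp_ge_of_dense fun c hc => ?_
      obtain ⟨l, hl, hlc⟩ := exists_lt_of_csInf_lt ⟨1, h1S⟩ (show sInf S < c * sInf S by nlinarith)
      refine (csInf_le ⟨0, ?_⟩ (show l / sInf S ∈ {l : ℝ | l * sInf S ∈ S} from ?_)).trans ?_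
      · intro l hl
        exact ((mul_pos_iff_of_pos_right hN).1 hl.1).le
      · rw [mem_ofPred_eq, div_mul_cancel₀ _ hN.ne']
        exact hl
      · rw [div_le_iff₀ hN]; exact hlc.le
    · refine le_csInf ⟨1 / sInf S, ?_⟩ ?_
      · rw [mem_ofPred_eq, div_mul_cancel₀ _ hN.ne']
        exact h1S
      · intro l hl
        have := csInf_le hbd hl
        nlinarith

/-- The growth bound `Psi_mul_le` makes the modular continuous under dilations near 1. A modular
above 1 would therefore contradict dilations l close to 1 being admissible, and one below 1 would
leave room for some l < 1. -/
theorem modular_eq_one_of_mem (hα : 0 < α) (h : f ∈ constraintSet α) : modular α f = 1 := by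
  obtain ⟨⟨hf, -⟩, hN⟩ := h
  set S := {l : ℝ | 0 < l ∧ ∫⁻ x, ENNReal.ofReal (Psi α (f x / l)) ≤ 1} with hS
  have hN' : sInf S = 1 := hN
  have hne : S.Nonempty := by
    by_contra hc
    rw [not_nonempty_iff_eq_empty.1 hc, Real.sInf_empty] at hN'
    exact zero_ne_one hN'
  refine le_antisymm ?_ ?_
  · have key : ∀ c : ℝ, 1 < c → modular α f ≤ ENNReal.ofReal (c ^ 4) := by
      intro c hc
      obtain ⟨l, hl, hlc⟩ := exists_lt_of_csInf_lt hne (show sInf S < c by rw [hN']; exact hc)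
      have hl1 : 1 ≤ l := by rw [← hN']; exact csInf_le ⟨0, fun l hl => hl.1.le⟩ hl
      have h1 := modular_mul_le hα hl1 (fun x => f x / l)
      have e : ∀ x, l * (f x / l) = f x := fun x => mul_div_cancel₀ _ hl.1.ne'
      simp only [e] at h1
      calc modular α f ≤ ENNReal.ofReal (l ^ 4) * 1 := h1.trans (mul_le_mul_right hl.2 _)
        _ ≤ ENNReal.ofReal (c ^ 4) := by
          rw [mul_one]
          exact ENNReal.ofReal_le_ofReal (pow_le_pow_left₀ (by linarith) hlc.le 4)
    have ht : Tendsto (fun c : ℝ => ENNReal.ofReal (c ^ 4)) (𝓝[>] 1) (𝓝 (ENNReal.ofReal (1 ^ 4))) :=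
      (ENNReal.continuous_ofReal.comp (continuous_pow 4)).continuousAt.continuousWithinAt
    rw [one_pow, ENNReal.ofReal_one] at ht
    exact ge_of_tendsto ht (eventually_mem_nhdsWithin.mono fun c hc => key c hc)
  · by_contra hc
    push Not at hc
    have hev : ∃ s : ℝ, 1 < s ∧ ENNReal.ofReal (s ^ 4) * modular α f ≤ 1 := by
      have ht : Tendsto (fun c : ℝ => ENNReal.ofReal (c ^ 4) * modular α f) (𝓝[>] 1)
          (𝓝 (ENNReal.ofReal (1 ^ 4) * modular α f)) := by
        refine ENNReal.Tendsto.mul_const ?_ (Or.inr (ne_top_of_lt hc))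
        exact (ENNReal.continuous_ofReal.comp (continuous_pow 4)).continuousAt.continuousWithinAt
      rw [one_pow, ENNReal.ofReal_one, one_mul] at ht
      obtain ⟨s, h1, h2⟩ := ((ht.eventually_lt_const hc).and eventually_mem_nhdsWithin).exists
      exact ⟨s, h2, h1.le⟩
    obtain ⟨s, hs, hs1⟩ := hev
    have : (1 / s : ℝ) ∈ S := by
      refine ⟨by positivity, ?_⟩
      have e : ∀ x, f x / (1 / s) = s * f x := fun x => by field_simp
      simp only [e]
      exact (modular_mul_le hα hs.le f).trans hs1
    have h2 := csInf_le ⟨0, fun l hl => hl.1.le⟩ this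
    rw [hN', le_div_iff₀ (by linarith)] at h2
    linarith

theorem IsMaximizer.modular_eq_one (hα : 0 < α) (h : IsMaximizer α f) : modular α f = 1 :=
  modular_eq_one_of_mem hα h.1

theorem IsMaximizer.aestronglyMeasurable (h : IsMaximizer α f) : AEStronglyMeasurable f volume :=
  h.1.1.1

theorem IsMaximizer.memLp_two (hα : 0 < α) (h : IsMaximizer α f) : MemLp f 2 volume :=
  memLp_two_of_modular hα h.aestronglyMeasurable (h.modular_eq_one hα ▸ ENNReal.one_ne_top)

theorem J_zero : J 0 = 0 := by
  have h := J_sq_le (f := (0 : ℝ → ℝ)) (MemLp.zero (p := 2) (μ := volume))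
  simp only [Pi.zero_apply, ne_eq, OfNat.ofNat_ne_zero, not_false_eq_true, zero_pow,
    integral_zero] at h
  exact pow_eq_zero_iff two_ne_zero |>.1 (le_antisymm h (sq_nonneg _))

theorem IsMaximizer.J_le (hα : 0 < α) (h : IsMaximizer α f) (hg : AEStronglyMeasurable g volume)
    (hg1 : modular α g ≤ 1) : J g ≤ J f := by
  by_cases h0 : modular α g = 0
  · rw [J_congr (ae_eq_zero_of_modular hα hg h0), J_zero]
    exact J_nonneg f
  · obtain ⟨s, hs, hmem⟩ := exists_smul_mem_constraintSet hα hg hg1 h0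
    have h1 : J (fun x => s * g x) ≤ J f := h.2 hmem
    have h2 := J_smul s (memLp_two_of_modular hα hg (ne_top_of_le_ne_top ENNReal.one_ne_top hg1))
    have h3 : J g ^ 2 ≤ J (fun x => s * g x) ^ 2 := by
      rw [h2]
      exact le_mul_of_one_le_left (sq_nonneg _) (one_le_pow₀ hs)
    exact (pow_le_pow_iff_left₀ (J_nonneg _) (J_nonneg _) two_ne_zero |>.1 h3).trans h1

/-- Dilating g by q^(-1/4) multiplies the modular by at most 1/q, so the result is still admissible,
while J² gains a factor q^(-1/2). -/
theorem IsMaximizer.J_sq_le_sqrt (hα : 0 < α) (h : IsMaximizer α f)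
    (hg : AEStronglyMeasurable g volume) {q : ℝ} (hq : 0 < q) (hq1 : q ≤ 1)
    (hgq : modular α g ≤ ENNReal.ofReal q) : J g ^ 2 ≤ Real.sqrt q * J f ^ 2 := by
  set s : ℝ := (Real.sqrt (Real.sqrt q))⁻¹ with hs
  have hr : 0 < Real.sqrt q := Real.sqrt_pos.2 hq
  have hr1 : Real.sqrt q ≤ 1 := Real.sqrt_le_one.2 hq1
  have hs2 : s ^ 2 = (Real.sqrt q)⁻¹ := by rw [hs, inv_pow, Real.sq_sqrt hr.le]
  have hs4 : s ^ 4 = q⁻¹ := by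
    rw [show s ^ 4 = (s ^ 2) ^ 2 by ring, hs2, inv_pow, Real.sq_sqrt hq.le]
  have hs1 : 1 ≤ s := by
    rw [hs]
    exact (one_le_inv₀ (Real.sqrt_pos.2 hr)).2 (Real.sqrt_le_one.2 hr1)
  have hfin := ne_top_of_le_ne_top ENNReal.ofReal_ne_top hgq
  have h1 : modular α (fun x => s * g x) ≤ 1 := by
    refine (modular_mul_le hα hs1 g).trans ?_
    refine (mul_le_mul_right hgq _).trans ?_
    rw [← ENNReal.ofReal_mul (by positivity), hs4, inv_mul_cancel₀ hq.ne', ENNReal.ofReal_one]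
  have h2 := h.J_le hα (hg.const_mul s) h1
  have h3 := J_smul s (memLp_two_of_modular hα hg hfin)
  have h4 : J (fun x => s * g x) ^ 2 ≤ J f ^ 2 := pow_le_pow_left₀ (J_nonneg _) h2 2
  rw [h3, hs2, inv_mul_le_iff₀ hr] at h4
  exact h4

end Orlicz

/-! ### The bilinear form and convolution with the kernel. -/

/-- The bilinear form `∬ W(z) f(x) g(x+z) dx dz`. -/
noncomputable def bil (W f g : ℝ → ℝ) : ℝ :=
  ∫ p : ℝ × ℝ, W p.1 * (f p.2 * g (p.2 + p.1)) ∂(volume.prod volume)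

/-- The convolution of `f` with the even kernel `W`. -/
noncomputable def conv (W f : ℝ → ℝ) (x : ℝ) : ℝ := ∫ z, W z * f (x + z)

section Bilinear

variable {W f g h : ℝ → ℝ}

theorem measurePreserving_shear :
    MeasurePreserving (fun p : ℝ × ℝ => (p.1, p.2 + p.1)) (volume.prod volume) (volume.prod volume) := by
  have := measurePreserving_prod_add (volume : Measure ℝ) (volume : Measure ℝ)
  simpa only [add_comm] using this

theorem integrable_mul_sq_shear (hW : IsWhithamKernel W) (hg : MemLp g 2 volume) :
    Integrable (fun p : ℝ × ℝ => W p.1 * g (p.2 + p.1) ^ 2) (volume.prod volume) :=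
  measurePreserving_shear.integrable_comp_of_integrable (hW.integrable.mul_prod hg.integrable_sq)

theorem aestronglyMeasurable_bil (hW : IsWhithamKernel W) (hf : AEStronglyMeasurable f volume)
    (hg : AEStronglyMeasurable g volume) :
    AEStronglyMeasurable (fun p : ℝ × ℝ => W p.1 * (f p.2 * g (p.2 + p.1))) (volume.prod volume) := by
  refine (hW.integrable.1.comp_fst).mul ((hf.comp_snd).mul ?_)
  exact (hg.comp_snd (μ := volume)).comp_measurePreserving measurePreserving_shear

theorem integrable_bil (hW : IsWhithamKernel W) (hf : MemLp f 2 volume) (hg : MemLp g 2 volume) :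
    Integrable (fun p : ℝ × ℝ => W p.1 * (f p.2 * g (p.2 + p.1))) (volume.prod volume) := by
  have h1 := (hW.integrable.mul_prod hf.integrable_sq).add (integrable_mul_sq_shear hW hg)
  refine h1.mono' (aestronglyMeasurable_bil hW hf.1 hg.1) (Eventually.of_forall fun p => ?_)
  have h0 := hW.nonneg p.1
  rw [Real.norm_eq_abs, abs_mul, abs_of_nonneg h0, Pi.add_apply, ← mul_add]
  refine mul_le_mul_of_nonneg_left ?_ h0
  rw [abs_le]
  constructor <;> nlinarith [sq_nonneg (f p.2 + g (p.2 + p.1)), sq_nonneg (f p.2 - g (p.2 + p.1)),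
    sq_nonneg (f p.2), sq_nonneg (g (p.2 + p.1))]

theorem integral_prod_mul_sq (hW : IsWhithamKernel W) (f : ℝ → ℝ) :
    ∫ p : ℝ × ℝ, W p.1 * f p.2 ^ 2 ∂(volume.prod volume) = ∫ x, f x ^ 2 := by
  have := integral_prod_mul (μ := volume) (ν := volume) W (fun x => f x ^ 2)
  rw [this, hW.integral_eq_one, one_mul]

theorem integral_prod_mul_sq_shear (hW : IsWhithamKernel W) (hg : MemLp g 2 volume) :
    ∫ p : ℝ × ℝ, W p.1 * g (p.2 + p.1) ^ 2 ∂(volume.prod volume) = ∫ x, g x ^ 2 := by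
  have h := (hW.integrable.mul_prod hg.integrable_sq).1
  rw [← integral_prod_mul_sq hW g]
  have := integral_map (f := fun p : ℝ × ℝ => W p.1 * g p.2 ^ 2)
    measurePreserving_shear.measurable.aemeasurable (by rw [measurePreserving_shear.map_eq]; exact h)
  rw [measurePreserving_shear.map_eq] at this
  exact this.symm

/-- Expand the square in `diffForm_eq`; since W has mass one, the two pure squares each give ∫ f².
-/
theorem J_sq_eq_bil (hW : IsWhithamKernel W) (hf : MemLp f 2 volume) : J f ^ 2 = bil W f f := by
  have h1 := diffForm_eq hW hf
  have i1 := hW.integrable.mul_prod hf.integrable_sq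
  have i2 := integrable_mul_sq_shear hW hf
  have i3 := integrable_bil hW hf hf
  have hI : Integrable (fun p : ℝ × ℝ => W p.1 * (f (p.2 + p.1) - f p.2) ^ 2) (volume.prod volume) := by
    refine ((i1.add i2).sub (i3.const_mul 2)).congr (Eventually.of_forall fun p => ?_)
    simp only [Pi.add_apply, Pi.sub_apply]
    ring
  have h2 : diffForm W f = ENNReal.ofReal
      (∫ p : ℝ × ℝ, W p.1 * (f (p.2 + p.1) - f p.2) ^ 2 ∂(volume.prod volume)) := by
    rw [ofReal_integral_eq_lintegral_ofReal hI
      (Eventually.of_forall fun p => mul_nonneg (hW.nonneg _) (sq_nonneg _)),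
      lintegral_prod _ hI.1.aemeasurable.ennreal_ofReal]
    refine lintegral_congr fun z => ?_
    rw [← lintegral_const_mul' _ _ ENNReal.ofReal_ne_top]
    refine lintegral_congr fun x => ?_
    rw [ENNReal.ofReal_mul (hW.nonneg _)]
  have h3 : ∫ p : ℝ × ℝ, W p.1 * (f (p.2 + p.1) - f p.2) ^ 2 ∂(volume.prod volume) =
      2 * (∫ x, f x ^ 2) - 2 * bil W f f := by
    have e : (fun p : ℝ × ℝ => W p.1 * (f (p.2 + p.1) - f p.2) ^ 2) = fun p =>
        (W p.1 * f p.2 ^ 2 + W p.1 * f (p.2 + p.1) ^ 2) -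
        2 * (W p.1 * (f p.2 * f (p.2 + p.1))) := by ext p; ring
    have i12 : Integrable (fun p : ℝ × ℝ => W p.1 * f p.2 ^ 2 + W p.1 * f (p.2 + p.1) ^ 2)
        (volume.prod volume) := i1.add i2
    rw [e, integral_sub i12 (i3.const_mul 2), integral_add i1 i2, integral_const_mul,
      integral_prod_mul_sq hW, integral_prod_mul_sq_shear hW hf, bil]
    ring
  have h4 := J_sq_le hf
  have h5 : 0 ≤ ∫ p : ℝ × ℝ, W p.1 * (f (p.2 + p.1) - f p.2) ^ 2 ∂(volume.prod volume) :=
    integral_nonneg fun p => mul_nonneg (hW.nonneg _) (sq_nonneg _)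
  rw [h1, ENNReal.ofReal_eq_ofReal_iff (by linarith) h5, h3] at h2
  linarith

theorem bil_add_left (hW : IsWhithamKernel W) (hf : MemLp f 2 volume) (hg : MemLp g 2 volume)
    (hh : MemLp h 2 volume) : bil W (fun x => f x + g x) h = bil W f h + bil W g h := by
  unfold bil
  rw [← integral_add (integrable_bil hW hf hh) (integrable_bil hW hg hh)]
  exact integral_congr_ae (Eventually.of_forall fun p => by ring)

theorem bil_add_right (hW : IsWhithamKernel W) (hf : MemLp f 2 volume) (hg : MemLp g 2 volume)
    (hh : MemLp h 2 volume) : bil W h (fun x => f x + g x) = bil W h f + bil W h g := by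
  unfold bil
  rw [← integral_add (integrable_bil hW hh hf) (integrable_bil hW hh hg)]
  exact integral_congr_ae (Eventually.of_forall fun p => by ring)

theorem bil_smul_left (c : ℝ) : bil W (fun x => c * f x) g = c * bil W f g := by
  unfold bil
  rw [← integral_const_mul]
  exact integral_congr_ae (Eventually.of_forall fun p => by ring)

theorem bil_eq_integral_shift (hW : IsWhithamKernel W) (hf : MemLp f 2 volume)
    (hg : MemLp g 2 volume) : bil W f g = ∫ z, W z * ∫ x, f x * g (x + z) := by
  rw [bil, integral_prod _ (integrable_bil hW hf hg)]
  refine integral_congr_ae (Eventually.of_forall fun z => ?_)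
  simp only [integral_const_mul]

theorem bil_comm (hW : IsWhithamKernel W) (hf : MemLp f 2 volume) (hg : MemLp g 2 volume) :
    bil W f g = bil W g f := by
  rw [bil_eq_integral_shift hW hf hg, bil_eq_integral_shift hW hg hf,
    ← integral_neg_eq_self (fun z => W z * ∫ x, f x * g (x + z))]
  refine integral_congr_ae (Eventually.of_forall fun z => ?_)
  simp only [hW.even]
  congr 1
  rw [← integral_add_right_eq_self _ z]
  refine integral_congr_ae (Eventually.of_forall fun x => ?_)
  simp only [add_neg_cancel_right, mul_comm]

theorem bil_eq_integral_conv (hW : IsWhithamKernel W) (hf : MemLp f 2 volume)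
    (hg : MemLp g 2 volume) : bil W f g = ∫ x, f x * conv W g x := by
  rw [bil, integral_prod_symm _ (integrable_bil hW hf hg)]
  refine integral_congr_ae (Eventually.of_forall fun x => ?_)
  simp only [conv]
  rw [← integral_const_mul]
  exact integral_congr_ae (Eventually.of_forall fun z => by ring)

theorem integrable_mul_conv (hW : IsWhithamKernel W) (hf : MemLp f 2 volume)
    (hg : MemLp g 2 volume) : Integrable (fun x => f x * conv W g x) := by
  refine (integrable_bil hW hf hg).integral_prod_right.congr (Eventually.of_forall fun x => ?_)
  simp only [conv]
  rw [← integral_const_mul]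
  exact integral_congr_ae (Eventually.of_forall fun z => by ring)

theorem J_add_sq (hW : IsWhithamKernel W) (hf : MemLp f 2 volume) (hg : MemLp g 2 volume) :
    J (fun x => f x + g x) ^ 2 = J f ^ 2 + 2 * bil W f g + J g ^ 2 := by
  have hfg : MemLp (fun x => f x + g x) 2 volume := hf.add hg
  rw [J_sq_eq_bil hW hfg, J_sq_eq_bil hW hf, J_sq_eq_bil hW hg, bil_add_left hW hf hg hfg,
    bil_add_right hW hf hg hf, bil_add_right hW hf hg hg, bil_comm hW hg hf]
  ring

theorem energy_eq (hW : IsWhithamKernel W) (hf0 : ∀ x, 0 ≤ f x)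
    (hf : MemLp f 2 volume) : energy W f = ENNReal.ofReal (J f ^ 2) := by
  rw [J_sq_eq_bil hW hf, bil, ofReal_integral_eq_lintegral_ofReal (integrable_bil hW hf hf)
    (Eventually.of_forall fun p => mul_nonneg (hW.nonneg _) (mul_nonneg (hf0 _) (hf0 _))),
    lintegral_prod_symm _ (integrable_bil hW hf hf).1.aemeasurable.ennreal_ofReal, energy]
  refine lintegral_congr fun x => ?_
  rw [← lintegral_const_mul' _ _ ENNReal.ofReal_ne_top,
    ← lintegral_add_right_eq_self _ x]
  refine lintegral_congr fun z => ?_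
  rw [add_sub_cancel_right, ENNReal.ofReal_mul (hW.nonneg _), ENNReal.ofReal_mul (hf0 _), add_comm z x]
  ring

/-- Monotonicity of `∫ f² - J(f)²` under contractions. -/
theorem J_sq_sub_le (hf : MemLp f 2 volume) (hg : MemLp g 2 volume)
    (hfg : ∀ x y, |g x - g y| ≤ |f x - f y|) :
    (∫ x, g x ^ 2) - J g ^ 2 ≤ (∫ x, f x ^ 2) - J f ^ 2 := by
  have h1 := diffForm_eq isWhithamKernel_kernel hf
  have h2 := diffForm_eq isWhithamKernel_kernel hg
  have h3 : diffForm kernel g ≤ diffForm kernel f := by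
    unfold diffForm
    exact lintegral_mono fun z => mul_le_mul_right (lintegral_mono fun x =>
      ENNReal.ofReal_le_ofReal (sq_le_sq.2 (hfg _ _))) _
  have h4 := J_sq_le hf
  rw [h1, h2, ENNReal.ofReal_le_ofReal_iff (by linarith)] at h3
  linarith

theorem J_le_J_abs (hf : MemLp f 2 volume) : J f ≤ J fun x => |f x| := by
  have h := J_sq_sub_le hf hf.abs fun x y => abs_abs_sub_abs_le_abs_sub (f x) (f y)
  simp only [Pi.abs_apply, sq_abs] at h
  refine pow_le_pow_iff_left₀ (J_nonneg _) (J_nonneg _) two_ne_zero |>.1 ?_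
  have e : J |f| = J fun x => |f x| := rfl
  rw [e] at h
  linarith

end Bilinear

section Conv

variable {W f g : ℝ → ℝ}

theorem integrable_conv (hW : IsWhithamKernel W) (hf : AEStronglyMeasurable f volume) {M : ℝ}
    (hM : ∀ x, |f x| ≤ M) (x : ℝ) : Integrable fun z => W z * f (x + z) := by
  refine hW.integrable.mul_bdd (c := M) ?_ (Eventually.of_forall fun z => hM _)
  exact hf.comp_measurePreserving (measurePreserving_add_left volume x)

theorem conv_nonneg (hW : IsWhithamKernel W) (hf : ∀ x, 0 ≤ f x) (x : ℝ) : 0 ≤ conv W f x :=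
  integral_nonneg fun _ => mul_nonneg (hW.nonneg _) (hf _)

theorem conv_le (hW : IsWhithamKernel W) (hf : AEStronglyMeasurable f volume) {M : ℝ}
    (hM : ∀ x, |f x| ≤ M) (x : ℝ) : conv W f x ≤ M := by
  calc conv W f x ≤ ∫ z, W z * M := by
        refine integral_mono (integrable_conv hW hf hM x) (hW.integrable.mul_const M) fun z => ?_
        exact mul_le_mul_of_nonneg_left ((le_abs_self _).trans (hM _)) (hW.nonneg _)
    _ = M := by rw [integral_mul_const, hW.integral_eq_one, one_mul]

theorem conv_eq_sub (W f : ℝ → ℝ) (x : ℝ) : conv W f x = ∫ y, W (y - x) * f y := by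
  rw [conv, ← integral_add_right_eq_self (fun y => W (y - x) * f y) x]
  refine integral_congr_ae (Eventually.of_forall fun z => ?_)
  simp only
  rw [add_sub_cancel_right, add_comm]

/-- Translation is continuous in L¹, and f is bounded. -/
theorem continuous_conv (hW : IsWhithamKernel W) (hf : AEStronglyMeasurable f volume) {M : ℝ}
    (hM : ∀ x, |f x| ≤ M) : Continuous (conv W f) := by
  have hM0 : 0 ≤ M := (abs_nonneg _).trans (hM 0)
  have hWL : MemLp W 1 volume := memLp_one_iff_integrable.2 hW.integrable
  set T : ℝ → C(ℝ, ℝ) := fun x => (ContinuousMap.curry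
    ⟨fun p : ℝ × ℝ => p.2 - p.1, by fun_prop⟩) x with hT
  have hTc : Continuous T := ContinuousMap.continuous _
  have hTm : ∀ x, MeasurePreserving (T x) volume volume := fun x =>
    measurePreserving_sub_right volume x
  set L : ℝ → Lp (α := ℝ) ℝ 1 volume := fun x => Lp.compMeasurePreserving (T x) (hTm x) (hWL.toLp W)
    with hL
  have hLc : Continuous L := continuous_const.compMeasurePreservingLp hTc hTm (by simp)
  have hLe : ∀ x, L x =ᵐ[volume] fun z => W (z - x) := fun x =>
    (Lp.coeFn_compMeasurePreserving _ _).trans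
      ((hTm x).quasiMeasurePreserving.ae_eq_comp hWL.coeFn_toLp)
  have i0 : ∀ x, Integrable fun z => W (z - x) * f z := by
    intro x
    have := (integrable_conv hW hf hM x).comp_sub_right x
    refine this.congr (Eventually.of_forall fun z => ?_)
    simp only [add_sub_cancel]
  have key : ∀ x y, dist (conv W f y) (conv W f x) ≤ M * dist (L y) (L x) := by
    intro x y
    have i2 : Integrable fun z => |W (z - y) - W (z - x)| :=
      ((hW.integrable.comp_sub_right y).sub (hW.integrable.comp_sub_right x)).abs
    have e1 : dist (L y) (L x) = ∫ z, |W (z - y) - W (z - x)| := by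
      rw [dist_eq_norm, L1.norm_eq_integral_norm]
      refine integral_congr_ae ?_
      filter_upwards [Lp.coeFn_sub (L y) (L x), hLe x, hLe y] with z h1 h2 h3
      rw [h1, Pi.sub_apply, h2, h3, Real.norm_eq_abs]
    rw [e1, Real.dist_eq, conv_eq_sub, conv_eq_sub, ← integral_sub (i0 y) (i0 x),
      ← integral_const_mul]
    refine (abs_integral_le_integral_abs).trans (integral_mono ((i0 y).sub (i0 x)).abs
      (i2.const_mul M) fun z => ?_)
    simp only
    rw [← sub_mul, abs_mul, mul_comm M]
    exact mul_le_mul_of_nonneg_left (hM z) (abs_nonneg _)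
  refine continuous_iff_continuousAt.2 fun x => tendsto_iff_dist_tendsto_zero.2 ?_
  have h0 : Tendsto (fun y => M * dist (L y) (L x)) (𝓝 x) (𝓝 (M * 0)) :=
    (tendsto_iff_dist_tendsto_zero.1 hLc.continuousAt).const_mul M
  rw [mul_zero] at h0
  exact squeeze_zero (fun _ => dist_nonneg) (key x) h0

end Conv

/-! ### Tents as test functions. -/

/-- Even nonnegative functions that are nonincreasing on the open positive half-axis. -/
structure IsBell (f : ℝ → ℝ) : Prop where
  nonneg : ∀ x, 0 ≤ f x
  even : ∀ x, f (-x) = f x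
  antitoneOn : AntitoneOn f (Ioi 0)

theorem IsBell.measurable {f : ℝ → ℝ} (hf : IsBell f) : Measurable f :=
  measurable_of_even_antitoneOn hf.even hf.antitoneOn

/-- The tent of height `A` and half-width `l`. -/
noncomputable def tent (A l x : ℝ) : ℝ := A * max 0 (1 - |x| / l)

section Tent

variable {A l : ℝ}

theorem continuous_tent (A l : ℝ) : Continuous (tent A l) := by
  unfold tent
  fun_prop

theorem tent_nonneg (hA : 0 ≤ A) (l x : ℝ) : 0 ≤ tent A l x := mul_nonneg hA (le_max_left _ _)

theorem tent_le (hA : 0 ≤ A) (hl : 0 < l) (x : ℝ) : tent A l x ≤ A := by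
  refine mul_le_of_le_one_right hA (max_le zero_le_one ?_)
  have : 0 ≤ |x| / l := by positivity
  linarith

theorem tent_eq_zero (hl : 0 < l) {x : ℝ} (hx : l ≤ |x|) : tent A l x = 0 := by
  rw [tent, max_eq_left, mul_zero]
  have : 1 ≤ |x| / l := (one_le_div hl).2 hx
  linarith

theorem isBell_tent (hA : 0 ≤ A) (hl : 0 < l) : IsBell (tent A l) where
  nonneg := tent_nonneg hA l
  even x := by simp [tent]
  antitoneOn x hx y hy hxy := by
    unfold tent
    rw [abs_of_pos (mem_Ioi.1 hx), abs_of_pos (mem_Ioi.1 hy)]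
    gcongr

theorem integral_tent_pow (hl : 0 < l) (n : ℕ) :
    ∫ x, tent A l x ^ (n + 1) = A ^ (n + 1) * (2 * l / (n + 2)) := by
  have h1 : ∫ x, tent A l x ^ (n + 1) = 2 * ∫ x in Ioi (0 : ℝ), (A * max 0 (1 - x / l)) ^ (n + 1) :=
    integral_comp_abs (f := fun x => (A * max 0 (1 - x / l)) ^ (n + 1))
  have h2 : ∫ x in Ioi (0 : ℝ), (A * max 0 (1 - x / l)) ^ (n + 1) =
      ∫ x in Ioc (0 : ℝ) l, (A * (1 - x / l)) ^ (n + 1) := by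
    rw [setIntegral_eq_of_subset_of_forall_sdiff_eq_zero (s := Ioc (0 : ℝ) l) measurableSet_Ioi
      Ioc_subset_Ioi_self]
    · refine setIntegral_congr_fun measurableSet_Ioc fun x hx => ?_
      have : x / l ≤ 1 := (div_le_one hl).2 hx.2
      simp only [max_eq_right (sub_nonneg.2 this)]
    · rintro x ⟨hx0, hx⟩
      have hxl : l < x := by
        by_contra hc
        exact hx ⟨hx0, not_lt.1 hc⟩
      have : 1 ≤ x / l := (one_le_div hl).2 hxl.le
      rw [max_eq_left (by linarith), mul_zero, zero_pow (Nat.succ_ne_zero n)]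
  have h3 : ∫ x in Ioc (0 : ℝ) l, (A * (1 - x / l)) ^ (n + 1) = A ^ (n + 1) * (l / (n + 2)) := by
    rw [← intervalIntegral.integral_of_le hl.le]
    simp only [mul_pow]
    rw [intervalIntegral.integral_const_mul,
      intervalIntegral.integral_comp_sub_div (fun x => x ^ (n + 1)) hl.ne' 1, integral_pow,
      div_self hl.ne']
    congr 1
    simp only [sub_self, zero_div, sub_zero, one_pow, zero_pow (Nat.succ_ne_zero (n + 1)), smul_eq_mul]
    push_cast
    ring
  rw [h1, h2, h3]
  ring

theorem hasCompactSupport_tent (hl : 0 < l) : HasCompactSupport (tent A l) := by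
  refine HasCompactSupport.intro (isCompact_Icc (a := -l) (b := l)) fun x hx => tent_eq_zero hl ?_
  by_contra hc
  exact hx (abs_le.1 (not_le.1 hc).le)

theorem integrable_tent_pow (hl : 0 < l) (n : ℕ) : Integrable fun x => tent A l x ^ (n + 1) := by
  refine ((continuous_tent A l).pow (n + 1)).integrable_of_hasCompactSupport ?_
  refine (hasCompactSupport_tent (A := A) hl).mono fun x hx => ?_
  rw [Function.mem_support] at hx ⊢
  intro h
  refine hx ?_
  rw [Pi.pow_apply, h, zero_pow (Nat.succ_ne_zero n)]

theorem memLp_tent (hl : 0 < l) : MemLp (tent A l) 2 volume :=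
  (memLp_two_iff_integrable_sq (continuous_tent A l).aestronglyMeasurable).2 (integrable_tent_pow hl 1)

/-- The tent has Lipschitz constant A/l, and the difference vanishes unless x or x + z lies in its
support. -/
theorem tent_sub_sq_le (hl : 0 < l) (x z : ℝ) :
    (tent A l (x + z) - tent A l x) ^ 2 ≤
      (Icc (-l) l).indicator (fun _ => A ^ 2 / l ^ 2 * z ^ 2) x +
      (Icc (-l) l).indicator (fun _ => A ^ 2 / l ^ 2 * z ^ 2) (x + z) := by
  have hnn : ∀ w, 0 ≤ (Icc (-l) l).indicator (fun _ => A ^ 2 / l ^ 2 * z ^ 2) w := fun w =>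
    indicator_nonneg (fun _ _ => by positivity) w
  by_cases h : x ∈ Icc (-l) l ∨ x + z ∈ Icc (-l) l
  · have h1 : (tent A l (x + z) - tent A l x) ^ 2 ≤ A ^ 2 / l ^ 2 * z ^ 2 := by
      have h2 : |max 0 (1 - |x + z| / l) - max 0 (1 - |x| / l)| ≤ |z| / l := by
        refine (abs_max_sub_max_le_max _ _ _ _).trans ?_
        rw [sub_self, abs_zero, max_eq_right (abs_nonneg _),
          show 1 - |x + z| / l - (1 - |x| / l) = (|x| - |x + z|) / l by ring, abs_div, abs_of_pos hl]
        refine div_le_div_of_nonneg_right ?_ hl.le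
        have := abs_abs_sub_abs_le_abs_sub x (x + z)
        rwa [sub_add_cancel_left, abs_neg] at this
      have h3 : (max 0 (1 - |x + z| / l) - max 0 (1 - |x| / l)) ^ 2 ≤ (|z| / l) ^ 2 := by
        rw [← sq_abs]
        exact pow_le_pow_left₀ (abs_nonneg _) h2 2
      calc _ = A ^ 2 * (max 0 (1 - |x + z| / l) - max 0 (1 - |x| / l)) ^ 2 := by unfold tent; ring
        _ ≤ A ^ 2 * (|z| / l) ^ 2 := by gcongr
        _ = _ := by rw [div_pow, sq_abs]; ring
    rcases h with h | h
    · rw [indicator_of_mem h]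
      linarith [hnn (x + z)]
    · rw [indicator_of_mem h]
      linarith [hnn x]
  · push Not at h
    have hz : ∀ w, w ∉ Icc (-l) l → tent A l w = 0 := fun w hw => tent_eq_zero hl (by
      by_contra hc
      exact hw (abs_le.1 (not_le.1 hc).le))
    rw [hz _ h.1, hz _ h.2]
    simpa using add_nonneg (hnn x) (hnn (x + z))

/-- Integrating the Lipschitz bound over both supports leaves the second moment of W and a factor
1/l, so long tents lose little. -/
theorem diffForm_tent_le {W : ℝ → ℝ} (hW : IsWhithamKernel W) (hl : 0 < l) :
    diffForm W (tent A l) ≤ ENNReal.ofReal (4 * A ^ 2 / l * ∫ z, W z * z ^ 2) := by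
  have h1 : ∀ z, ∫⁻ x, ENNReal.ofReal ((tent A l (x + z) - tent A l x) ^ 2) ≤
      ENNReal.ofReal (4 * A ^ 2 / l * z ^ 2) := by
    intro z
    set c := A ^ 2 / l ^ 2 * z ^ 2 with hc
    have hc0 : 0 ≤ c := by positivity
    have h2 : ∫⁻ x, ENNReal.ofReal ((Icc (-l) l).indicator (fun _ => c) x) =
        ENNReal.ofReal (c * (2 * l)) := by
      have e : (fun x => ENNReal.ofReal ((Icc (-l) l).indicator (fun _ => c) x)) =
          (Icc (-l) l).indicator fun _ => ENNReal.ofReal c := by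
        ext x
        by_cases hx : x ∈ Icc (-l) l
        · simp only [indicator_of_mem hx]
        · simp only [indicator_of_notMem hx, ENNReal.ofReal_zero]
      rw [e, lintegral_indicator_const measurableSet_Icc, Real.volume_Icc, ← ENNReal.ofReal_mul hc0]
      congr 2
      ring
    have hm : Measurable fun x => ENNReal.ofReal ((Icc (-l) l).indicator (fun _ => c) x) :=
      (measurable_const.indicator measurableSet_Icc).ennreal_ofReal
    calc _ ≤ ∫⁻ x, (ENNReal.ofReal ((Icc (-l) l).indicator (fun _ => c) x) +
          ENNReal.ofReal ((Icc (-l) l).indicator (fun _ => c) (x + z))) := by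
          refine lintegral_mono fun x => ?_
          rw [← ENNReal.ofReal_add (indicator_nonneg (fun _ _ => hc0) _)
            (indicator_nonneg (fun _ _ => hc0) _)]
          exact ENNReal.ofReal_le_ofReal (tent_sub_sq_le hl x z)
      _ = ENNReal.ofReal (c * (2 * l)) + ENNReal.ofReal (c * (2 * l)) := by
          rw [lintegral_add_left hm,
            lintegral_add_right_eq_self (fun x => ENNReal.ofReal ((Icc (-l) l).indicator (fun _ => c) x)) z,
            h2]
      _ = _ := by
          rw [← ENNReal.ofReal_add (by positivity) (by positivity), hc]
          congr 1
          field_simp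
          ring
  have hI : Integrable fun z => 4 * A ^ 2 / l * (W z * z ^ 2) := hW.integrable_sq_mul.const_mul _
  rw [← integral_const_mul, ofReal_integral_eq_lintegral_ofReal hI
    (Eventually.of_forall fun z => mul_nonneg (by positivity) (mul_nonneg (hW.nonneg z) (sq_nonneg z)))]
  refine lintegral_mono fun z => ?_
  refine (mul_le_mul_right (h1 z) _).trans (le_of_eq ?_)
  rw [← ENNReal.ofReal_mul (hW.nonneg z)]
  congr 1
  ring

end Tent

/-- Long, low tents beat the trivial level `1 / α` of the functional. -/
theorem exists_test : ∃ c : ℝ, 0 < c ∧ ∀ α : ℝ, 0 < α → ∃ g : ℝ → ℝ, IsBell g ∧ (∀ x, g x ≤ α) ∧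
    modular α g = 1 ∧ 1 / α + c * min (1 / α) (1 / α ^ 3) ≤ J g ^ 2 := by
  set m := ∫ z, kernel z * z ^ 2 with hm
  have hW := isWhithamKernel_kernel
  have hm0 : 0 ≤ m := integral_nonneg fun z => mul_nonneg (hW.nonneg z) (sq_nonneg z)
  set ε : ℝ := 1 / (1 + 32 * m) with hε
  have hε0 : 0 < ε := by positivity
  have hε1 : ε ≤ 1 := by rw [hε, div_le_one (by positivity)]; linarith
  have hεm : ε * m ≤ 1 / 32 := by
    rw [hε, one_div_mul_eq_div, div_le_iff₀ (by positivity)]; linarith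
  refine ⟨ε / 8, by positivity, fun α hα => ?_⟩
  -- The bound A ≤ α keeps the tent in the polynomial range of Ψ; A α ≤ ε makes the loss small
  -- compared with the gain.
  set A := ε * min α (1 / α) with hA
  have hmin : 0 < min α (1 / α) := lt_min hα (by positivity)
  have hA0 : 0 < A := by positivity
  have hAα : A ≤ α := (mul_le_of_le_one_left hmin.le hε1).trans (min_le_left _ _)
  have hA1 : A * α ≤ ε := by
    have : min α (1 / α) * α ≤ 1 := by
      calc min α (1 / α) * α ≤ 1 / α * α := by gcongr; exact min_le_right _ _
        _ = 1 := by field_simp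
    calc A * α = ε * (min α (1 / α) * α) := by rw [hA]; ring
      _ ≤ ε := mul_le_of_le_one_right hε0.le this
  -- The modular of a tent of half-width l is l q, so l = 1/q normalises it.
  set q := 2 / 3 * α * A ^ 2 - A ^ 3 / 6 with hq
  have hq1 : α * A ^ 2 / 2 ≤ q := by rw [hq]; nlinarith [mul_nonneg (sq_nonneg A) (sub_nonneg.2 hAα)]
  have hq2 : q ≤ 2 / 3 * α * A ^ 2 := by rw [hq]; linarith [pow_pos hA0 3]
  have hq0 : 0 < q := lt_of_lt_of_le (by positivity) hq1
  set l := 1 / q with hl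
  have hl0 : 0 < l := by positivity
  have hlq : l * q = 1 := by rw [hl]; field_simp
  set g := tent A l with hg
  have hgα : ∀ x, g x ≤ α := fun x => (tent_le hA0.le hl0 x).trans hAα
  have i2 := integral_tent_pow (A := A) hl0 1
  have i3 := integral_tent_pow (A := A) hl0 2
  norm_num at i2 i3
  have hPsi : ∀ x, Psi α (g x) = α * g x ^ 2 - 1 / 3 * g x ^ 3 := fun x =>
    Psi_of_le hα (tent_nonneg hA0.le l x) (hgα x)
  have hI2 : Integrable fun x => α * g x ^ 2 := (integrable_tent_pow hl0 1).const_mul α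
  have hI3 : Integrable fun x => 1 / 3 * g x ^ 3 := (integrable_tent_pow hl0 2).const_mul (1 / 3)
  have hmod : modular α g = 1 := by
    have e : ∫ x, Psi α (g x) = 1 := by
      simp only [hPsi]
      rw [integral_sub hI2 hI3, integral_const_mul, integral_const_mul, i2, i3]
      refine Eq.trans ?_ hlq
      rw [hq]
      ring
    have hI : Integrable fun x => Psi α (g x) := by
      simp only [hPsi]
      exact hI2.sub hI3
    rw [modular, ← ofReal_integral_eq_lintegral_ofReal hI (Eventually.of_forall fun x => Psi_nonneg hα _),
      e, ENNReal.ofReal_one]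
  refine ⟨g, isBell_tent hA0.le hl0, hgα, hmod, ?_⟩
  have h1 := diffForm_eq hW (memLp_tent (A := A) hl0)
  have h2 := diffForm_tent_le (A := A) hW hl0
  rw [h1, ENNReal.ofReal_le_ofReal_iff (by positivity), i2, ← hm] at h2
  have h3 : 4 * A ^ 2 / l = 4 * A ^ 2 * q := by rw [hl]; field_simp
  rw [h3] at h2
  -- The constraint α ∫ g² - ∫ g³ / 3 = 1 shows that ∫ g² exceeds 1/α by a third of ∫ g³ divided by
  -- α: this is the gain.
  have h4 : A ^ 2 * (2 * l / 3) = 1 / α + A ^ 3 * l / (6 * α) := by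
    field_simp
    have : l * (α * A ^ 2 * 4 - A ^ 3) = 6 := by
      have : l * (α * A ^ 2 * 4 - A ^ 3) = 6 * (l * q) := by rw [hq]; ring
      rw [this, hlq, mul_one]
    linarith
  have h5 : A / (4 * α ^ 2) ≤ A ^ 3 * l / (6 * α) := by
    rw [div_le_div_iff₀ (by positivity) (by positivity)]
    have : 3 ≤ l * (2 * α * A ^ 2) := by
      have := mul_le_mul_of_nonneg_left hq2 hl0.le
      rw [hlq] at this
      linarith
    nlinarith [mul_le_mul_of_nonneg_left this (show 0 ≤ 2 * A * α by positivity)]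
  -- The loss ∫ g² - J(g)² is of order α A⁴ m, and the choice of ε makes it at most half of the gain
  -- A / (4α²).
  have h6 : 2 * A ^ 2 * q * m ≤ A / (8 * α ^ 2) := by
    rw [le_div_iff₀ (by positivity)]
    have a1 : (A * α) ^ 3 ≤ ε := by
      calc (A * α) ^ 3 ≤ ε ^ 3 := pow_le_pow_left₀ (by positivity) hA1 3
        _ ≤ ε := by
          have := pow_le_pow_of_le_one hε0.le hε1 (show 1 ≤ 3 by norm_num)
          rwa [pow_one] at this
    have a2 : (A * α) ^ 3 * m ≤ 1 / 32 := (mul_le_mul_of_nonneg_right a1 hm0).trans hεm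
    have a3 : 2 * A ^ 2 * q * m * (8 * α ^ 2) ≤ 2 * A ^ 2 * (2 / 3 * α * A ^ 2) * m * (8 * α ^ 2) := by
      gcongr
    calc _ ≤ _ := a3
      _ = A * (32 / 3 * ((A * α) ^ 3 * m)) := by ring
      _ ≤ A * 1 := by gcongr; linarith
      _ = A := mul_one A
  have h7 : ε / 8 * min (1 / α) (1 / α ^ 3) = A / (8 * α ^ 2) := by
    have : min (1 / α) (1 / α ^ 3) = min α (1 / α) * (1 / α ^ 2) := by
      rw [min_mul_of_nonneg _ _ (by positivity)]
      congr 1 <;> field_simp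
    rw [this, hA]
    ring
  have h8 : A / (4 * α ^ 2) = 2 * (A / (8 * α ^ 2)) := by field_simp; norm_num
  rw [h7]
  linarith

/-! ### Boundedness of maximisers and the Euler–Lagrange equation. -/

section Maximizer

variable {α : ℝ} {f g : ℝ → ℝ}

theorem IsMaximizer.congr (hα : 0 < α) (h : IsMaximizer α f) (hfg : f =ᵐ[volume] g) :
    IsMaximizer α g := by
  refine ⟨mem_constraintSet_of_modular_eq_one hα (h.aestronglyMeasurable.congr hfg) ?_, fun k hk => ?_⟩
  · rw [← modular_congr hfg, h.modular_eq_one hα]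
  · rw [mem_ofPred_eq, ← J_congr hfg]
    exact h.2 hk

theorem IsMaximizer.one_div_lt (hα : 0 < α) (h : IsMaximizer α f) : 1 / α < J f ^ 2 := by
  obtain ⟨c, hc, H⟩ := exists_test
  obtain ⟨g, hg, -, hg1, hJ⟩ := H α hα
  have h1 := h.J_le hα hg.measurable.aestronglyMeasurable hg1.le
  have h2 : J g ^ 2 ≤ J f ^ 2 := pow_le_pow_left₀ (J_nonneg _) h1 2
  have h3 : 0 < c * min (1 / α) (1 / α ^ 3) := mul_pos hc (lt_min (by positivity) (by positivity))
  linarith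

theorem IsMaximizer.J_sq_pos (hα : 0 < α) (h : IsMaximizer α f) : 0 < J f ^ 2 :=
  lt_trans (by positivity) (h.one_div_lt hα)

theorem integrable_Psi (hα : 0 < α) (hf : AEStronglyMeasurable f volume) (h : modular α f ≠ ∞) :
    Integrable fun x => Psi α (f x) := by
  refine ⟨(continuous_Psi α).comp_aestronglyMeasurable hf, ?_⟩
  rw [hasFiniteIntegral_iff_ofReal (Eventually.of_forall fun x => Psi_nonneg hα _)]
  exact h.lt_top

theorem modular_eq_ofReal (hα : 0 < α) (hI : Integrable fun x => Psi α (f x)) :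
    modular α f = ENNReal.ofReal (∫ x, Psi α (f x)) :=
  (ofReal_integral_eq_lintegral_ofReal hI (Eventually.of_forall fun _ => Psi_nonneg hα _)).symm

theorem IsMaximizer.integrable_Psi (hα : 0 < α) (h : IsMaximizer α f) :
    Integrable fun x => Psi α (f x) :=
  Whitham.integrable_Psi hα h.aestronglyMeasurable (h.modular_eq_one hα ▸ ENNReal.one_ne_top)

theorem IsMaximizer.integral_Psi (hα : 0 < α) (h : IsMaximizer α f) : ∫ x, Psi α (f x) = 1 := by
  have h1 := modular_eq_ofReal hα (h.integrable_Psi hα)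
  rw [h.modular_eq_one hα, eq_comm, ENNReal.ofReal_eq_one] at h1
  exact h1

theorem abs_min_sub_min_le (a b M : ℝ) : |min a M - min b M| ≤ |a - b| := by
  refine (abs_min_sub_min_le_max _ _ _ _).trans ?_
  rw [sub_self, abs_zero, max_eq_left (abs_nonneg _)]

theorem memLp_min {M : ℝ} (hM : 0 ≤ M) (hf : MemLp f 2 volume) (hf0 : ∀ x, 0 ≤ f x) :
    MemLp (fun x => min (f x) M) 2 volume := by
  refine hf.mono (hf.1.inf aestronglyMeasurable_const) (Eventually.of_forall fun x => ?_)
  rw [Real.norm_of_nonneg (le_min (hf0 x) hM), Real.norm_of_nonneg (hf0 x)]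
  exact min_le_left _ _

/-- A nonnegative maximiser is essentially bounded: cutting it off at a large height pays. -/
theorem IsMaximizer.exists_ae_le (hα : 0 < α) (h : IsMaximizer α f) (hf0 : ∀ x, 0 ≤ f x) :
    ∃ M : ℝ, 0 < M ∧ ∀ᵐ x, f x ≤ M := by
  have hS := h.J_sq_pos hα
  set S := J f ^ 2 with hSdef
  set K := 4 / S with hK
  have hK0 : 0 < K := by positivity
  set M := α + 2 * K with hM
  have hM0 : 0 < M := by positivity
  have hf2 := h.memLp_two hα
  set k : ℝ → ℝ := fun x => min (f x) M with hk
  have hk2 : MemLp k 2 volume := memLp_min hM0.le hf2 hf0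
  have hk0 : ∀ x, 0 ≤ k x := fun x => le_min (hf0 x) hM0.le
  have hD := J_sq_sub_le hf2 hk2 fun x y => abs_min_sub_min_le (f x) (f y) M
  have hle : ∀ x, Psi α (k x) ≤ Psi α (f x) := fun x => Psi_mono hα (hk0 x) (min_le_left _ _)
  have hmk : modular α k ≤ 1 := by
    rw [← h.modular_eq_one hα]
    exact lintegral_mono fun x => ENNReal.ofReal_le_ofReal (hle x)
  have hIk := Whitham.integrable_Psi hα hk2.1 (ne_top_of_le_ne_top ENNReal.one_ne_top hmk)
  have hIf := h.integrable_Psi hα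
  set q := ∫ x, Psi α (k x) with hq
  have hq1 : q ≤ 1 := by
    rw [← h.integral_Psi hα]
    exact integral_mono hIk hIf hle
  have hq0 : 0 ≤ q := integral_nonneg fun x => Psi_nonneg hα _
  have hmq : modular α k = ENNReal.ofReal q := modular_eq_ofReal hα hIk
  have hJk : J k ^ 2 ≤ (1 - (1 - q) / 2) * S := by
    rcases hq0.eq_or_lt with h0 | h0
    · have : k =ᵐ[volume] 0 := ae_eq_zero_of_modular hα hk2.1 (by rw [hmq, ← h0, ENNReal.ofReal_zero])
      rw [J_congr this, J_zero, ← h0]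
      norm_num
      positivity
    · refine (h.J_sq_le_sqrt hα hk2.1 h0 hq1 hmq.le).trans ?_
      refine mul_le_mul_of_nonneg_right ?_ hS.le
      rw [Real.sqrt_le_left (by linarith)]
      nlinarith [sq_nonneg (1 - q)]
  have hKd : K * ((∫ x, f x ^ 2) - ∫ x, k x ^ 2) ≤ 1 - q := by
    rw [← h.integral_Psi hα, hq, ← integral_sub hIf hIk, ← integral_sub hf2.integrable_sq hk2.integrable_sq,
      ← integral_const_mul]
    refine integral_mono ((hf2.integrable_sq.sub hk2.integrable_sq).const_mul K) (hIf.sub hIk) fun x => ?_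
    simp only [hk]
    rcases le_total (f x) M with h1 | h1
    · simp [min_eq_left h1]
    · rw [min_eq_right h1]
      exact Psi_sub_ge hα hK0 le_rfl h1
  -- By contraction S - J(k)² ≤ ∫ f² - ∫ k². The left side is at least (1 - q) S / 2 by `hJk`, the
  -- right side at most (1 - q) S / 4 by `hKd` with K = 4/S. Hence 1 - q ≤ 0 and the right side is
  -- not positive.
  have hzero : (∫ x, f x ^ 2) - ∫ x, k x ^ 2 ≤ 0 := by
    have e : K * S = 4 := by rw [hK]; field_simp
    by_contra hc
    push Not at hc
    have h1 := mul_le_mul_of_nonneg_right hKd hS.le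
    nlinarith
  refine ⟨M, hM0, ?_⟩
  have hnn : ∀ x, 0 ≤ f x ^ 2 - k x ^ 2 := fun x => by
    have : k x ≤ f x := min_le_left _ _
    nlinarith [hk0 x]
  rw [← integral_sub hf2.integrable_sq hk2.integrable_sq] at hzero
  have h2 := (integral_eq_zero_iff_of_nonneg hnn (hf2.integrable_sq.sub hk2.integrable_sq)).1
    (le_antisymm hzero (integral_nonneg hnn))
  filter_upwards [h2] with x hx
  by_contra hc
  push Not at hc
  have hx' : f x ^ 2 - k x ^ 2 = 0 := hx
  simp only [hk, min_eq_right hc.le] at hx'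
  nlinarith

/-- The pairing `∫ f Ψ'(f)` in terms of the explicit derivative. -/
noncomputable def pair (α : ℝ) (f : ℝ → ℝ) : ℝ := ∫ x, f x * dPsi α (f x)

theorem integrable_mul_dPsi (hα : 0 < α) (hf : MemLp f 2 volume) (hg : MemLp g 2 volume)
    (hf0 : ∀ x, 0 ≤ f x) {M : ℝ} (hM : ∀ x, f x ≤ M) : Integrable fun x => g x * dPsi α (f x) := by
  have hM0 : 0 ≤ M := (hf0 0).trans (hM 0)
  have h1 : MemLp (fun x => dPsi α (f x)) 2 volume := by
    refine (hf.const_mul (2 * α + 3 * M)).mono ((continuous_dPsi α).comp_aestronglyMeasurable hf.1)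
      (Eventually.of_forall fun x => ?_)
    rw [Real.norm_of_nonneg (dPsi_nonneg hα (hf0 x)), Real.norm_of_nonneg
      (mul_nonneg (by positivity) (hf0 x))]
    exact dPsi_le hα (hf0 x) (hM x)
  exact hg.integrable_mul h1

/-- The first variation of the constrained problem. -/
theorem IsMaximizer.variation (hα : 0 < α) (h : IsMaximizer α f) (hf0 : ∀ x, 0 ≤ f x) {M : ℝ}
    (hM : ∀ x, f x ≤ M) (hg : MemLp g 2 volume) {B : ℝ} (hB : ∀ x, |g x| ≤ B)
    (hneg : ∫ x, g x * dPsi α (f x) < 0) : ∫ x, g x * conv kernel f x ≤ 0 := by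
  have hW := isWhithamKernel_kernel
  have hf2 := h.memLp_two hα
  have hM0 : 0 ≤ M := (hf0 0).trans (hM 0)
  have hB0 : 0 ≤ B := (abs_nonneg _).trans (hB 0)
  set d := ∫ x, g x * dPsi α (f x) with hd
  set C := (3 * M + 5 * α) * ∫ x, g x ^ 2 with hC
  have hC0 : 0 ≤ C := mul_nonneg (by positivity) (integral_nonneg fun x => sq_nonneg _)
  -- The first bound brings t g within the range of the Taylor estimate; the second makes the
  -- quadratic remainder at most the negative linear term.
  set t : ℝ := min (α / (B + 1)) (-d / (C + 1)) with ht
  have ht0 : 0 < t := lt_min (by positivity) (div_pos (by linarith) (by positivity))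
  have htB : t * B ≤ α := by
    have h1 : t * (B + 1) ≤ α := (le_div_iff₀ (by positivity)).1 (min_le_left _ _)
    nlinarith
  have htC : t * C ≤ -d := by
    have h1 : t * (C + 1) ≤ -d := (le_div_iff₀ (by positivity)).1 (min_le_right _ _)
    nlinarith
  have htg : MemLp (fun x => t * g x) 2 volume := hg.const_mul t
  have hsum : MemLp (fun x => f x + t * g x) 2 volume := hf2.add htg
  have hpt : ∀ x, Psi α (f x + t * g x) ≤
      Psi α (f x) + t * (g x * dPsi α (f x)) + (3 * M + 5 * α) * t ^ 2 * g x ^ 2 := by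
    intro x
    have h1 : |t * g x| ≤ α := by
      rw [abs_mul, abs_of_pos ht0]
      exact (mul_le_mul_of_nonneg_left (hB x) ht0.le).trans htB
    have := Psi_taylor_le hα (hf0 x) (hM x) h1
    linarith
  have hI1 := h.integrable_Psi hα
  have hI2 := (integrable_mul_dPsi hα hf2 hg hf0 hM).const_mul t
  have hI3 := hg.integrable_sq.const_mul ((3 * M + 5 * α) * t ^ 2)
  have hI12 : Integrable fun x => Psi α (f x) + t * (g x * dPsi α (f x)) := hI1.add hI2
  have hI123 : Integrable fun x =>
      Psi α (f x) + t * (g x * dPsi α (f x)) + (3 * M + 5 * α) * t ^ 2 * g x ^ 2 := hI12.add hI3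
  have hmod : modular α (fun x => f x + t * g x) ≤ 1 := by
    calc modular α (fun x => f x + t * g x) ≤ ∫⁻ x, ENNReal.ofReal
          (Psi α (f x) + t * (g x * dPsi α (f x)) + (3 * M + 5 * α) * t ^ 2 * g x ^ 2) :=
          lintegral_mono fun x => ENNReal.ofReal_le_ofReal (hpt x)
      _ = ENNReal.ofReal (1 + t * d + t ^ 2 * C) := by
          rw [← ofReal_integral_eq_lintegral_ofReal hI123
            (Eventually.of_forall fun x => (Psi_nonneg hα _).trans (hpt x)),
            integral_add hI12 hI3, integral_add hI1 hI2, integral_const_mul, integral_const_mul,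
            h.integral_Psi hα, ← hd, hC]
          congr 1
          ring
      _ ≤ 1 := by
          rw [ENNReal.ofReal_le_one]
          nlinarith
  have h1 := h.J_le hα hsum.1 hmod
  have h2 : J (fun x => f x + t * g x) ^ 2 ≤ J f ^ 2 := pow_le_pow_left₀ (J_nonneg _) h1 2
  rw [J_add_sq hW hf2 htg, bil_comm hW hf2 htg, bil_smul_left, bil_eq_integral_conv hW hg hf2] at h2
  by_contra hc
  push Not at hc
  nlinarith [sq_nonneg (J fun x => t * g x), mul_pos ht0 hc]

theorem IsMaximizer.integral_mul_conv_self (hα : 0 < α) (h : IsMaximizer α f) :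
    ∫ x, f x * conv kernel f x = J f ^ 2 := by
  have hW := isWhithamKernel_kernel
  rw [J_sq_eq_bil hW (h.memLp_two hα), bil_eq_integral_conv hW (h.memLp_two hα) (h.memLp_two hα)]

theorem IsMaximizer.one_le_pair (hα : 0 < α) (h : IsMaximizer α f) (hf0 : ∀ x, 0 ≤ f x) {M : ℝ}
    (hM : ∀ x, f x ≤ M) : 1 ≤ pair α f := by
  have hf2 := h.memLp_two hα
  rw [← h.integral_Psi hα]
  refine integral_mono (h.integrable_Psi hα) (integrable_mul_dPsi hα hf2 hf2 hf0 hM) fun x => ?_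
  rcases (hf0 x).eq_or_lt with h0 | h0
  · simp [← h0, Psi_zero hα]
  · exact (Psi_lt_mul_dPsi hα h0).le

/-- `variation` needs a strictly negative constraint derivative, which subtracting η f provides
because the pairing is positive. Let η → 0, then replace g by -g. -/
theorem IsMaximizer.variation_eq_zero (hα : 0 < α) (h : IsMaximizer α f) (hf0 : ∀ x, 0 ≤ f x) {M : ℝ}
    (hM : ∀ x, f x ≤ M) (hg : MemLp g 2 volume) {B : ℝ} (hB : ∀ x, |g x| ≤ B)
    (hzero : ∫ x, g x * dPsi α (f x) = 0) : ∫ x, g x * conv kernel f x = 0 := by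
  have hW := isWhithamKernel_kernel
  have hf2 := h.memLp_two hα
  have hP := h.one_le_pair hα hf0 hM
  have hfM : ∀ x, |f x| ≤ M := fun x => by rw [abs_of_nonneg (hf0 x)]; exact hM x
  have key : ∀ k : ℝ → ℝ, MemLp k 2 volume → (∀ x, |k x| ≤ B) → ∫ x, k x * dPsi α (f x) = 0 →
      ∫ x, k x * conv kernel f x ≤ 0 := by
    intro k hk hkB hk0
    have hη : ∀ η : ℝ, 0 < η → ∫ x, k x * conv kernel f x ≤ η * J f ^ 2 := by
      intro η hη
      have hkf : MemLp (fun x => k x - η * f x) 2 volume := hk.sub (hf2.const_mul η)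
      have e1 : ∫ x, (k x - η * f x) * dPsi α (f x) = -(η * pair α f) := by
        have i1 := integrable_mul_dPsi hα hf2 hk hf0 hM
        have i2 := (integrable_mul_dPsi hα hf2 hf2 hf0 hM).const_mul η
        have e : (fun x => (k x - η * f x) * dPsi α (f x)) =
            fun x => k x * dPsi α (f x) - η * (f x * dPsi α (f x)) := by ext x; ring
        rw [e, integral_sub i1 i2, hk0, integral_const_mul, pair]
        ring
      have h1 := h.variation hα hf0 hM hkf (B := B + η * M) (fun x => by
        refine (abs_sub _ _).trans ?_
        rw [abs_mul, abs_of_pos hη]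
        exact add_le_add (hkB x) (mul_le_mul_of_nonneg_left (hfM x) hη.le)) (by
        rw [e1]
        nlinarith)
      have i1 := integrable_mul_conv hW hk hf2
      have i2 := (integrable_mul_conv hW hf2 hf2).const_mul η
      have e : (fun x => (k x - η * f x) * conv kernel f x) =
          fun x => k x * conv kernel f x - η * (f x * conv kernel f x) := by ext x; ring
      rw [e, integral_sub i1 i2, integral_const_mul, h.integral_mul_conv_self hα] at h1
      linarith
    refine le_of_forall_pos_le_add fun ε hε => ?_
    have hS := h.J_sq_pos hα
    have := hη (ε / J f ^ 2) (by positivity)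
    rw [div_mul_cancel₀ _ hS.ne'] at this
    linarith
  refine le_antisymm (key g hg hB hzero) ?_
  have := key (fun x => -g x) hg.neg (fun x => by rw [abs_neg]; exact hB x) (by
    simp only [neg_mul, integral_neg, hzero, neg_zero])
  simp only [neg_mul, integral_neg] at this
  linarith

/-- The Euler–Lagrange equation. -/
theorem IsMaximizer.euler_lagrange (hα : 0 < α) (h : IsMaximizer α f) (hf0 : ∀ x, 0 ≤ f x) {M : ℝ}
    (hM : ∀ x, f x ≤ M) :
    conv kernel f =ᵐ[volume] fun x => J f ^ 2 / pair α f * dPsi α (f x) := by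
  have hW := isWhithamKernel_kernel
  have hf2 := h.memLp_two hα
  have hP := h.one_le_pair hα hf0 hM
  have hP0 : pair α f ≠ 0 := by linarith
  have hM0 : 0 ≤ M := (hf0 0).trans (hM 0)
  have hfM : ∀ x, |f x| ≤ M := fun x => by rw [abs_of_nonneg (hf0 x)]; exact hM x
  set μ := J f ^ 2 / pair α f with hμ
  have hμ0 : 0 ≤ μ := div_nonneg (sq_nonneg _) (by linarith)
  set u : ℝ → ℝ := fun x => conv kernel f x - μ * dPsi α (f x) with hu
  have hum : AEStronglyMeasurable u volume :=
    (continuous_conv hW hf2.1 hfM).aestronglyMeasurable.sub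
      (((continuous_dPsi α).comp_aestronglyMeasurable hf2.1).const_mul μ)
  set B := M + μ * ((2 * α + 3 * M) * M) with hBdef
  have huB : ∀ x, |u x| ≤ B := by
    intro x
    refine (abs_sub _ _).trans ?_
    rw [abs_of_nonneg (conv_nonneg hW hf0 x), abs_of_nonneg (mul_nonneg hμ0 (dPsi_nonneg hα (hf0 x)))]
    refine add_le_add (conv_le hW hf2.1 hfM x) (mul_le_mul_of_nonneg_left ?_ hμ0)
    exact (dPsi_le hα (hf0 x) (hM x)).trans (mul_le_mul_of_nonneg_left (hM x) (by positivity))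
  have hB0 : 0 ≤ B := (abs_nonneg _).trans (huB 0)
  have key : ∀ n : ℕ, ∀ᵐ x, x ∈ Icc (-(n : ℝ)) n → u x = 0 := by
    intro n
    set A := Icc (-(n : ℝ)) n with hA
    set w : ℝ → ℝ := A.indicator u with hw
    have hwB : ∀ x, |w x| ≤ B := by
      intro x
      by_cases hx : x ∈ A
      · rw [hw, indicator_of_mem hx]; exact huB x
      · rw [hw, indicator_of_notMem hx, abs_zero]; exact hB0
    have hw2 : MemLp w 2 volume := by
      rw [hw, memLp_indicator_iff_restrict measurableSet_Icc]
      have : IsFiniteMeasure (volume.restrict A) := ⟨by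
        rw [Measure.restrict_apply_univ, hA, Real.volume_Icc]; exact ENNReal.ofReal_lt_top⟩
      exact MemLp.of_bound hum.restrict B (Eventually.of_forall huB)
    -- The defect u, cut to a bounded window, is made tangent to the constraint by subtracting c f.
    -- Testing the variation with it leaves exactly ∫ w² = 0.
    set c := (∫ x, w x * dPsi α (f x)) / pair α f with hc
    have hk2 : MemLp (fun x => w x - c * f x) 2 volume := hw2.sub (hf2.const_mul c)
    have i1 := integrable_mul_dPsi hα hf2 hw2 hf0 hM
    have i2 := (integrable_mul_dPsi hα hf2 hf2 hf0 hM).const_mul c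
    have j1 := integrable_mul_conv hW hw2 hf2
    have j2 := (integrable_mul_conv hW hf2 hf2).const_mul c
    have h1 := h.variation_eq_zero hα hf0 hM hk2 (B := B + |c| * M) (fun x => by
      refine (abs_sub _ _).trans ?_
      rw [abs_mul]
      exact add_le_add (hwB x) (mul_le_mul_of_nonneg_left (hfM x) (abs_nonneg _))) (by
      have e : (fun x => (w x - c * f x) * dPsi α (f x)) =
          fun x => w x * dPsi α (f x) - c * (f x * dPsi α (f x)) := by ext x; ring
      rw [e, integral_sub i1 i2, integral_const_mul, ← pair, hc, div_mul_cancel₀ _ hP0, sub_self])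
    have e : (fun x => (w x - c * f x) * conv kernel f x) =
        fun x => w x * conv kernel f x - c * (f x * conv kernel f x) := by ext x; ring
    rw [e, integral_sub j1 j2, integral_const_mul, h.integral_mul_conv_self hα] at h1
    have e2 : c * J f ^ 2 = ∫ x, μ * (w x * dPsi α (f x)) := by
      rw [integral_const_mul, hc, hμ]; ring
    rw [e2, ← integral_sub j1 (i1.const_mul μ)] at h1
    have e3 : ∀ x, w x * conv kernel f x - μ * (w x * dPsi α (f x)) = w x ^ 2 := by
      intro x
      by_cases hx : x ∈ A
      · rw [hw, indicator_of_mem hx, hu]; ring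
      · rw [hw, indicator_of_notMem hx]; ring
    simp only [e3] at h1
    rw [integral_eq_zero_iff_of_nonneg (fun x => sq_nonneg _) hw2.integrable_sq] at h1
    filter_upwards [h1] with x hx hxA
    have hx' : w x ^ 2 = 0 := hx
    rw [hw, indicator_of_mem hxA] at hx'
    exact pow_eq_zero_iff two_ne_zero |>.1 hx'
  filter_upwards [ae_all_iff.2 key] with x hx
  obtain ⟨n, hn⟩ := exists_nat_ge |x|
  have := hx n (abs_le.1 hn)
  rw [hu] at this
  exact sub_eq_zero.1 this

end Maximizer

/-! ### Continuous profiles and the pairing. -/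

/-- Continuous bell-shaped maximisers. -/
structure IsProfile (α : ℝ) (f : ℝ → ℝ) : Prop where
  isMaximizer : IsMaximizer α f
  continuous : Continuous f
  nonneg : ∀ x, 0 ≤ f x
  even : ∀ x, f (-x) = f x
  antitoneOn : AntitoneOn f (Ici 0)

section Profile

variable {α : ℝ} {f : ℝ → ℝ}

theorem IsMaximizer.isProfile (h : IsMaximizer α f) (hb : BellShaped f) (hc : Continuous f) :
    IsProfile α f := by
  obtain ⟨g, hg0, hge, hga, hfg⟩ := hb
  refine ⟨h, hc, fun x => ?_, fun x => ?_, fun x hx y hy hxy => ?_⟩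
  · have h1 : f =ᵐ[volume] fun x => |f x| := hfg.mono fun x hx => by
      simp only [hx, abs_of_nonneg (hg0 x)]
    rw [congrFun ((hc.ae_eq_iff_eq volume hc.abs).1 h1) x]
    exact abs_nonneg _
  · have h1 : (fun x => f (-x)) =ᵐ[volume] fun x => g (-x) :=
      (Measure.measurePreserving_neg (volume : Measure ℝ)).quasiMeasurePreserving.ae_eq_comp hfg
    have h2 : (fun x => f (-x)) =ᵐ[volume] f := by
      filter_upwards [h1, hfg] with z e1 e2
      rw [e1, e2, hge]
    exact congrFun (((hc.comp continuous_neg).ae_eq_iff_eq volume hc).1 h2) x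
  · have h1 : ∀ z : ℝ, ∀ᵐ d, f (z + d) = g (z + d) := fun z =>
      (measurePreserving_add_left volume z).quasiMeasurePreserving.ae_eq_comp hfg
    -- Shifting by almost every d > 0 reaches points where f agrees with the bell-shaped g;
    -- continuity then allows d = 0, even at x = 0, where the monotonicity of g says nothing.
    have h2 : (fun d => max (f (x + d)) (f (y + d))) =ᵐ[volume.restrict (Ici 0)] fun d => f (x + d) := by
      rw [← Measure.restrict_congr_set Ioi_ae_eq_Ici]
      filter_upwards [ae_restrict_of_ae (h1 x), ae_restrict_of_ae (h1 y),
        ae_restrict_mem measurableSet_Ioi] with d e1 e2 hd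
      have hd0 : 0 < d := hd
      rw [e1, e2]
      exact max_eq_left (hga (show 0 < x + d by linarith [mem_Ici.1 hx])
        (show 0 < y + d by linarith [mem_Ici.1 hy]) (by linarith))
    have h3 := Measure.eqOn_of_ae_eq h2 (by fun_prop) (by fun_prop)
      (by rw [interior_Ici, closure_Ioi]) (mem_Ici.2 le_rfl)
    simp only [add_zero] at h3
    rw [← h3]
    exact le_max_right _ _

/-- Every bell-shaped maximiser has a continuous representative. -/
theorem IsMaximizer.exists_continuous (hα : 0 < α) (h : IsMaximizer α f) (hb : BellShaped f) :
    ∃ g : ℝ → ℝ, Continuous g ∧ f =ᵐ[volume] g := by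
  obtain ⟨g, hg0, hge, hga, hfg⟩ := hb
  have hg := h.congr hα hfg
  obtain ⟨M, hM0, hM⟩ := hg.exists_ae_le hα hg0
  set k : ℝ → ℝ := fun x => min (g x) M with hk
  have hgk : g =ᵐ[volume] k := hM.mono fun x hx => (min_eq_left hx).symm
  have hkm := hg.congr hα hgk
  have hk0 : ∀ x, 0 ≤ k x := fun x => le_min (hg0 x) hM0.le
  have hkM : ∀ x, k x ≤ M := fun x => min_le_right _ _
  have hEL := hkm.euler_lagrange hα hk0 hkM
  have hP := hkm.one_le_pair hα hk0 hkM
  have hμ : J k ^ 2 / pair α k ≠ 0 := (div_pos (hkm.J_sq_pos hα) (by linarith)).ne'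
  have hc := continuous_conv isWhithamKernel_kernel hkm.aestronglyMeasurable
    (fun x => by rw [abs_of_nonneg (hk0 x)]; exact hkM x)
  -- The convolution is continuous, so the Euler–Lagrange equation can be solved for f through the
  -- continuous inverse of Ψ'.
  refine ⟨fun x => dPsiInv α (conv kernel k x / (J k ^ 2 / pair α k)),
    (continuous_dPsiInv α).comp (hc.div_const _), (hfg.trans hgk).trans ?_⟩
  filter_upwards [hEL] with x hx
  rw [hx, mul_div_cancel_left₀ _ hμ, dPsiInv_dPsi]

namespace IsProfile

theorem le_zero (h : IsProfile α f) (x : ℝ) : f x ≤ f 0 := by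
  have h1 : f x = f |x| := by
    rcases abs_choice x with e | e
    · rw [e]
    · rw [e, h.even]
  rw [h1]
  exact h.antitoneOn (mem_Ici.2 le_rfl) (mem_Ici.2 (abs_nonneg x)) (abs_nonneg x)

theorem antitone_abs (h : IsProfile α f) {x y : ℝ} (hxy : |x| ≤ |y|) : f y ≤ f x := by
  have h1 : ∀ x, f x = f |x| := fun x => by
    rcases abs_choice x with e | e
    · rw [e]
    · rw [e, h.even]
  rw [h1 x, h1 y]
  exact h.antitoneOn (mem_Ici.2 (abs_nonneg x)) (mem_Ici.2 (abs_nonneg y)) hxy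

theorem memLp_two (hα : 0 < α) (h : IsProfile α f) : MemLp f 2 volume := h.isMaximizer.memLp_two hα

theorem integral_sq_le (hα : 0 < α) (h : IsProfile α f) : ∫ x, f x ^ 2 ≤ 3 / α := by
  have := integral_sq_le_of_modular hα h.isMaximizer.aestronglyMeasurable zero_le_one
    (by rw [ENNReal.ofReal_one, h.isMaximizer.modular_eq_one hα])
  simpa using this

theorem conv_eq (hα : 0 < α) (h : IsProfile α f) (x : ℝ) :
    conv kernel f x = J f ^ 2 / pair α f * dPsi α (f x) := by
  have h1 := h.isMaximizer.euler_lagrange hα h.nonneg h.le_zero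
  have hc := continuous_conv isWhithamKernel_kernel h.isMaximizer.aestronglyMeasurable
    (M := f 0) (fun x => by rw [abs_of_nonneg (h.nonneg x)]; exact h.le_zero x)
  have hc2 : Continuous fun x => J f ^ 2 / pair α f * dPsi α (f x) :=
    continuous_const.mul ((continuous_dPsi α).comp h.continuous)
  exact congrFun ((hc.ae_eq_iff_eq volume hc2).1 h1) x

theorem pairing_eq (hα : 0 < α) (h : IsProfile α f) : pairing α f = pair α f :=
  integral_congr_ae (Eventually.of_forall fun x => mul_deriv_Psi hα (h.nonneg x))

theorem two_mul_sq_le (h : IsProfile α f) (hα : 0 < α) {r : ℝ} (hr : 0 ≤ r) :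
    2 * r * f r ^ 2 ≤ 3 / α := by
  refine le_trans ?_ (h.integral_sq_le hα)
  have h1 : ∫ x in Icc (-r) r, f r ^ 2 ≤ ∫ x in Icc (-r) r, f x ^ 2 := by
    refine setIntegral_mono_on (integrableOn_const (by rw [Real.volume_Icc]; exact ENNReal.ofReal_ne_top))
      (h.memLp_two hα).integrable_sq.integrableOn measurableSet_Icc fun x hx => ?_
    refine pow_le_pow_left₀ (h.nonneg r) (h.antitone_abs ?_) 2
    rw [abs_of_nonneg hr]
    exact abs_le.2 hx
  have h2 : ∫ x in Icc (-r) r, f x ^ 2 ≤ ∫ x, f x ^ 2 :=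
    setIntegral_le_integral (h.memLp_two hα).integrable_sq (Eventually.of_forall fun x => sq_nonneg _)
  rw [setIntegral_const, measureReal_def, Real.volume_Icc, ENNReal.toReal_ofReal (by linarith),
    smul_eq_mul] at h1
  linarith

theorem zero_pos (h : IsProfile α f) (hα : 0 < α) : 0 < f 0 := by
  rcases (h.nonneg 0).eq_or_lt with h0 | h0
  · exfalso
    have h1 : f = 0 := funext fun x => le_antisymm ((h.le_zero x).trans h0.ge) (h.nonneg x)
    have h2 := h.isMaximizer.modular_eq_one hα
    rw [h1, modular_zero hα] at h2
    exact zero_ne_one h2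
  · exact h0

/-- A profile attains every value in `(0, f 0]`. -/
theorem exists_eq (h : IsProfile α f) (hα : 0 < α) {y : ℝ} (hy : 0 < y) (hy0 : y ≤ f 0) :
    ∃ x, 0 ≤ x ∧ f x = y := by
  -- Were f(r) ≥ y, then 2 r f(r)² would be at least 6/α, against the bound 3/α.
  set r := 3 / (α * y ^ 2) with hr
  have hr0 : 0 < r := by positivity
  have h1 : f r < y := by
    by_contra hc
    push Not at hc
    have h2 := h.two_mul_sq_le hα hr0.le
    have h3 : 2 * r * y ^ 2 = 6 / α := by rw [hr]; field_simp; norm_num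
    have h4 : y ^ 2 ≤ f r ^ 2 := pow_le_pow_left₀ hy.le hc 2
    have h5 : 2 * r * y ^ 2 ≤ 2 * r * f r ^ 2 := by gcongr
    have h6 : 6 / α ≤ 3 / α := by linarith
    rw [div_le_div_iff_of_pos_right hα] at h6
    norm_num at h6
  obtain ⟨x, hx, hxy⟩ := intermediate_value_Icc' hr0.le h.continuous.continuousOn ⟨h1.le, hy0⟩
  exact ⟨x, hx.1, hxy⟩

theorem one_lt_pair (hα : 0 < α) (h : IsProfile α f) : 1 < pair α f := by
  have hf2 := h.memLp_two hα
  have i1 := h.isMaximizer.integrable_Psi hα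
  have i2 := integrable_mul_dPsi hα hf2 hf2 h.nonneg h.le_zero
  have hnn : ∀ x, 0 ≤ f x * dPsi α (f x) - Psi α (f x) := fun x => by
    rcases (h.nonneg x).eq_or_lt with h0 | h0
    · simp [← h0, Psi_zero hα]
    · linarith [Psi_lt_mul_dPsi hα h0]
  have h1 : 0 < ∫ x, (f x * dPsi α (f x) - Psi α (f x)) := by
    refine integral_pos_of_integrable_nonneg_nonzero (x := 0) ?_ (i2.sub i1) hnn ?_
    · exact (h.continuous.mul ((continuous_dPsi α).comp h.continuous)).sub
        ((continuous_Psi α).comp h.continuous)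
    · have := Psi_lt_mul_dPsi hα (h.zero_pos hα)
      exact (sub_pos.2 this).ne'
  rw [integral_sub i2 i1, h.isMaximizer.integral_Psi hα] at h1
  unfold pair
  linarith

/-- The pairing is compared with 2 ∫ Ψ(f) = 2. The difference 2Ψ(y) - yΨ'(y) equals y³/3 below α and
stays nonnegative up to `heightConst * α`, a root of the cubic. -/
theorem pair_lt_two (hα : 0 < α) (h : IsProfile α f) (h0 : f 0 ≤ heightConst * α) : pair α f < 2 := by
  have hf2 := h.memLp_two hα
  have i1 := (h.isMaximizer.integrable_Psi hα).const_mul 2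
  have i2 := integrable_mul_dPsi hα hf2 hf2 h.nonneg h.le_zero
  have hlow : ∀ y, 0 ≤ y → y < α → 2 * Psi α y - y * dPsi α y = y ^ 3 / 3 := fun y hy0 hy => by
    rw [Psi_of_lt hy0 hy, dPsi, if_pos hy]; ring
  have hnn : ∀ x, 0 ≤ 2 * Psi α (f x) - f x * dPsi α (f x) := fun x => by
    have hx0 := h.nonneg x
    rcases lt_or_ge (f x) α with hx | hx
    · rw [hlow _ hx0 hx]
      positivity
    · have hxt := (h.le_zero x).trans h0
      obtain ⟨hc, hc1, hc2⟩ := heightConst_spec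
      set t := heightConst
      rw [Psi_of_ge hα hx, dPsi, if_neg (not_lt.2 hx)]
      obtain ⟨s, hs⟩ : ∃ s, f x = α * s := ⟨f x / α, by field_simp⟩
      rw [hs] at hx hxt ⊢
      have hs1 : 1 ≤ s := by nlinarith
      have hst : s ≤ t := by nlinarith
      have h2 : 3 * s ^ 3 - 12 * s + 8 ≤ 0 := by
        have h4 : 0 ≤ s ^ 2 + s * t + t ^ 2 - 4 := by nlinarith
        have h5 := mul_nonneg (sub_nonneg.2 hst) h4
        linarith [show (t - s) * (s ^ 2 + s * t + t ^ 2 - 4) = t ^ 3 - s ^ 3 - 4 * (t - s) by ring]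
      have h3 : 0 ≤ α ^ 3 * -(3 * s ^ 3 - 12 * s + 8) := mul_nonneg (by positivity) (by linarith)
      linarith
  have h1 : 0 < ∫ x, (2 * Psi α (f x) - f x * dPsi α (f x)) := by
    -- Strictness needs one point with 0 < f(x) < α, where the integrand is f(x)³/3.
    obtain ⟨x, -, hx⟩ := h.exists_eq hα (y := min (f 0) (α / 2)) (lt_min (h.zero_pos hα) (by positivity))
      (min_le_left _ _)
    refine integral_pos_of_integrable_nonneg_nonzero (x := x) ?_ (i1.sub i2) hnn ?_
    · exact (((continuous_Psi α).comp h.continuous).const_mul 2).sub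
        (h.continuous.mul ((continuous_dPsi α).comp h.continuous))
    · have hp : 0 < f x := hx ▸ lt_min (h.zero_pos hα) (by positivity)
      have hl : f x < α := by
        have := min_le_right (f 0) (α / 2)
        rw [hx]; linarith
      rw [hlow _ hp.le hl]
      positivity
  rw [integral_sub i1 i2, integral_const_mul, h.isMaximizer.integral_Psi hα] at h1
  unfold pair
  linarith

end IsProfile

end Profile

/-! ### Slicing by height and the bound on the maximum. -/

/-- The odd primitive of `W`. -/
noncomputable def primitive (W : ℝ → ℝ) (x : ℝ) : ℝ := ∫ z in (0 : ℝ)..x, W z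

section Primitive

variable {W : ℝ → ℝ}

theorem primitive_neg (hW : IsWhithamKernel W) (x : ℝ) : primitive W (-x) = -primitive W x := by
  unfold primitive
  have := intervalIntegral.integral_comp_neg (a := 0) (b := x) W
  simp only [hW.even, neg_zero] at this
  rw [this, intervalIntegral.integral_symm]

theorem primitive_mono (hW : IsWhithamKernel W) : Monotone (primitive W) := by
  intro a b hab
  have h := intervalIntegral.integral_add_adjacent_intervals
    (hW.integrable.intervalIntegrable (a := 0) (b := a)) (hW.integrable.intervalIntegrable (a := a) (b := b))
  have h2 := intervalIntegral.integral_nonneg (μ := volume) hab fun z _ => hW.nonneg z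
  unfold primitive
  linarith

theorem abs_primitive_le (hW : IsWhithamKernel W) (x : ℝ) : |primitive W x| ≤ 1 := by
  rw [← Real.norm_eq_abs, ← hW.integral_eq_one]
  refine intervalIntegral.norm_integral_le_integral_norm_uIoc.trans ?_
  simp only [Real.norm_of_nonneg (hW.nonneg _)]
  exact setIntegral_le_integral hW.integrable (Eventually.of_forall hW.nonneg)

theorem setIntegral_Icc_kernel (hW : IsWhithamKernel W) (a : ℝ) {b : ℝ} (hb : 0 ≤ b) :
    ∫ y in Icc (-b) b, W (y - a) = primitive W (b - a) + primitive W (b + a) := by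
  rw [integral_Icc_eq_integral_Ioc, ← intervalIntegral.integral_of_le (by linarith),
    intervalIntegral.integral_comp_sub_right W a, show -b - a = -(b + a) by ring,
    ← sub_neg_eq_add (primitive W (b - a)), ← primitive_neg hW]
  have h := intervalIntegral.integral_add_adjacent_intervals
    (hW.integrable.intervalIntegrable (a := 0) (b := -(b + a)))
    (hW.integrable.intervalIntegrable (a := -(b + a)) (b := b - a))
  unfold primitive
  linarith

end Primitive

namespace IsProfile

variable {α : ℝ} {f : ℝ → ℝ}

/-- The half-width of the superlevel sets of a profile. -/
theorem exists_halfWidth (hα : 0 < α) (h : IsProfile α f) : ∃ r : ℝ → ℝ, AntitoneOn r (Ioc 0 (f 0)) ∧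
    ∀ t ∈ Ioc 0 (f 0), 0 ≤ r t ∧ f (r t) = t ∧ ∀ x, t ≤ f x ↔ |x| ≤ r t := by
  set S : ℝ → Set ℝ := fun t => {x | 0 ≤ x ∧ t ≤ f x} with hS
  have h0 : ∀ t ∈ Ioc 0 (f 0), (0 : ℝ) ∈ S t := fun t ht => ⟨le_rfl, ht.2⟩
  have hbd : ∀ t ∈ Ioc 0 (f 0), BddAbove (S t) := by
    intro t ht
    refine ⟨3 / (2 * α * t ^ 2), fun x hx => ?_⟩
    have ht0 : 0 < t := ht.1
    rw [le_div_iff₀ (by positivity)]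
    have h1 := h.two_mul_sq_le hα hx.1
    rw [le_div_iff₀ hα] at h1
    have h2 : t ^ 2 ≤ f x ^ 2 := pow_le_pow_left₀ ht0.le hx.2 2
    have h3 : x * (2 * α * t ^ 2) ≤ x * (2 * α * f x ^ 2) := by
      have := hx.1
      gcongr
    linarith
  have hcl : ∀ t, IsClosed (S t) := fun t =>
    isClosed_Ici.inter (isClosed_le continuous_const h.continuous)
  have hmem : ∀ t ∈ Ioc 0 (f 0), sSup (S t) ∈ S t := fun t ht =>
    (hcl t).csSup_mem ⟨0, h0 t ht⟩ (hbd t ht)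
  have habs : ∀ x, f x = f |x| := fun x => by
    rcases abs_choice x with e | e
    · rw [e]
    · rw [e, h.even]
  have hiff : ∀ t ∈ Ioc 0 (f 0), ∀ x, t ≤ f x ↔ |x| ≤ sSup (S t) := by
    intro t ht x
    constructor
    · intro hx
      exact le_csSup (hbd t ht) ⟨abs_nonneg x, by rwa [← habs]⟩
    · intro hx
      refine (hmem t ht).2.trans (h.antitone_abs ?_)
      rwa [abs_of_nonneg (hmem t ht).1]
  refine ⟨fun t => sSup (S t), ?_, fun t ht => ⟨(hmem t ht).1, ?_, hiff t ht⟩⟩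
  · intro s hs t ht hst
    exact csSup_le_csSup (hbd s hs) ⟨0, h0 t ht⟩ fun x hx => ⟨hx.1, hst.trans hx.2⟩
  · obtain ⟨x, hx0, hx⟩ := h.exists_eq hα ht.1 ht.2
    refine le_antisymm ?_ (hmem t ht).2
    have h1 : |x| ≤ sSup (S t) := (hiff t ht x).1 hx.ge
    calc f (sSup (S t)) ≤ f x := h.antitone_abs (by rwa [abs_of_nonneg (hmem t ht).1])
      _ = t := hx

/-- Write f(y) as the integral over t of the indicator of |y| ≤ r(t) and exchange the order; each
slice is an integral of W over a centred interval. -/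
theorem conv_eq_layer (h : IsProfile α f) {W r : ℝ → ℝ} (hW : IsWhithamKernel W)
    (hr : ∀ t ∈ Ioc 0 (f 0), 0 ≤ r t ∧ f (r t) = t ∧ ∀ x, t ≤ f x ↔ |x| ≤ r t) (a : ℝ) :
    conv W f a = ∫ t in Ioc 0 (f 0), (primitive W (r t - a) + primitive W (r t + a)) := by
  set T := Ioc 0 (f 0) with hT
  set E : Set (ℝ × ℝ) := {p | p.2 ≤ f p.1} with hE
  have hEm : MeasurableSet E :=
    measurableSet_le measurable_snd (h.continuous.measurable.comp measurable_fst)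
  have hfin : IsFiniteMeasure (volume.restrict T) := ⟨by
    rw [Measure.restrict_apply_univ, hT, Real.volume_Ioc]; exact ENNReal.ofReal_lt_top⟩
  have hI : Integrable (fun p : ℝ × ℝ => E.indicator (fun p => W (p.1 - a) * 1) p)
      (volume.prod (volume.restrict T)) :=
    ((hW.integrable.comp_sub_right a).mul_prod (integrable_const (1 : ℝ))).indicator hEm
  have h1 : ∀ y, ∫ t in T, E.indicator (fun p => W (p.1 - a) * 1) (y, t) = W (y - a) * f y := by
    intro y
    have e : ∀ t, E.indicator (fun p : ℝ × ℝ => W (p.1 - a) * 1) (y, t) =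
        (Iic (f y)).indicator (fun _ => W (y - a)) t := by
      intro t
      by_cases ht : t ≤ f y
      · rw [indicator_of_mem (show (y, t) ∈ E from ht), indicator_of_mem (show t ∈ Iic (f y) from ht),
          mul_one]
      · rw [indicator_of_notMem (show (y, t) ∉ E from ht),
          indicator_of_notMem (show t ∉ Iic (f y) from ht)]
    simp only [e]
    rw [setIntegral_indicator measurableSet_Iic, setIntegral_const, hT, Ioc_inter_Iic,
      min_eq_right (h.le_zero y), measureReal_def, Real.volume_Ioc, sub_zero,
      ENNReal.toReal_ofReal (h.nonneg y), smul_eq_mul, mul_comm]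
  have h2 : ∀ t ∈ T, ∫ y, E.indicator (fun p => W (p.1 - a) * 1) (y, t) =
      primitive W (r t - a) + primitive W (r t + a) := by
    intro t ht
    obtain ⟨hr0, -, hr2⟩ := hr t ht
    rw [← setIntegral_Icc_kernel hW a hr0, ← integral_indicator measurableSet_Icc]
    refine integral_congr_ae (Eventually.of_forall fun y => ?_)
    simp only
    by_cases hy : t ≤ f y
    · rw [indicator_of_mem (show (y, t) ∈ E from hy), 
        indicator_of_mem (show y ∈ Icc (-r t) (r t) from abs_le.1 ((hr2 y).1 hy)), mul_one]
    · rw [indicator_of_notMem (show (y, t) ∉ E from hy),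
        indicator_of_notMem (show y ∉ Icc (-r t) (r t) from fun hc => hy ((hr2 y).2 (abs_le.2 hc)))]
  rw [conv_eq_sub]
  simp only [← h1]
  rw [integral_integral_swap hI]
  exact setIntegral_congr_fun measurableSet_Ioc h2

/-- The height inequality behind the bound on `f 0`. -/
theorem mul_dPsi_zero_le (hα : 0 < α) (h : IsProfile α f) :
    f 0 * dPsi α (f 0) ≤ 2 * Psi α (f 0) := by
  have hW := isWhithamKernel_kernel
  obtain ⟨r, hra, hr⟩ := h.exists_halfWidth hα
  set W := kernel with hWdef
  set T := Ioc 0 (f 0) with hT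
  have h00 := h.zero_pos hα
  set μ := J f ^ 2 / pair α f with hμ
  have hμ0 : 0 < μ := div_pos (h.isMaximizer.J_sq_pos hα) (by linarith [h.one_lt_pair hα])
  have hfin : IsFiniteMeasure (volume.restrict T) := ⟨by
    rw [Measure.restrict_apply_univ, hT, Real.volume_Ioc]; exact ENNReal.ofReal_lt_top⟩
  have hrm : AEMeasurable r (volume.restrict T) := aemeasurable_restrict_of_antitoneOn measurableSet_Ioc hra
  have hGm : Measurable (primitive W) := (primitive_mono hW).measurable
  have hbdd : ∀ {β : Type} [MeasurableSpace β] (ν : Measure β) [IsFiniteMeasure ν] (u : β → ℝ),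
      AEMeasurable u ν → Integrable (fun x => primitive W (u x)) ν := by
    intro β _ ν _ u hu
    exact Integrable.of_bound (hGm.comp_aemeasurable hu).aestronglyMeasurable 1
      (Eventually.of_forall fun x => abs_primitive_le hW _)
  -- The equation is evaluated at x = r(s), where f takes the value s, so that s becomes the
  -- variable.
  have hEL : ∀ s ∈ T, μ * dPsi α s =
      ∫ t in T, (primitive W (r t - r s) + primitive W (r t + r s)) := by
    intro s hs
    rw [← h.conv_eq_layer hW hr, h.conv_eq hα, (hr s hs).2.1]
  set ν := volume.restrict T with hν
  have hm1 : AEMeasurable (fun p : ℝ × ℝ => r p.1) (ν.prod ν) := hrm.comp_fst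
  have hm2 : AEMeasurable (fun p : ℝ × ℝ => r p.2) (ν.prod ν) := hrm.comp_snd
  have iM : Integrable (fun p : ℝ × ℝ => primitive W (r p.2 - r p.1)) (ν.prod ν) :=
    hbdd _ _ (hm2.sub hm1)
  have iP : Integrable (fun p : ℝ × ℝ => primitive W (r p.2 + r p.1)) (ν.prod ν) :=
    hbdd _ _ (hm2.add hm1)
  -- The primitive is odd, so the integrand is antisymmetric under exchanging the two heights.
  have hanti : ∫ p, primitive W (r p.2 - r p.1) ∂(ν.prod ν) = 0 := by
    have h1 := integral_prod_swap (μ := ν) (ν := ν) (fun p : ℝ × ℝ => primitive W (r p.2 - r p.1))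
    have h2 : ∀ p : ℝ × ℝ, primitive W (r p.swap.2 - r p.swap.1) = -primitive W (r p.2 - r p.1) := by
      intro p
      rw [← primitive_neg hW, neg_sub, Prod.snd_swap, Prod.fst_swap]
    simp only [h2, integral_neg] at h1
    linarith
  -- Integrating over s turns Ψ'(s) into Ψ(f(0)) and leaves only the symmetric part.
  have hPsi : μ * Psi α (f 0) = ∫ p, primitive W (r p.2 + r p.1) ∂(ν.prod ν) := by
    rw [← integral_dPsi hα h00.le, ← intervalIntegral.integral_const_mul,
      intervalIntegral.integral_of_le h00.le, setIntegral_congr_fun measurableSet_Ioc hEL]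
    have iMP := iM.add iP
    have h3 := integral_prod _ iMP
    simp only [Pi.add_apply] at h3
    rw [← h3, integral_add iM iP, hanti, zero_add]
  have i1 : Integrable (fun p : ℝ × ℝ => primitive W (r p.1)) (ν.prod ν) := hbdd _ _ hm1
  have i2 : Integrable (fun p : ℝ × ℝ => primitive W (r p.2)) (ν.prod ν) := hbdd _ _ hm2
  have hνu : ν.real univ = f 0 := by
    rw [measureReal_def, hν, Measure.restrict_apply_univ, hT, Real.volume_Ioc, sub_zero,
      ENNReal.toReal_ofReal h00.le]
  -- The equation at the origin has a single height variable; multiplying by f(0) adds a second one,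
  -- and symmetrising puts it on the same square as `hPsi`.
  have h0 : f 0 * (μ * dPsi α (f 0)) =
      ∫ p : ℝ × ℝ, (primitive W (r p.1) + primitive W (r p.2)) ∂(ν.prod ν) := by
    rw [integral_add i1 i2, integral_fun_fst (fun x => primitive W (r x)),
      integral_fun_snd (fun x => primitive W (r x)), hνu, smul_eq_mul, ← h.conv_eq hα,
      h.conv_eq_layer hW hr]
    simp only [sub_zero, add_zero]
    rw [integral_add (hbdd _ _ hrm) (hbdd _ _ hrm)]
    ring
  have hle : ∫ p : ℝ × ℝ, (primitive W (r p.1) + primitive W (r p.2)) ∂(ν.prod ν) ≤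
      ∫ p : ℝ × ℝ, 2 * primitive W (r p.2 + r p.1) ∂(ν.prod ν) := by
    refine integral_mono_ae (i1.add i2) (iP.const_mul 2) ?_
    have hmem : ∀ᵐ p ∂(ν.prod ν), p ∈ T ×ˢ T := by
      rw [hν, Measure.prod_restrict]
      exact ae_restrict_mem (measurableSet_Ioc.prod measurableSet_Ioc)
    filter_upwards [hmem] with p hp
    have a1 := (hr p.1 hp.1).1
    have a2 := (hr p.2 hp.2).1
    have b1 := primitive_mono hW (show r p.1 ≤ r p.2 + r p.1 by linarith)
    have b2 := primitive_mono hW (show r p.2 ≤ r p.2 + r p.1 by linarith)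
    linarith
  rw [← h0, integral_const_mul, ← hPsi] at hle
  refine le_of_mul_le_mul_left ?_ hμ0
  linarith

/-- Beyond the largest root of the cubic one has yΨ'(y) > 2Ψ(y), against `mul_dPsi_zero_le`. -/
theorem zero_le_heightConst_mul (hα : 0 < α) (h : IsProfile α f) : f 0 ≤ heightConst * α := by
  obtain ⟨hc, hc1, hc2⟩ := heightConst_spec
  set t := heightConst
  by_contra hlt
  push Not at hlt
  have hx : α ≤ f 0 := by nlinarith
  have h1 := h.mul_dPsi_zero_le hα
  obtain ⟨s, hs⟩ : ∃ s, f 0 = α * s := ⟨f 0 / α, by field_simp⟩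
  rw [Psi_of_ge hα hx, dPsi, if_neg (not_lt.2 hx), hs] at h1
  rw [hs] at hlt
  have hst : t < s := by nlinarith
  have h4 : 0 < s ^ 2 + s * t + t ^ 2 - 4 := by nlinarith
  have h5 := mul_pos (sub_pos.2 hst) h4
  have h6 : 0 < 3 * s ^ 3 - 12 * s + 8 := by
    linarith [show (s - t) * (s ^ 2 + s * t + t ^ 2 - 4) = s ^ 3 - t ^ 3 - 4 * (s - t) by ring]
  have h7 : 0 < α ^ 3 * (3 * s ^ 3 - 12 * s + 8) := mul_pos (by positivity) h6
  linarith

end IsProfile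

/-! ### Uniform bounds: mass, decay, cube and height. -/

namespace IsProfile

variable {α : ℝ} {f : ℝ → ℝ}

theorem J_sq_le_integral (hα : 0 < α) (h : IsProfile α f) : J f ^ 2 ≤ 3 / α :=
  (J_sq_le (h.memLp_two hα)).trans (h.integral_sq_le hα)

theorem pair_mem (hα : 0 < α) (h : IsProfile α f) : 1 < pair α f ∧ pair α f < 2 :=
  ⟨h.one_lt_pair hα, h.pair_lt_two hα (h.zero_le_heightConst_mul hα)⟩

theorem one_div_lt_multiplier (hα : 0 < α) (h : IsProfile α f) :
    1 / (2 * α) < J f ^ 2 / pair α f := by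
  obtain ⟨h1, h2⟩ := h.pair_mem hα
  have h3 := h.isMaximizer.one_div_lt hα
  rw [div_lt_iff₀ hα] at h3
  rw [div_lt_div_iff₀ (by positivity) (by linarith)]
  linarith

/-- The gain of `exists_test` in scale-free form. It feeds both the mass bound and the lower bound
on ∫ f³. -/
theorem exists_gain : ∃ c : ℝ, 0 < c ∧ ∀ α : ℝ, 0 < α → ∀ f : ℝ → ℝ, IsMaximizer α f →
    1 + c * (1 / (1 + α ^ 2)) ≤ α * J f ^ 2 := by
  obtain ⟨c, hc, H⟩ := exists_test
  refine ⟨c, hc, fun α hα f h => ?_⟩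
  obtain ⟨g, hg, -, hg1, hJ⟩ := H α hα
  have h1 := h.J_le hα hg.measurable.aestronglyMeasurable hg1.le
  have h2 : J g ^ 2 ≤ J f ^ 2 := pow_le_pow_left₀ (J_nonneg _) h1 2
  have h3 := mul_le_mul_of_nonneg_left (hJ.trans h2) hα.le
  refine le_trans ?_ h3
  have h4 : 1 / (1 + α ^ 2) ≤ α * min (1 / α) (1 / α ^ 3) := by
    rw [mul_min_of_nonneg _ _ hα.le]
    refine le_min ?_ ?_
    · rw [mul_one_div_cancel hα.ne', div_le_one (by positivity)]
      nlinarith [sq_nonneg α]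
    · rw [show α * (1 / α ^ 3) = 1 / α ^ 2 by field_simp]
      exact one_div_le_one_div_of_le (by positivity) (by linarith)
  have h5 : α * (1 / α + c * min (1 / α) (1 / α ^ 3)) = 1 + c * (α * min (1 / α) (1 / α ^ 3)) := by
    field_simp
  rw [h5]
  linarith [mul_le_mul_of_nonneg_left h4 hc.le]

theorem integrable_cube (hα : 0 < α) (h : IsProfile α f) : Integrable fun x => f x ^ 3 := by
  refine ((h.memLp_two hα).integrable_sq.const_mul (f 0)).mono' (h.continuous.pow 3).aestronglyMeasurable
    (Eventually.of_forall fun x => ?_)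
  rw [Real.norm_of_nonneg (pow_nonneg (h.nonneg x) 3), pow_succ' (f x) 2]
  exact mul_le_mul_of_nonneg_right (h.le_zero x) (sq_nonneg _)

/-- Since Ψ(y) ≥ αy² - y³/3 and J(f)² ≤ ∫ f², the constraint would force αJ(f)² ≤ 1 without the
cubic term, so that term carries the gain. -/
theorem cube_lower_bound (hα : 0 < α) (h : IsProfile α f) :
    3 * (α * J f ^ 2 - 1) ≤ ∫ x, f x ^ 3 := by
  have i2 := (h.memLp_two hα).integrable_sq.const_mul α
  have i3 := (h.integrable_cube hα).const_mul (1 / 3)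
  have h1 : ∫ x, (α * f x ^ 2 - 1 / 3 * f x ^ 3) ≤ ∫ x, Psi α (f x) :=
    integral_mono (i2.sub i3) (h.isMaximizer.integrable_Psi hα) fun x => Psi_ge_cubic hα (h.nonneg x)
  rw [h.isMaximizer.integral_Psi hα, integral_sub i2 i3, integral_const_mul, integral_const_mul] at h1
  have h2 := mul_le_mul_of_nonneg_left (J_sq_le (h.memLp_two hα)) hα.le
  linarith

theorem memLp_three (hα : 0 < α) (h : IsProfile α f) : MemLp f 3 volume := by
  have := (integrable_norm_rpow_iff (p := 3) (f := f) (μ := volume) h.continuous.aestronglyMeasurable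
    (by norm_num) (by norm_num)).1
  refine this ((h.integrable_cube hα).congr (Eventually.of_forall fun x => ?_))
  simp only [ENNReal.toReal_ofNat]
  rw [Real.norm_of_nonneg (h.nonneg x)]
  exact (Real.rpow_natCast (f x) 3).symm

theorem lpNorm_three_pow (h : IsProfile α f) : lpNorm f 3 volume ^ 3 = ∫ x, f x ^ 3 := by
  rw [lpNorm_eq_integral_norm_rpow_toReal (by norm_num) (by norm_num) h.continuous.aestronglyMeasurable]
  have e : ∫ x, ‖f x‖ ^ (3 : ℝ≥0∞).toReal = ∫ x, f x ^ 3 := by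
    refine integral_congr_ae (Eventually.of_forall fun x => ?_)
    simp only [ENNReal.toReal_ofNat]
    rw [Real.norm_of_nonneg (h.nonneg x)]
    exact Real.rpow_natCast (f x) 3
  rw [e, ← Real.rpow_natCast, ← Real.rpow_mul (integral_nonneg fun x => pow_nonneg (h.nonneg x) 3)]
  norm_num

/-- A bathtub argument: among intervals of length 2T the centred one captures most of f. Moving it
trades points where f ≥ f(T) for points where f ≤ f(T), and the correction with weight f(T)
integrates to zero. -/
theorem setIntegral_shift_le (h : IsProfile α f) {T : ℝ} (hT : 0 ≤ T) (z : ℝ) :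
    ∫ x, (Icc (-T) T).indicator 1 x * f (x + z) ≤ ∫ x, (Icc (-T) T).indicator 1 x * f x := by
  set k : ℝ → ℝ := (Icc (-T) T).indicator 1 with hk
  have hk1 : Integrable k := (integrable_indicator_iff measurableSet_Icc).2
    (integrableOn_const (by rw [Real.volume_Icc]; exact ENNReal.ofReal_ne_top))
  have hkb : ∀ x, k x = 0 ∨ k x = 1 := fun x => by
    by_cases hx : x ∈ Icc (-T) T
    · exact Or.inr (by rw [hk, indicator_of_mem hx]; rfl)
    · exact Or.inl (by rw [hk, indicator_of_notMem hx])
  have hkf : ∀ x, k x = 1 → f T ≤ f x := fun x hx => by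
    refine h.antitone_abs ?_
    rw [abs_of_nonneg hT, abs_le]
    by_contra hc
    rw [hk, indicator_of_notMem (show x ∉ Icc (-T) T from hc)] at hx
    exact zero_ne_one hx
  have hkf' : ∀ x, k x = 0 → f x ≤ f T := fun x hx => by
    refine h.antitone_abs ?_
    rw [abs_of_nonneg hT]
    by_contra hc
    rw [hk, indicator_of_mem (show x ∈ Icc (-T) T from abs_le.1 (not_le.1 hc).le)] at hx
    exact one_ne_zero hx
  have hfb : ∀ x, ‖f x‖ ≤ f 0 := fun x => by rw [Real.norm_of_nonneg (h.nonneg x)]; exact h.le_zero x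
  have hks : Integrable fun x => k (x - z) := hk1.comp_sub_right z
  have j1 : Integrable fun x => k (x - z) * f x :=
    hks.mul_bdd h.continuous.aestronglyMeasurable (Eventually.of_forall hfb)
  have j2 : Integrable fun x => k x * f x :=
    hk1.mul_bdd h.continuous.aestronglyMeasurable (Eventually.of_forall hfb)
  have e1 : ∫ x, k x * f (x + z) = ∫ x, k (x - z) * f x := by
    rw [← integral_add_right_eq_self (fun x => k (x - z) * f x) z]
    simp only [add_sub_cancel_right]
  have j3 : Integrable fun x => f T * (k (x - z) - k x) := (hks.sub hk1).const_mul _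
  have e2 : ∫ x, (k x * f x + f T * (k (x - z) - k x)) = ∫ x, k x * f x := by
    rw [integral_add j2 j3, integral_const_mul, integral_sub hks hk1,
      integral_sub_right_eq_self k z, sub_self, mul_zero, add_zero]
  rw [e1, ← e2]
  refine integral_mono j1 (j2.add j3) fun x => ?_
  simp only
  rcases hkb (x - z) with a1 | a1 <;> rcases hkb x with a2 | a2
  · rw [a1, a2]; simp
  · rw [a1, a2]; linarith [hkf x a2]
  · rw [a1, a2]; linarith [hkf' x a2]
  · rw [a1, a2]; linarith

/-- Integrate K * f = μΨ'(f) ≥ μ(2αf - f²) over [-T, T]. The left side is at most the mass of f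
there, so (2αμ - 1) times that mass is at most μ ∫ f². A pairing below 2 gives 2αμ ≥ αJ(f)². -/
theorem setIntegral_bound (hα : 0 < α) (h : IsProfile α f) {T : ℝ} (hT : 0 ≤ T) :
    (α * J f ^ 2 - 1) * ∫ x in Icc (-T) T, f x ≤ 9 / α ^ 2 := by
  have hW := isWhithamKernel_kernel
  set k : ℝ → ℝ := (Icc (-T) T).indicator 1 with hk
  have hk2 : MemLp k 2 volume := memLp_indicator_const 2 measurableSet_Icc (1 : ℝ)
    (Or.inr (by rw [Real.volume_Icc]; exact ENNReal.ofReal_ne_top))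
  have hf2 := h.memLp_two hα
  have hkm : ∀ g : ℝ → ℝ, ∫ x, k x * g x = ∫ x in Icc (-T) T, g x := by
    intro g
    rw [← integral_indicator measurableSet_Icc]
    refine integral_congr_ae (Eventually.of_forall fun x => ?_)
    by_cases hx : x ∈ Icc (-T) T
    · simp only [hk, indicator_of_mem hx, Pi.one_apply, one_mul]
    · simp only [hk, indicator_of_notMem hx, zero_mul]
  set I := ∫ x in Icc (-T) T, f x with hI
  have hI0 : 0 ≤ I := integral_nonneg h.nonneg
  have h1 : ∫ x in Icc (-T) T, conv kernel f x ≤ I := by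
    rw [← hkm, ← bil_eq_integral_conv hW hk2 hf2, bil_eq_integral_shift hW hk2 hf2]
    have e : I = ∫ z, kernel z * I := by rw [integral_mul_const, hW.integral_eq_one, one_mul]
    rw [e]
    refine integral_mono ?_ (hW.integrable.mul_const I) fun z => ?_
    · refine (integrable_bil hW hk2 hf2).integral_prod_left.congr (Eventually.of_forall fun z => ?_)
      simp only [integral_const_mul]
    · refine mul_le_mul_of_nonneg_left ?_ (hW.nonneg z)
      rw [hI, ← hkm]
      exact h.setIntegral_shift_le hT z
  obtain ⟨hP1, hP2⟩ := h.pair_mem hα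
  have hS := h.isMaximizer.J_sq_pos hα
  have hS3 := h.J_sq_le_integral hα
  set μ := J f ^ 2 / pair α f with hμ
  have hμ0 : 0 < μ := div_pos hS (by linarith)
  have hμS : μ ≤ J f ^ 2 := div_le_self hS.le hP1.le
  have hμα : J f ^ 2 ≤ 2 * μ := by
    rw [hμ, ← mul_div_assoc, le_div_iff₀ (by linarith)]
    nlinarith
  have c1 : IntegrableOn f (Icc (-T) T) := h.continuous.continuousOn.integrableOn_Icc
  have c2 : IntegrableOn (fun x => f x ^ 2) (Icc (-T) T) := (h.continuous.pow 2).continuousOn.integrableOn_Icc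
  have c3 : IntegrableOn (fun x => conv kernel f x) (Icc (-T) T) := by
    simp only [h.conv_eq hα]
    exact (continuous_const.mul ((continuous_dPsi α).comp h.continuous)).continuousOn.integrableOn_Icc
  have h2 : ∫ x in Icc (-T) T, (2 * α * μ * f x - μ * f x ^ 2) ≤ ∫ x in Icc (-T) T, conv kernel f x := by
    refine integral_mono ((c1.const_mul _).sub (c2.const_mul _)) c3 fun x => ?_
    simp only [h.conv_eq hα]
    have := mul_le_mul_of_nonneg_left (le_dPsi (α := α) (f x)) hμ0.le
    linarith
  rw [integral_sub (c1.const_mul _) (c2.const_mul _), integral_const_mul, integral_const_mul, ← hI] at h2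
  have h3 : ∫ x in Icc (-T) T, f x ^ 2 ≤ 3 / α :=
    (setIntegral_le_integral hf2.integrable_sq (Eventually.of_forall fun x => sq_nonneg _)).trans
      (h.integral_sq_le hα)
  have h4 : μ * ∫ x in Icc (-T) T, f x ^ 2 ≤ 9 / α ^ 2 := by
    calc _ ≤ (3 / α) * (3 / α) := mul_le_mul (hμS.trans hS3) h3
          (integral_nonneg fun x => sq_nonneg _) (by positivity)
      _ = 9 / α ^ 2 := by field_simp; norm_num
  have h5 : (α * J f ^ 2 - 1) * I ≤ (2 * α * μ - 1) * I := by
    refine mul_le_mul_of_nonneg_right ?_ hI0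
    nlinarith
  linarith

theorem integrable_and_decay : ∃ C : ℝ, 0 < C ∧ ∀ α : ℝ, 0 < α → ∀ f : ℝ → ℝ, IsProfile α f →
    MemLp f 1 volume ∧ ∀ x : ℝ, lpNorm f 1 volume + |x * f x| ≤ C * (1 + α ^ (-2 : ℤ)) := by
  obtain ⟨c, hc, H⟩ := exists_gain
  -- One share of 9/c bounds the L¹ norm and the other bounds |x f(x)|, by monotonicity of f on
  -- [-|x|, |x|].
  refine ⟨2 * (9 / c), by positivity, fun α hα f h => ?_⟩
  set C := 9 / c * (1 + α ^ (-2 : ℤ)) with hC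
  have hbd : ∀ T, 0 ≤ T → ∫ x in Icc (-T) T, f x ≤ C := by
    intro T hT
    have h1 := h.setIntegral_bound hα hT
    have h2 := H α hα f h.isMaximizer
    have h3 : 0 ≤ ∫ x in Icc (-T) T, f x := integral_nonneg h.nonneg
    have h4 : c * (1 / (1 + α ^ 2)) * ∫ x in Icc (-T) T, f x ≤ 9 / α ^ 2 :=
      (mul_le_mul_of_nonneg_right (by linarith) h3).trans h1
    have h5 : C = 9 / α ^ 2 / (c * (1 / (1 + α ^ 2))) := by
      rw [hC, zpow_neg]
      have : α ^ (2 : ℤ) = α ^ 2 := by norm_cast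
      rw [this]
      field_simp
      ring
    rw [h5, le_div_iff₀ (by positivity)]
    linarith
  have hbd' : ∀ n : ℕ, ∫ x in (-(n : ℝ))..n, f x ≤ C := by
    intro n
    rw [intervalIntegral.integral_of_le (by linarith [n.cast_nonneg (α := ℝ)]),
      ← integral_Icc_eq_integral_Ioc]
    exact hbd n n.cast_nonneg
  have hb : Tendsto (fun n : ℕ => (n : ℝ)) atTop atTop := tendsto_natCast_atTop_atTop
  have ha : Tendsto (fun n : ℕ => -(n : ℝ)) atTop atBot := tendsto_neg_atTop_atBot.comp hb
  have hint : Integrable f := by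
    refine integrable_of_intervalIntegral_norm_bounded C
      (fun n : ℕ => h.continuous.integrableOn_Ioc) ha hb (Eventually.of_forall fun n => ?_)
    simp only [Real.norm_of_nonneg (h.nonneg _)]
    exact hbd' n
  have hle : ∫ x, f x ≤ C :=
    le_of_tendsto (intervalIntegral_tendsto_integral hint ha hb) (Eventually.of_forall hbd')
  refine ⟨memLp_one_iff_integrable.2 hint, fun x => ?_⟩
  have h1 : lpNorm f 1 volume ≤ C := by
    rw [lpNorm_one_eq_integral_norm h.continuous.aestronglyMeasurable]
    simpa only [Real.norm_of_nonneg (h.nonneg _)] using hle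
  have h2 : |x * f x| ≤ C := by
    rw [abs_mul, abs_of_nonneg (h.nonneg x)]
    have h3 : ∫ y in Icc (-|x|) |x|, f x ≤ ∫ y in Icc (-|x|) |x|, f y := by
      refine setIntegral_mono_on (integrableOn_const (by rw [Real.volume_Icc]; exact ENNReal.ofReal_ne_top))
        hint.integrableOn measurableSet_Icc fun y hy => h.antitone_abs (abs_le.2 hy)
    rw [setIntegral_const, measureReal_def, Real.volume_Icc,
      ENNReal.toReal_ofReal (by linarith [abs_nonneg x]), smul_eq_mul] at h3
    nlinarith [hbd |x| (abs_nonneg x), mul_nonneg (abs_nonneg x) (h.nonneg x)]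
  linarith

theorem exists_height_bound : ∃ C : ℝ, 0 < C ∧ ∀ α : ℝ, 0 < α → ∀ f : ℝ → ℝ, IsProfile α f →
    f 0 ≤ C * α ^ (-(1 / 2) : ℝ) := by
  have hW := isWhithamKernel_kernel
  -- The kernel has mass below 1/5 on [-r, r], so most of (K * f)(0) comes from |z| > r, where f ≤
  -- f(r).
  obtain ⟨r, hr0, hr⟩ : ∃ r : ℝ, 0 < r ∧ primitive kernel r < 1 / 10 := by
    have hc : Continuous (primitive kernel) := intervalIntegral.continuous_primitive
      (fun a b => hW.integrable.intervalIntegrable) 0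
    have h0 : primitive kernel 0 = 0 := intervalIntegral.integral_same
    have hev : ∀ᶠ r in 𝓝[>] (0 : ℝ), primitive kernel r < 1 / 10 := by
      have ht : Tendsto (primitive kernel) (𝓝[>] 0) (𝓝 (primitive kernel 0)) :=
        hc.continuousAt.continuousWithinAt
      exact ht.eventually_lt_const (by rw [h0]; norm_num)
    obtain ⟨r, h1, h2⟩ := (hev.and eventually_mem_nhdsWithin).exists
    exact ⟨r, h2, h1⟩
  refine ⟨Real.sqrt (24 / r), by positivity, fun α hα f h => ?_⟩
  have h1 : conv kernel f 0 ≤ 1 / 5 * f 0 + f r := by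
    have i1 : Integrable ((Icc (-r) r).indicator fun z => kernel z) := hW.integrable.indicator measurableSet_Icc
    have e : ∫ z, ((Icc (-r) r).indicator (fun z => kernel z) z * f 0 + kernel z * f r) =
        2 * primitive kernel r * f 0 + f r := by
      rw [integral_add (i1.mul_const _) (hW.integrable.mul_const _), integral_mul_const, integral_mul_const,
        hW.integral_eq_one, integral_indicator measurableSet_Icc, one_mul]
      have := setIntegral_Icc_kernel hW 0 hr0.le
      simp only [sub_zero, add_zero] at this
      rw [this]
      ring
    have h2 : conv kernel f 0 ≤ 2 * primitive kernel r * f 0 + f r := by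
      rw [← e]
      refine integral_mono (integrable_conv hW h.continuous.aestronglyMeasurable (M := f 0)
        (fun x => by rw [abs_of_nonneg (h.nonneg x)]; exact h.le_zero x) 0)
        ((i1.mul_const _).add (hW.integrable.mul_const _)) fun z => ?_
      simp only [zero_add]
      have hz := hW.nonneg z
      by_cases hzr : z ∈ Icc (-r) r
      · rw [indicator_of_mem hzr]
        nlinarith [mul_le_mul_of_nonneg_left (h.le_zero z) hz, mul_nonneg hz (h.nonneg r)]
      · rw [indicator_of_notMem hzr, zero_mul, zero_add]
        refine mul_le_mul_of_nonneg_left (h.antitone_abs ?_) hz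
        rw [abs_of_pos hr0]
        by_contra hc
        exact hzr (abs_le.1 (not_le.1 hc).le)
    nlinarith [h.zero_pos hα]
  have h2 : 9 / 20 * f 0 ≤ conv kernel f 0 := by
    rw [h.conv_eq hα]
    have h3 := linear_le_dPsi (α := α) (h.nonneg 0)
    have h4 := (h.one_div_lt_multiplier hα).le
    calc 9 / 20 * f 0 = 1 / (2 * α) * (9 / 10 * α * f 0) := by field_simp; ring
      _ ≤ _ := mul_le_mul h4 h3 (by have := h.nonneg 0; positivity) ((by positivity : (0:ℝ) ≤ 1 / (2 * α)).trans h4)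
  -- The constants leave 9/20 - 1/5 = 1/4. With 2 r f(r)² ≤ 3/α this becomes f(0)² ≤ 24/(rα).
  have h3 : f 0 ≤ 4 * f r := by linarith
  have h4 := h.two_mul_sq_le hα hr0.le
  have h5 : f 0 ^ 2 ≤ 24 / r / α := by
    have h6 : f 0 ^ 2 ≤ (4 * f r) ^ 2 := pow_le_pow_left₀ (h.nonneg 0) h3 2
    rw [div_div, le_div_iff₀ (by positivity)]
    rw [le_div_iff₀ hα] at h4
    have h7 := mul_le_mul_of_nonneg_right h6 (show 0 ≤ r * α by positivity)
    linarith
  have h6 := Real.le_sqrt_of_sq_le h5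
  rw [Real.sqrt_div (by positivity)] at h6
  rwa [Real.rpow_neg hα.le, ← Real.sqrt_eq_rpow, ← div_eq_mul_inv]

theorem lpNorm_top_le (h : IsProfile α f) : MemLp f ∞ volume ∧ lpNorm f ∞ volume ≤ f 0 := by
  have hb : ∀ x, ‖f x‖ ≤ f 0 := fun x => by rw [Real.norm_of_nonneg (h.nonneg x)]; exact h.le_zero x
  have hm : MemLp f ∞ volume := memLp_top_of_bound h.continuous.aestronglyMeasurable (f 0)
    (Eventually.of_forall hb)
  refine ⟨hm, ?_⟩
  rw [← toReal_eLpNorm hm.1]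
  refine ENNReal.toReal_le_of_le_ofReal (h.nonneg 0) ?_
  rw [eLpNorm_exponent_top]
  exact eLpNormEssSup_le_of_ae_bound (Eventually.of_forall hb)

end IsProfile

/-! ### Compactness and lower semicontinuity. -/

/-- Helly selection for uniformly bounded bell-shaped functions. -/
theorem exists_subseq_tendsto_of_isBell {u : ℕ → ℝ → ℝ} {A : ℝ} (hu : ∀ n, IsBell (u n))
    (hA : ∀ n x, u n x ≤ A) : ∃ φ : ℕ → ℕ, StrictMono φ ∧ ∃ f : ℝ → ℝ, IsBell f ∧ (∀ x, f x ≤ A) ∧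
      ∀ᵐ x, Tendsto (fun n => u (φ n) x) atTop (𝓝 (f x)) := by
  have hmem : ∀ n x, u n x ∈ Icc 0 A := fun n x => ⟨(hu n).nonneg x, hA n x⟩
  -- A countable product of compact intervals is sequentially compact, which replaces the diagonal
  -- argument over the rationals.
  obtain ⟨g, φ, hφ, hg⟩ := CompactSpace.tendsto_subseq
    (fun n => (fun q : ℚ => (⟨u n q, hmem n q⟩ : Icc (0 : ℝ) A)))
  have hgq : ∀ q : ℚ, Tendsto (fun n => u (φ n) q) atTop (𝓝 (g q : ℝ)) := fun q =>
    (continuous_subtype_val.tendsto _).comp ((tendsto_pi_nhds.1 hg) q)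
  have hganti : ∀ p q : ℚ, 0 < p → p ≤ q → (g q : ℝ) ≤ g p := fun p q hp hpq =>
    le_of_tendsto_of_tendsto' (hgq q) (hgq p) fun n => (hu (φ n)).antitoneOn
      (show (0 : ℝ) < p by exact_mod_cast hp) (show (0 : ℝ) < q by exact_mod_cast hp.trans_le hpq)
      (by exact_mod_cast hpq)
  set S : ℝ → Set ℝ := fun y => {t | ∃ q : ℚ, 0 < q ∧ y ≤ q ∧ t = g q} with hS
  have hSne : ∀ y, (S y).Nonempty := fun y => by
    obtain ⟨q, hq⟩ := exists_rat_gt (max y 0)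
    exact ⟨g q, q, by exact_mod_cast (le_max_right y 0).trans_lt hq, ((le_max_left y 0).trans_lt hq).le, rfl⟩
  have hSbd : ∀ y, BddAbove (S y) := fun y => ⟨A, by rintro _ ⟨q, -, -, rfl⟩; exact (g q).2.2⟩
  set F : ℝ → ℝ := fun y => sSup (S y) with hF
  have hFanti : Antitone F := fun x y hxy =>
    csSup_le_csSup (hSbd x) (hSne y) (by rintro _ ⟨q, h0, h1, rfl⟩; exact ⟨q, h0, hxy.trans h1, rfl⟩)
  have hFq : ∀ q : ℚ, 0 < q → F q = g q := fun q hq => by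
    refine le_antisymm (csSup_le (hSne q) ?_) (le_csSup (hSbd q) ⟨q, hq, le_rfl, rfl⟩)
    rintro _ ⟨p, -, hp, rfl⟩
    exact hganti q p hq (by exact_mod_cast hp)
  have hF0 : ∀ y, 0 ≤ F y := fun y => by
    obtain ⟨_, q, h0, h1, rfl⟩ := hSne y
    exact (g q).2.1.trans (le_csSup (hSbd y) ⟨q, h0, h1, rfl⟩)
  have hFA : ∀ y, F y ≤ A := fun y =>
    csSup_le (hSne y) (by rintro _ ⟨q, -, -, rfl⟩; exact (g q).2.2)
  -- At a continuity point the values at rationals on either side squeeze the sequence; a monotone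
  -- function has only countably many other points.
  have hconv : ∀ x, 0 < x → ContinuousAt F x → Tendsto (fun n => u (φ n) x) atTop (𝓝 (F x)) := by
    intro x hx hc
    rw [Metric.tendsto_atTop']
    intro ε hε
    obtain ⟨δ, hδ, hcδ⟩ := Metric.continuousAt_iff.1 hc (ε / 2) (by positivity)
    obtain ⟨p, hp1, hp2⟩ := exists_rat_btwn (show max 0 (x - δ) < x from max_lt hx (by linarith))
    obtain ⟨q, hq1, hq2⟩ := exists_rat_btwn (show x < x + δ by linarith)
    have hp0 : (0 : ℝ) < p := (le_max_left _ _).trans_lt hp1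
    have hpd : x - δ < p := (le_max_right _ _).trans_lt hp1
    have hq0 : (0 : ℝ) < q := hx.trans hq1
    have e1 := hcδ (show dist (p : ℝ) x < δ by rw [Real.dist_eq, abs_lt]; constructor <;> linarith)
    have e2 := hcδ (show dist (q : ℝ) x < δ by rw [Real.dist_eq, abs_lt]; constructor <;> linarith)
    rw [Real.dist_eq, abs_lt] at e1 e2
    rw [hFq p (by exact_mod_cast hp0)] at e1
    rw [hFq q (by exact_mod_cast hq0)] at e2
    have ev1 := (hgq p).eventually_lt_const (show (g p : ℝ) < g p + ε / 2 by linarith)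
    have ev2 := (hgq q).eventually_const_lt (show (g q : ℝ) - ε / 2 < g q by linarith)
    obtain ⟨N, hN⟩ := eventually_atTop.1 (ev1.and ev2)
    refine ⟨N, fun n hn => ?_⟩
    obtain ⟨h1, h2⟩ := hN n hn.le
    have h3 := (hu (φ n)).antitoneOn hp0 hx hp2.le
    have h4 := (hu (φ n)).antitoneOn hx hq0 hq1.le
    rw [Real.dist_eq, abs_lt]
    constructor <;> linarith
  refine ⟨φ, hφ, fun x => F |x|, ⟨fun x => hF0 _, fun x => by rw [abs_neg], ?_⟩, fun x => hFA _, ?_⟩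
  · intro x hx y hy hxy
    show F |y| ≤ F |x|
    rw [abs_of_pos (mem_Ioi.1 hx), abs_of_pos (mem_Ioi.1 hy)]
    exact hFanti hxy
  · have hae : ∀ᵐ x, ContinuousAt F x := by
      have := hFanti.countable_not_continuousAt.ae_notMem (volume : Measure ℝ)
      filter_upwards [this] with x hx
      by_contra hc
      exact hx hc
    have hae' : ∀ᵐ x : ℝ, ContinuousAt F (-x) :=
      (Measure.measurePreserving_neg (volume : Measure ℝ)).quasiMeasurePreserving.ae hae
    have hne : ∀ᵐ x : ℝ, x ≠ 0 := Measure.ae_ne volume 0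
    filter_upwards [hae, hae', hne] with x h1 h2 h3
    have h4 : ContinuousAt F |x| := by
      rcases abs_choice x with e | e <;> rw [e] <;> assumption
    have h5 := hconv |x| (abs_pos.2 h3) h4
    refine h5.congr fun n => ?_
    rcases abs_choice x with e | e
    · rw [e]
    · rw [e, (hu (φ n)).even]

theorem lintegral_le_of_tendsto_ae {X : Type*} [MeasurableSpace X] {ν : Measure X}
    {F : ℕ → X → ℝ≥0∞} {f : X → ℝ≥0∞} (hm : ∀ n, AEMeasurable (F n) ν)
    (hF : ∀ᵐ x ∂ν, Tendsto (fun n => F n x) atTop (𝓝 (f x))) {c : ℕ → ℝ≥0∞} {C : ℝ≥0∞}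
    (hc : ∀ n, ∫⁻ x, F n x ∂ν ≤ c n) (hC : Tendsto c atTop (𝓝 C)) : ∫⁻ x, f x ∂ν ≤ C := by
  calc ∫⁻ x, f x ∂ν = ∫⁻ x, liminf (fun n => F n x) atTop ∂ν :=
        lintegral_congr_ae (hF.mono fun x hx => hx.liminf_eq.symm)
    _ ≤ liminf (fun n => ∫⁻ x, F n x ∂ν) atTop := lintegral_liminf_le' hm
    _ ≤ liminf c atTop := liminf_le_liminf (Eventually.of_forall hc)
    _ = C := hC.liminf_eq

theorem diffForm_eq_lintegral_prod {W f : ℝ → ℝ} (hW : IsWhithamKernel W) (hf : Measurable f) :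
    diffForm W f = ∫⁻ p : ℝ × ℝ, ENNReal.ofReal (W p.1) * ENNReal.ofReal ((f (p.2 + p.1) - f p.2) ^ 2)
      ∂(volume.prod volume) := by
  have hm : Measurable fun p : ℝ × ℝ =>
      ENNReal.ofReal (W p.1) * ENNReal.ofReal ((f (p.2 + p.1) - f p.2) ^ 2) :=
    (hW.measurable.comp measurable_fst).ennreal_ofReal.mul
      (((hf.comp (measurable_snd.add measurable_fst)).sub (hf.comp measurable_snd)).pow_const 2).ennreal_ofReal
  rw [lintegral_prod _ hm.aemeasurable]
  refine lintegral_congr fun z => ?_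
  exact (lintegral_const_mul' _ _ ENNReal.ofReal_ne_top).symm

/-- Lower semicontinuity of `diffForm` under almost everywhere convergence. -/
theorem diffForm_le_of_tendsto {W f : ℝ → ℝ} {u : ℕ → ℝ → ℝ} (hW : IsWhithamKernel W)
    (hf : Measurable f) (hu : ∀ n, Measurable (u n))
    (hlim : ∀ᵐ x, Tendsto (fun n => u n x) atTop (𝓝 (f x))) {c : ℕ → ℝ≥0∞} {C : ℝ≥0∞}
    (hc : ∀ n, diffForm W (u n) ≤ c n) (hC : Tendsto c atTop (𝓝 C)) : diffForm W f ≤ C := by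
  rw [diffForm_eq_lintegral_prod hW hf]
  refine lintegral_le_of_tendsto_ae (F := fun n p => ENNReal.ofReal (W p.1) *
    ENNReal.ofReal ((u n (p.2 + p.1) - u n p.2) ^ 2)) (fun n => ?_) ?_
    (fun n => (diffForm_eq_lintegral_prod hW (hu n)).symm.le.trans (hc n)) hC
  · exact ((hW.measurable.comp measurable_fst).ennreal_ofReal.mul
      ((((hu n).comp (measurable_snd.add measurable_fst)).sub
        ((hu n).comp measurable_snd)).pow_const 2).ennreal_ofReal).aemeasurable
  · have h1 : ∀ᵐ p : ℝ × ℝ ∂(volume.prod volume), Tendsto (fun n => u n p.2) atTop (𝓝 (f p.2)) :=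
      Measure.quasiMeasurePreserving_snd.ae hlim
    have h2 : ∀ᵐ p : ℝ × ℝ ∂(volume.prod volume),
        Tendsto (fun n => u n (p.2 + p.1)) atTop (𝓝 (f (p.2 + p.1))) :=
      measurePreserving_shear.quasiMeasurePreserving.ae h1
    filter_upwards [h1, h2] with p e1 e2
    exact ENNReal.Tendsto.const_mul (ENNReal.tendsto_ofReal ((e2.sub e1).pow 2)) (Or.inr ENNReal.ofReal_ne_top)

/-! ### Truncation at height α for large α. -/

section Truncation

variable {α : ℝ} {f : ℝ → ℝ}

theorem IsBell.two_mul_sq_le (hb : IsBell f) (hf : MemLp f 2 volume) {r : ℝ} (hr : 0 < r) :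
    2 * r * f r ^ 2 ≤ ∫ x, f x ^ 2 := by
  have h1 : ∫ x in Icc (-r) r, f r ^ 2 ≤ ∫ x in Icc (-r) r, f x ^ 2 := by
    refine setIntegral_mono_on_ae (integrableOn_const (by rw [Real.volume_Icc]; exact ENNReal.ofReal_ne_top))
      hf.integrable_sq.integrableOn measurableSet_Icc ?_
    filter_upwards [Measure.ae_ne volume (0 : ℝ)] with x hx0 hx
    refine pow_le_pow_left₀ (hb.nonneg r) ?_ 2
    have h2 : f |x| = f x := by
      rcases abs_choice x with e | e
      · rw [e]
      · rw [e, hb.even]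
    rw [← h2]
    exact hb.antitoneOn (mem_Ioi.2 (abs_pos.2 hx0)) hr (abs_le.2 hx)
  have h2 : ∫ x in Icc (-r) r, f x ^ 2 ≤ ∫ x, f x ^ 2 :=
    setIntegral_le_integral hf.integrable_sq (Eventually.of_forall fun x => sq_nonneg _)
  rw [setIntegral_const, measureReal_def, Real.volume_Icc, ENNReal.toReal_ofReal (by linarith),
    smul_eq_mul] at h1
  linarith

theorem IsBell.min (hb : IsBell f) {M : ℝ} (hM : 0 ≤ M) : IsBell fun x => min (f x) M where
  nonneg x := le_min (hb.nonneg x) hM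
  even x := by rw [hb.even]
  antitoneOn x hx y hy hxy := min_le_min_right M (hb.antitoneOn hx hy hxy)

/-- The functional `J² - α⁻¹ ∫ Ψ`. -/
noncomputable def excess (α : ℝ) (f : ℝ → ℝ) : ℝ := J f ^ 2 - 1 / α * ∫ x, Psi α (f x)

/-- For large `α`, cutting a bell-shaped function off at height `α` does not decrease `excess`. -/
theorem exists_excess_min_ge : ∃ α₀ : ℝ, 0 < α₀ ∧ ∀ α : ℝ, α₀ < α → ∀ f : ℝ → ℝ, IsBell f →
    modular α f ≤ 1 → excess α f ≤ excess α fun x => min (f x) α := by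
  have hW := isWhithamKernel_kernel
  -- By absolute continuity every interval of length 2R carries at most 1/8 of the mass of the
  -- kernel.
  obtain ⟨R, hR0, hR⟩ : ∃ R : ℝ, 0 < R ∧ ∀ x, ∫ z in Icc (-R - x) (R - x), kernel z ≤ 1 / 8 := by
    have hfin : ∫⁻ z, ENNReal.ofReal (kernel z) ≠ ∞ := by
      rw [← ofReal_integral_eq_lintegral_ofReal hW.integrable (Eventually.of_forall hW.nonneg)]
      exact ENNReal.ofReal_ne_top
    obtain ⟨δ, hδ, H⟩ := exists_pos_setLIntegral_lt_of_measure_lt hfin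
      (show ENNReal.ofReal (1 / 8) ≠ 0 by norm_num)
    obtain ⟨R, hR0, hRδ⟩ : ∃ R : ℝ, 0 < R ∧ ENNReal.ofReal (2 * R) < δ := by
      have ht : Tendsto (fun R : ℝ => ENNReal.ofReal (2 * R)) (𝓝[>] 0) (𝓝 (ENNReal.ofReal (2 * 0))) :=
        (ENNReal.continuous_ofReal.comp (continuous_const.mul continuous_id)).continuousAt.continuousWithinAt
      rw [mul_zero, ENNReal.ofReal_zero] at ht
      obtain ⟨R, h1, h2⟩ := ((ht.eventually_lt_const hδ).and eventually_mem_nhdsWithin).exists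
      exact ⟨R, h2, h1⟩
    refine ⟨R, hR0, fun x => ?_⟩
    have h1 := H (Icc (-R - x) (R - x)) (by
      rw [Real.volume_Icc, show R - x - (-R - x) = 2 * R by ring]
      exact hRδ)
    rw [← ofReal_integral_eq_lintegral_ofReal hW.integrable.integrableOn
      (Eventually.of_forall hW.nonneg)] at h1
    exact ((ENNReal.ofReal_lt_ofReal_iff (by norm_num)).1 h1).le
  refine ⟨max 1 (96 / R), by positivity, fun α hα f hb hmod => ?_⟩
  have hα1 : 1 < α := (le_max_left _ _).trans_lt hα
  have hαR : 96 / R < α := (le_max_right _ _).trans_lt hα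
  have hα0 : 0 < α := by linarith
  have hfm := hb.measurable.aestronglyMeasurable (μ := volume)
  have hfin := ne_top_of_le_ne_top ENNReal.one_ne_top hmod
  have hf2 := memLp_two_of_modular hα0 hfm hfin
  set k : ℝ → ℝ := fun x => min (f x) α with hk
  have hkb : IsBell k := hb.min hα0.le
  have hk2 : MemLp k 2 volume := memLp_min hα0.le hf2 hb.nonneg
  have hkα : ∀ x, k x ≤ α := fun x => min_le_right _ _
  have hkf : ∀ x, k x ≤ f x := fun x => min_le_left _ _
  set w : ℝ → ℝ := fun x => f x - k x with hw
  have hw2 : MemLp w 2 volume := hf2.sub hk2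
  have hw0 : ∀ x, 0 ≤ w x := fun x => sub_nonneg.2 (hkf x)
  have hsum : (fun x => k x + w x) = f := by ext x; simp [hw]
  -- The threshold on α gives α³R ≥ 96, so that 2 R k(R)² ≤ 3/α forces this bound.
  have hkR : k R ≤ α / 8 := by
    have h1 := hkb.two_mul_sq_le hk2 hR0
    have h2 : ∫ x, k x ^ 2 ≤ 3 * 1 / α := by
      refine integral_sq_le_of_modular hα0 hk2.1 zero_le_one ?_
      rw [ENNReal.ofReal_one]
      exact (lintegral_mono fun x => ENNReal.ofReal_le_ofReal
        (Psi_mono hα0 (hkb.nonneg x) (hkf x))).trans hmod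
    have h3 := h1.trans h2
    rw [le_div_iff₀ hα0] at h3
    rw [div_lt_iff₀ hR0] at hαR
    by_contra hc
    push Not at hc
    have h4 : (α / 8) ^ 2 < k R ^ 2 := pow_lt_pow_left₀ hc (by positivity) two_ne_zero
    have h5 : 2 * R * α * (α / 8) ^ 2 < 2 * R * α * k R ^ 2 := by gcongr
    have h6 : 96 * 1 ≤ α * R * α ^ 2 := by
      refine mul_le_mul hαR.le ?_ zero_le_one (by positivity)
      nlinarith
    linarith
  -- One α/8 comes from the points of [-R, R], where k ≤ α but the kernel has little mass, the other
  -- from outside, where k ≤ α/8.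
  have hconv : ∀ x, conv kernel k x ≤ α / 4 := by
    intro x
    set A := Icc (-R - x) (R - x) with hA
    have i1 : Integrable (A.indicator fun z => kernel z) := hW.integrable.indicator measurableSet_Icc
    have e : ∫ z, (A.indicator (fun z => kernel z) z * α + kernel z * (α / 8)) =
        (∫ z in A, kernel z) * α + α / 8 := by
      rw [integral_add (i1.mul_const _) (hW.integrable.mul_const _), integral_mul_const, integral_mul_const,
        hW.integral_eq_one, integral_indicator measurableSet_Icc, one_mul]
    have h2 : conv kernel k x ≤ (∫ z in A, kernel z) * α + α / 8 := by
      rw [← e]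
      refine integral_mono_ae (integrable_conv hW hk2.1 (M := α)
        (fun y => by rw [abs_of_nonneg (hkb.nonneg y)]; exact hkα y) x)
        ((i1.mul_const _).add (hW.integrable.mul_const _)) (Eventually.of_forall fun z => ?_)
      simp only
      have hz := hW.nonneg z
      by_cases hzr : z ∈ A
      · rw [indicator_of_mem hzr]
        nlinarith [mul_le_mul_of_nonneg_left (hkα (x + z)) hz, mul_nonneg hz hα0.le]
      · rw [indicator_of_notMem hzr, zero_mul, zero_add]
        refine mul_le_mul_of_nonneg_left (le_trans ?_ hkR) hz
        have hlt : R < |x + z| := by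
          by_contra hc
          obtain ⟨h1, h2⟩ := abs_le.1 (not_lt.1 hc)
          exact hzr ⟨by linarith, by linarith⟩
        have h2 : k |x + z| = k (x + z) := by
          rcases abs_choice (x + z) with e | e
          · rw [e]
          · rw [e, hkb.even]
        rw [← h2]
        exact hkb.antitoneOn hR0 (hR0.trans hlt) hlt.le
    have h3 := mul_le_mul_of_nonneg_right (hR x) hα0.le
    linarith
  have hIf := integrable_Psi hα0 hfm hfin
  have hIk := integrable_Psi hα0 hk2.1 (ne_top_of_le_ne_top hfin (lintegral_mono fun x =>
    ENNReal.ofReal_le_ofReal (Psi_mono hα0 (hkb.nonneg x) (hkf x))))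
  have hJ : J f ^ 2 = J k ^ 2 + 2 * (∫ x, w x * conv kernel k x) + J w ^ 2 := by
    rw [← bil_eq_integral_conv hW hw2 hk2, bil_comm hW hw2 hk2, ← J_add_sq hW hk2 hw2, hsum]
  have j1 := (integrable_mul_conv hW hw2 hk2).const_mul 2
  -- Since Ψ(α + w) - Ψ(α) = α²w + w³, the saving per point is αw + w³/α. It covers the cross term,
  -- at most αw/2, and then w², which dominates J(w)² after integration.
  have hmain : 2 * (∫ x, w x * conv kernel k x) + ∫ x, w x ^ 2 ≤
      1 / α * ((∫ x, Psi α (f x)) - ∫ x, Psi α (k x)) := by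
    rw [← integral_sub hIf hIk, ← integral_const_mul, ← integral_const_mul,
      ← integral_add j1 hw2.integrable_sq]
    refine integral_mono (j1.add hw2.integrable_sq) ((hIf.sub hIk).const_mul _) fun x => ?_
    simp only
    rcases le_total (f x) α with h1 | h1
    · simp [hw, hk, min_eq_left h1]
    · have e1 : k x = α := min_eq_right h1
      have e2 : f x = α + w x := by rw [hw]; simp only; rw [e1]; ring
      rw [Psi_of_ge hα0 h1, e1, Psi_of_ge hα0 le_rfl, e2]
      have hx0 := hw0 x
      have h2 := mul_le_mul_of_nonneg_left (hconv x) hx0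
      have h3 : 1 / α * (2 / 3 * α ^ 3 + α ^ 2 * (α + w x - α) + (α + w x - α) ^ 3 -
          (2 / 3 * α ^ 3 + α ^ 2 * (α - α) + (α - α) ^ 3)) = α * w x + w x ^ 3 / α := by
        field_simp
        ring
      rw [h3]
      have h4 : w x ^ 2 ≤ α * w x / 2 + w x ^ 3 / α := by
        have h5 : α * w x / 2 + w x ^ 3 / α - w x ^ 2 =
            w x / (2 * α) * ((α - w x) ^ 2 + w x ^ 2) := by field_simp; ring
        have h6 : 0 ≤ w x / (2 * α) * ((α - w x) ^ 2 + w x ^ 2) := by positivity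
        linarith
      linarith
  have hJw := J_sq_le hw2
  unfold excess
  have e3 : 1 / α * ((∫ x, Psi α (f x)) - ∫ x, Psi α (k x)) =
    1 / α * (∫ x, Psi α (f x)) - 1 / α * ∫ x, Psi α (k x) := mul_sub _ _ _
  linarith

end Truncation

/-! ### Existence of a maximiser for large α. -/

section Existence

variable {α : ℝ} {f : ℝ → ℝ}

/-- Bell-shaped functions of height at most `α` and modular at most one. -/
def competitors (α : ℝ) : Set (ℝ → ℝ) := {f | IsBell f ∧ (∀ x, f x ≤ α) ∧ modular α f ≤ 1}

theorem memLp_two_of_competitor (hα : 0 < α) (hf : f ∈ competitors α) : MemLp f 2 volume :=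
  memLp_two_of_modular hα hf.1.measurable.aestronglyMeasurable
    (ne_top_of_le_ne_top ENNReal.one_ne_top hf.2.2)

theorem integral_sq_le_of_competitor (hα : 0 < α) (hf : f ∈ competitors α) : ∫ x, f x ^ 2 ≤ 3 / α := by
  have := integral_sq_le_of_modular hα hf.1.measurable.aestronglyMeasurable zero_le_one
    (by rw [ENNReal.ofReal_one]; exact hf.2.2)
  simpa using this

theorem integrable_cube_of_competitor (hα : 0 < α) (hf : f ∈ competitors α) :
    Integrable fun x => f x ^ 3 := by
  refine ((memLp_two_of_competitor hα hf).integrable_sq.const_mul α).mono'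
    (hf.1.measurable.pow_const 3).aestronglyMeasurable (Eventually.of_forall fun x => ?_)
  rw [Real.norm_of_nonneg (pow_nonneg (hf.1.nonneg x) 3), pow_succ' (f x) 2]
  exact mul_le_mul_of_nonneg_right (hf.2.1 x) (sq_nonneg _)

theorem integral_Psi_of_competitor (hα : 0 < α) (hf : f ∈ competitors α) :
    ∫ x, Psi α (f x) = α * (∫ x, f x ^ 2) - 1 / 3 * ∫ x, f x ^ 3 := by
  rw [← integral_const_mul, ← integral_const_mul, ← integral_sub
    ((memLp_two_of_competitor hα hf).integrable_sq.const_mul α)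
    ((integrable_cube_of_competitor hα hf).const_mul (1 / 3))]
  exact integral_congr_ae (Eventually.of_forall fun x => Psi_of_le hα (hf.1.nonneg x) (hf.2.1 x))

/-- Up to height α the function Ψ is a polynomial, and subtracting α⁻¹ ∫ Ψ cancels the bare L² norm.
What remains is a cubic term minus a nonnegative form, so L² mass escaping to infinity does no harm.
-/
theorem excess_of_competitor (hα : 0 < α) (hf : f ∈ competitors α) :
    excess α f = 1 / (3 * α) * (∫ x, f x ^ 3) - ((∫ x, f x ^ 2) - J f ^ 2) := by
  rw [excess, integral_Psi_of_competitor hα hf]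
  field_simp
  ring

/-- Height and L² bounds give f(x)² = O(1/(1 + |x|)), hence an integrable majorant of order
|x|^(-3/2) for the cubes. -/
theorem cube_le_of_competitor (hα : 0 < α) (hf : f ∈ competitors α) {x : ℝ} (hx : x ≠ 0) :
    f x ^ 3 ≤ (α ^ 2 + 3 / α) ^ (3 / 2 : ℝ) * (1 + ‖x‖) ^ (-(3 / 2) : ℝ) := by
  have h1 := hf.1.two_mul_sq_le (memLp_two_of_competitor hα hf) (abs_pos.2 hx)
  have h2 : f |x| = f x := by
    rcases abs_choice x with e | e
    · rw [e]
    · rw [e, hf.1.even]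
  rw [h2] at h1
  have h3 := h1.trans (integral_sq_le_of_competitor hα hf)
  have h0 := hf.1.nonneg x
  have h4 : f x ^ 2 ≤ α ^ 2 := pow_le_pow_left₀ h0 (hf.2.1 x) 2
  have h5 : f x ^ 2 ≤ (α ^ 2 + 3 / α) / (1 + |x|) := by
    rw [le_div_iff₀ (by positivity)]
    nlinarith [mul_nonneg (abs_nonneg x) (sq_nonneg (f x))]
  have h6 : f x ^ 3 = (f x ^ 2) ^ (3 / 2 : ℝ) := by
    rw [← Real.rpow_natCast (f x) 2, ← Real.rpow_mul h0, ← Real.rpow_natCast (f x) 3]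
    norm_num
  rw [h6, Real.norm_eq_abs, Real.rpow_neg (by positivity), ← div_eq_mul_inv,
    ← Real.div_rpow (by positivity) (by positivity)]
  exact Real.rpow_le_rpow (sq_nonneg _) h5 (by norm_num)

theorem excess_le_of_competitor (hα : 0 < α) (hf : f ∈ competitors α) : excess α f ≤ 3 / α := by
  have h1 := J_sq_le (memLp_two_of_competitor hα hf)
  have h2 := integral_sq_le_of_competitor hα hf
  have h3 : 0 ≤ 1 / α * ∫ x, Psi α (f x) :=
    mul_nonneg (by positivity) (integral_nonneg fun x => Psi_nonneg hα _)
  unfold excess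
  linarith

/-- `excess` attains its maximum over the competitors. -/
theorem exists_isMaxOn_excess (hα : 0 < α) : ∃ f ∈ competitors α, IsMaxOn (excess α) (competitors α) f := by
  have hW := isWhithamKernel_kernel
  have hne : (excess α '' competitors α).Nonempty := by
    obtain ⟨c, -, H⟩ := exists_test
    obtain ⟨g, h1, h2, h3, -⟩ := H α hα
    exact ⟨_, g, ⟨h1, h2, h3.le⟩, rfl⟩
  have hbd : BddAbove (excess α '' competitors α) :=
    ⟨3 / α, by rintro _ ⟨f, hf, rfl⟩; exact excess_le_of_competitor hα hf⟩
  set m := sSup (excess α '' competitors α) with hm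
  obtain ⟨a, -, ha, hmem⟩ := exists_seq_tendsto_sSup hne hbd
  choose u hu hua using hmem
  obtain ⟨φ, hφ, f, hfb, hfα, hlim⟩ :=
    exists_subseq_tendsto_of_isBell (fun n => (hu n).1) (fun n => (hu n).2.1)
  have hfm : f ∈ competitors α := by
    refine ⟨hfb, hfα, ?_⟩
    refine lintegral_le_of_tendsto_ae (F := fun n x => ENNReal.ofReal (Psi α (u (φ n) x)))
      (c := fun _ => 1) (fun n => aemeasurable_Psi α (hu _).1.measurable.aestronglyMeasurable) ?_
      (fun n => (hu (φ n)).2.2) tendsto_const_nhds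
    filter_upwards [hlim] with x hx
    exact ENNReal.tendsto_ofReal (((continuous_Psi α).tendsto _).comp hx)
  have hcube : Tendsto (fun n => ∫ x, u (φ n) x ^ 3) atTop (𝓝 (∫ x, f x ^ 3)) := by
    refine tendsto_integral_of_dominated_convergence
      (fun x => (α ^ 2 + 3 / α) ^ (3 / 2 : ℝ) * (1 + ‖x‖) ^ (-(3 / 2) : ℝ))
      (fun n => ((hu _).1.measurable.pow_const 3).aestronglyMeasurable) ?_ (fun n => ?_) ?_
    · exact (integrable_one_add_norm (by simp; norm_num)).const_mul _
    · filter_upwards [Measure.ae_ne volume (0 : ℝ)] with x hx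
      rw [Real.norm_of_nonneg (pow_nonneg ((hu _).1.nonneg x) 3)]
      exact cube_le_of_competitor hα (hu _) hx
    · filter_upwards [hlim] with x hx
      exact hx.pow 3
  set d : ℕ → ℝ := fun n => 1 / (3 * α) * (∫ x, u (φ n) x ^ 3) - a (φ n) with hd
  have hdlim : Tendsto d atTop (𝓝 (1 / (3 * α) * (∫ x, f x ^ 3) - m)) :=
    (hcube.const_mul _).sub (ha.comp hφ.tendsto_atTop)
  have hdn : ∀ n, d n = (∫ x, u (φ n) x ^ 2) - J (u (φ n)) ^ 2 := fun n => by
    have := excess_of_competitor hα (hu (φ n))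
    rw [hua] at this
    simp only [hd]
    linarith
  have hd0 : ∀ n, 0 ≤ d n := fun n => by
    rw [hdn]
    exact sub_nonneg.2 (J_sq_le (memLp_two_of_competitor hα (hu _)))
  -- Along the maximising sequence the cubic terms converge, so the forms converge as well; Fatou
  -- bounds the form of the limit, and `excess` can only go up.
  have hD := diffForm_le_of_tendsto hW hfb.measurable (fun n => (hu (φ n)).1.measurable) hlim
    (c := fun n => ENNReal.ofReal (2 * d n))
    (fun n => by rw [diffForm_eq hW (memLp_two_of_competitor hα (hu _)), hdn])
    (ENNReal.tendsto_ofReal (hdlim.const_mul 2))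
  rw [diffForm_eq hW (memLp_two_of_competitor hα hfm), ENNReal.ofReal_le_ofReal_iff
    (mul_nonneg zero_le_two (ge_of_tendsto' hdlim hd0))] at hD
  have hmf : m ≤ excess α f := by
    rw [excess_of_competitor hα hfm]
    linarith
  exact ⟨f, hfm, fun g hg => (le_csSup hbd ⟨g, hg, rfl⟩).trans hmf⟩

theorem volume_lt_le_of_memLp_two (hf : MemLp f 2 volume) {t : ℝ} (ht : 0 < t) :
    volume {y | t < f y} ≤ ENNReal.ofReal ((∫ x, f x ^ 2) / t ^ 2) := by
  have h1 := mul_meas_ge_le_lintegral₀ (μ := volume) (f := fun x => ENNReal.ofReal (f x ^ 2))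
    hf.integrable_sq.1.aemeasurable.ennreal_ofReal (ENNReal.ofReal (t ^ 2))
  rw [← ofReal_integral_eq_lintegral_ofReal hf.integrable_sq (Eventually.of_forall fun x => sq_nonneg _)] at h1
  rw [ENNReal.ofReal_div_of_pos (by positivity), ENNReal.le_div_iff_mul_le
    (Or.inl (by simpa using ht.ne')) (Or.inl ENNReal.ofReal_ne_top), mul_comm]
  refine le_trans (mul_le_mul_right (measure_mono fun x hx => ?_) _) h1
  exact ENNReal.ofReal_le_ofReal (pow_le_pow_left₀ ht.le (le_of_lt hx) 2)

/-- Symmetric rearrangement keeps the modular and does not decrease `J`. -/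
theorem exists_isBell_J_le (hα : 0 < α) {g : ℝ → ℝ} (hg : AEStronglyMeasurable g volume)
    (hfin : modular α g ≠ ∞) : ∃ p : ℝ → ℝ, IsBell p ∧ modular α p = modular α g ∧ J g ≤ J p := by
  have hW := isWhithamKernel_kernel
  -- Rearrangement is applied to a measurable nonnegative representative; passing to |g| keeps the
  -- modular and does not lower J.
  set k : ℝ → ℝ := fun x => |hg.mk g x| with hk
  have hkg : (fun x => |g x|) =ᵐ[volume] k := hg.ae_eq_mk.mono fun x hx => by simp only [hk, hx]
  have hk0 : ∀ x, 0 ≤ k x := fun x => abs_nonneg _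
  have hkm : Measurable k := hg.stronglyMeasurable_mk.measurable.abs
  have hmk : modular α k = modular α g := by
    rw [← modular_congr hkg]
    simp only [modular, Psi_abs]
  have hg2 := memLp_two_of_modular hα hg hfin
  have hk2 : MemLp k 2 volume := memLp_two_of_modular hα hkm.aestronglyMeasurable (hmk ▸ hfin)
  have hC : ∀ t, 0 < t → volume {y | t < k y} ≤ ENNReal.ofReal ((∫ x, k x ^ 2) / t ^ 2) :=
    fun t ht => volume_lt_le_of_memLp_two hk2 ht
  have hpm : modular α (rearr k) = modular α k :=
    lintegral_comp_rearr hk0 hkm hC (continuous_dPsi α) (fun t ht => dPsi_nonneg hα ht)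
      (fun y hy => integral_dPsi hα hy)
  have hp2 : MemLp (rearr k) 2 volume := memLp_two_of_modular hα
    (measurable_rearr hC).aestronglyMeasurable (by rw [hpm, hmk]; exact hfin)
  refine ⟨rearr k, ⟨rearr_nonneg k, rearr_neg k, rearr_antitoneOn hC⟩, hpm.trans hmk, ?_⟩
  have h1 := energy_le_rearr hW hkm hC
  rw [energy_eq hW hk0 hk2, energy_eq hW (rearr_nonneg k) hp2,
    ENNReal.ofReal_le_ofReal_iff (sq_nonneg _)] at h1
  have h2 := pow_le_pow_iff_left₀ (J_nonneg _) (J_nonneg _) two_ne_zero |>.1 h1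
  calc J g ≤ J fun x => |g x| := J_le_J_abs hg2
    _ = J k := J_congr hkg
    _ ≤ J (rearr k) := h2

theorem min_mem_competitors (hα : 0 < α) {p : ℝ → ℝ} (hp : IsBell p) (hm : modular α p ≤ 1) :
    (fun x => min (p x) α) ∈ competitors α := by
  refine ⟨hp.min hα.le, fun x => min_le_right _ _, le_trans (lintegral_mono fun x => ?_) hm⟩
  exact ENNReal.ofReal_le_ofReal (Psi_mono hα (le_min (hp.nonneg x) hα.le) (min_le_left _ _))

/-- For large `α` there is a bell-shaped maximiser of height at most `α`. -/
theorem exists_maximizer : ∃ α₀ : ℝ, 0 < α₀ ∧ ∀ α : ℝ, α₀ < α → ∃ f : ℝ → ℝ,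
    IsMaximizer α f ∧ IsBell f := by
  obtain ⟨α₀, hα₀, H⟩ := exists_excess_min_ge
  refine ⟨α₀, hα₀, fun α hα => ?_⟩
  have hα0 : 0 < α := hα₀.trans hα
  obtain ⟨f, hf, hmax⟩ := exists_isMaxOn_excess hα0
  have hpos : 0 < excess α f := by
    obtain ⟨c, hc, T⟩ := exists_test
    obtain ⟨g, h1, h2, h3, h4⟩ := T α hα0
    have h5 : excess α g ≤ excess α f := hmax ⟨h1, h2, h3.le⟩
    have hI := integrable_Psi hα0 h1.measurable.aestronglyMeasurable (h3 ▸ ENNReal.one_ne_top)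
    have h6 : ∫ x, Psi α (g x) = 1 := by
      have := modular_eq_ofReal hα0 hI
      rwa [h3, eq_comm, ENNReal.ofReal_eq_one] at this
    have h7 : 0 < c * min (1 / α) (1 / α ^ 3) := mul_pos hc (lt_min (by positivity) (by positivity))
    rw [excess, h6] at h5
    linarith
  have hfm := hf.1.measurable.aestronglyMeasurable (μ := volume)
  have hf2 := memLp_two_of_competitor hα0 hf
  have hfin := ne_top_of_le_ne_top ENNReal.one_ne_top hf.2.2
  have hI := integrable_Psi hα0 hfm hfin
  set θ := ∫ x, Psi α (f x) with hθ
  have hmodθ : modular α f = ENNReal.ofReal θ := modular_eq_ofReal hα0 hI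
  have hθ0 : 0 ≤ θ := integral_nonneg fun x => Psi_nonneg hα0 _
  have hθ1 : θ ≤ 1 := by
    have := hf.2.2
    rwa [hmodθ, ENNReal.ofReal_le_one] at this
  -- If the constraint were slack, dilating by s > 1 would multiply the positive `excess` by at
  -- least s², because Ψ(sy) ≤ s²Ψ(y) below α; truncation then returns to the competitors without
  -- loss, against maximality.
  have hθeq : θ = 1 := by
    by_contra hne
    have hlt : θ < 1 := lt_of_le_of_ne hθ1 hne
    obtain ⟨s, hs1, hs2, hsθ⟩ : ∃ s : ℝ, 1 < s ∧ s ≤ 2 ∧ s ^ 2 * θ ≤ 1 := by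
      have ht : Tendsto (fun s : ℝ => s ^ 2 * θ) (𝓝[>] 1) (𝓝 (1 ^ 2 * θ)) :=
        ((continuous_pow 2).mul continuous_const).continuousAt.continuousWithinAt
      rw [one_pow, one_mul] at ht
      have hev : ∀ᶠ s in 𝓝[>] (1 : ℝ), s ∈ Ioc (1 : ℝ) 2 := Ioc_mem_nhdsGT (by norm_num)
      obtain ⟨s, h1, h2, h3⟩ := ((ht.eventually_lt_const hlt).and hev).exists
      exact ⟨s, h2, h3, h1.le⟩
    set p : ℝ → ℝ := fun x => s * f x with hp
    have hpb : IsBell p := ⟨fun x => mul_nonneg (by linarith) (hf.1.nonneg x), fun x => by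
      simp only [hp, hf.1.even], fun x hx y hy hxy =>
      mul_le_mul_of_nonneg_left (hf.1.antitoneOn hx hy hxy) (by linarith)⟩
    have hPsi : ∀ x, Psi α (p x) ≤ s ^ 2 * Psi α (f x) := fun x =>
      Psi_mul_le_sq hα0 hs1.le hs2 (hf.1.nonneg x) (hf.2.1 x)
    have hpI : Integrable fun x => Psi α (p x) := (hI.const_mul (s ^ 2)).mono'
      ((continuous_Psi α).comp_aestronglyMeasurable (hfm.const_mul s)) (Eventually.of_forall fun x => by
        rw [Real.norm_of_nonneg (Psi_nonneg hα0 _)]; exact hPsi x)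
    have hple : ∫ x, Psi α (p x) ≤ s ^ 2 * θ := by
      rw [hθ, ← integral_const_mul]
      exact integral_mono hpI (hI.const_mul _) hPsi
    have hpm : modular α p ≤ 1 := by
      rw [modular_eq_ofReal hα0 hpI, ENNReal.ofReal_le_one]
      exact hple.trans hsθ
    have h1 := H α hα p hpb hpm
    have h2 : excess α (fun x => min (p x) α) ≤ excess α f := hmax (min_mem_competitors hα0 hpb hpm)
    have h3 : s ^ 2 * excess α f ≤ excess α p := by
      rw [excess, excess, J_smul s hf2]
      have := mul_le_mul_of_nonneg_left hple (show 0 ≤ 1 / α by positivity)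
      linarith
    have h4 : 1 < s ^ 2 := by nlinarith
    nlinarith
  have hmod1 : modular α f = 1 := by rw [hmodθ, hθeq, ENNReal.ofReal_one]
  refine ⟨f, ⟨mem_constraintSet_of_modular_eq_one hα0 hfm hmod1, fun g hg => ?_⟩, hf.1⟩
  have hg1 := modular_eq_one_of_mem hα0 hg
  -- For functions of modular one, `excess` and J² differ by the constant 1/α, so comparing `excess`
  -- compares J.
  obtain ⟨p, hpb, hpm, hJ⟩ := exists_isBell_J_le hα0 hg.1.1 (hg1 ▸ ENNReal.one_ne_top)
  rw [hg1] at hpm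
  have h1 := H α hα p hpb hpm.le
  have h2 : excess α (fun x => min (p x) α) ≤ excess α f := hmax (min_mem_competitors hα0 hpb hpm.le)
  have hpI := integrable_Psi hα0 hpb.measurable.aestronglyMeasurable (hpm ▸ ENNReal.one_ne_top)
  have h3 : ∫ x, Psi α (p x) = 1 := by
    have := modular_eq_ofReal hα0 hpI
    rwa [hpm, eq_comm, ENNReal.ofReal_eq_one] at this
  have h4 := h1.trans h2
  rw [excess, excess, h3, ← hθ, hθeq] at h4
  have h5 : J p ^ 2 ≤ J f ^ 2 := by linarith
  exact hJ.trans (pow_le_pow_iff_left₀ (J_nonneg _) (J_nonneg _) two_ne_zero |>.1 h5)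

/-- The height bound C α^(-1/2) is below α once α exceeds both 1 and C, so any bell-shaped maximiser
then stays strictly below the threshold. -/
theorem exists_low_maximizer : ∃ α₀ : ℝ, 0 ≤ α₀ ∧ ∀ α : ℝ, α₀ < α → ∃ f : ℝ → ℝ, IsMaximizer α f ∧
    BellShaped f ∧ Continuous f ∧ f 0 < α := by
  obtain ⟨α₁, hα₁, H⟩ := exists_maximizer
  obtain ⟨C, hC, HC⟩ := IsProfile.exists_height_bound
  refine ⟨max α₁ (max 1 C), hα₁.le.trans (le_max_left _ _), fun α hα => ?_⟩
  have h1 : α₁ < α := (le_max_left _ _).trans_lt hα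
  have h2 : 1 < α := (le_max_left _ _).trans_lt ((le_max_right _ _).trans_lt hα)
  have h3 : C < α := (le_max_right _ _).trans_lt ((le_max_right _ _).trans_lt hα)
  have hα0 : 0 < α := by linarith
  obtain ⟨f, hf, hb⟩ := H α h1
  have hbf : BellShaped f := ⟨f, hb.nonneg, hb.even, hb.antitoneOn, ae_eq_rfl⟩
  obtain ⟨g, hg, hfg⟩ := hf.exists_continuous hα0 hbf
  have hgm := hf.congr hα0 hfg
  have hbg : BellShaped g := ⟨f, hb.nonneg, hb.even, hb.antitoneOn, hfg.symm⟩
  refine ⟨g, hgm, hbg, hg, ?_⟩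
  have h4 := HC α hα0 g (hgm.isProfile hbg hg)
  have h5 : α ^ (-(1 / 2) : ℝ) ≤ 1 := Real.rpow_le_one_of_one_le_of_nonpos h2.le (by norm_num)
  nlinarith

end Existence

end Whitham

theorem mainTheorem4 :
    -- every bell-shaped maximiser has a continuous representative
    (∀ α : ℝ, 0 < α → ∀ f : ℝ → ℝ, Whitham.IsMaximizer α f → Whitham.BellShaped f →
      ∃ g : ℝ → ℝ, Continuous g ∧ f =ᵐ[volume] g) ∧
    -- the bound on the height
    |Whitham.heightConst - 1.48| < 0.005 ∧
    (∀ α : ℝ, 0 < α → ∀ f : ℝ → ℝ, Whitham.IsMaximizer α f → Whitham.BellShaped f →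
      Continuous f → f 0 ≤ Whitham.heightConst * α) ∧
    -- the bounds on the pairing
    (∀ α : ℝ, 0 < α → ∀ f : ℝ → ℝ, Whitham.IsMaximizer α f → Whitham.BellShaped f →
      Continuous f → 1 < Whitham.pairing α f ∧ Whitham.pairing α f < 2) ∧
    -- the uniform integral and decay bound
    (∃ C : ℝ, 0 < C ∧ ∀ α : ℝ, 0 < α → ∀ f : ℝ → ℝ, Whitham.IsMaximizer α f →
      Whitham.BellShaped f → Continuous f →
        MemLp f 1 volume ∧ ∀ x : ℝ, lpNorm f 1 volume + |x * f x| ≤ C * (1 + α ^ (-2 : ℤ))) ∧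
    -- the uniform non-degeneracy
    (∃ c : ℝ, 0 < c ∧ ∀ α : ℝ, 0 < α → ∀ f : ℝ → ℝ, Whitham.IsMaximizer α f →
      Whitham.BellShaped f → Continuous f →
        MemLp f 3 volume ∧ c * (1 / (1 + α ^ 2)) ≤ lpNorm f 3 volume ^ 3) ∧
    -- the uniform supremum bound, over all `α > 0` for `0 < δ ≤ 3/2`
    (∀ δ : ℝ, 0 < δ → δ ≤ 3 / 2 → ∃ C : ℝ, 0 < C ∧ ∀ α : ℝ, 0 < α → ∀ f : ℝ → ℝ,
      Whitham.IsMaximizer α f → Whitham.BellShaped f → Continuous f →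
        MemLp f ∞ volume ∧ lpNorm f ∞ volume ≤ C * α ^ (-(1 / 2) + δ)) ∧
    -- the supremum bound for every `δ > 0`, uniform for `α` bounded away from zero
    (∀ δ : ℝ, 0 < δ → ∀ α₁ : ℝ, 0 < α₁ → ∃ C : ℝ, 0 < C ∧ ∀ α : ℝ, α₁ ≤ α → ∀ f : ℝ → ℝ,
      Whitham.IsMaximizer α f → Whitham.BellShaped f → Continuous f →
        MemLp f ∞ volume ∧ lpNorm f ∞ volume ≤ C * α ^ (-(1 / 2) + δ)) ∧
    -- for large `α` some bell-shaped maximiser stays below the threshold height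
    (∃ α₀ : ℝ, 0 ≤ α₀ ∧ ∀ α : ℝ, α₀ < α → ∃ f : ℝ → ℝ, Whitham.IsMaximizer α f ∧
      Whitham.BellShaped f ∧ Continuous f ∧ f 0 < α) := by
  open Whitham in
  refine ⟨fun α hα f hf hb => hf.exists_continuous hα hb, ?_, ?_, ?_, ?_, ?_, ?_, ?_,
    exists_low_maximizer⟩
  · obtain ⟨-, h1, h2⟩ := heightConst_spec
    rw [abs_lt]
    constructor <;> linarith
  · exact fun α hα f hf hb hc => (hf.isProfile hb hc).zero_le_heightConst_mul hα
  · intro α hα f hf hb hc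
    have h := hf.isProfile hb hc
    rw [h.pairing_eq hα]
    exact h.pair_mem hα
  · obtain ⟨C, hC, H⟩ := IsProfile.integrable_and_decay
    exact ⟨C, hC, fun α hα f hf hb hc => H α hα f (hf.isProfile hb hc)⟩
  · obtain ⟨c, hc, H⟩ := IsProfile.exists_gain
    refine ⟨3 * c, by positivity, fun α hα f hf hb hcont => ?_⟩
    have h := hf.isProfile hb hcont
    refine ⟨h.memLp_three hα, ?_⟩
    rw [h.lpNorm_three_pow]
    linarith [H α hα f hf, h.cube_lower_bound hα]
  · intro δ hδ hδ1
    obtain ⟨C, hC, H⟩ := IsProfile.exists_height_bound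
    refine ⟨C + 2, by positivity, fun α hα f hf hb hc => ?_⟩
    have h := hf.isProfile hb hc
    obtain ⟨h1, h2⟩ := h.lpNorm_top_le
    refine ⟨h1, h2.trans ?_⟩
    have hp : 0 < α ^ (-(1 / 2) + δ) := Real.rpow_pos_of_pos hα _
    rcases le_or_gt 1 α with h3 | h3
    · have h4 : α ^ (-(1 / 2) : ℝ) ≤ α ^ (-(1 / 2) + δ) :=
        Real.rpow_le_rpow_of_exponent_le h3 (by linarith)
      have h5 := mul_le_mul_of_nonneg_left h4 hC.le
      linarith [H α hα f h]
    -- For small α the linear height bound is used instead; α ≤ α^(-1/2 + δ) for α < 1 requires -1/2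
    -- + δ ≤ 1, which is the origin of the restriction δ ≤ 3/2.
    · have h4 : α ^ (1 : ℝ) ≤ α ^ (-(1 / 2) + δ) :=
        Real.rpow_le_rpow_of_exponent_ge hα h3.le (by linarith)
      rw [Real.rpow_one] at h4
      have h5 : heightConst * α ≤ 2 * α :=
        mul_le_mul_of_nonneg_right (by linarith [heightConst_spec.2.2]) hα.le
      have h6 := mul_pos hC hp
      linarith [h.zero_le_heightConst_mul hα]
  · intro δ hδ α₁ hα₁
    obtain ⟨C, hC, H⟩ := IsProfile.exists_height_bound
    have hp : 0 < α₁ ^ (-δ) := Real.rpow_pos_of_pos hα₁ _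
    refine ⟨C * α₁ ^ (-δ), by positivity, fun α hα f hf hb hc => ?_⟩
    have hα0 : 0 < α := hα₁.trans_le hα
    have h := hf.isProfile hb hc
    obtain ⟨h1, h2⟩ := h.lpNorm_top_le
    refine ⟨h1, h2.trans ((H α hα0 f h).trans ?_)⟩
    -- The bound α^(-1/2) holds without any δ, so away from zero the surplus factor α^(-δ) is
    -- absorbed in the constant.
    have h3 : α ^ (-δ) ≤ α₁ ^ (-δ) := Real.rpow_le_rpow_of_nonpos hα₁ hα (by linarith)
    have h4 : α ^ (-(1 / 2) : ℝ) = α ^ (-δ) * α ^ (-(1 / 2) + δ) := by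
      rw [← Real.rpow_add hα0]
      congr 1
      ring
    rw [h4, mul_assoc C]
    exact mul_le_mul_of_nonneg_left
      (mul_le_mul_of_nonneg_right h3 (Real.rpow_nonneg hα0.le _)) hC.le
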